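/- Let $\mathcal C$ be a category with finite limits and let $\pi\colon\tilde U\to U$ be a universal map in $\mathcal C$, that is, an exponentiable morphism with a choice of pullbacks along $\pi$ (a right adjoint of post-composition $\pi_!\colon\mathcal C/\tilde U\to\mathcal C/U$); write $\pi_*$ for the pushforward, the right adjoint of pullback along $\pi$. A $\pi$-fibration $E\to B$ is a map equipped with a $\pi$-fibrancy structure: maps $e\colon B\to U$ (the name) and $\tilde e\colon E\to\tilde U$ (the point) exhibiting $E\to B$ as a pullback of $\pi$ along $e$. The chosen pullback of $\pi$ along $a\colon A\to U$ is the selected $\pi$-fibration with name $a$; the selected base change along $f\colon A'\to A$ of a $\pi$-fibration with name $a$ is the selected $\pi$-fibration with name $a f$. Let $P_\pi\colon\mathcal C\to\mathcal C$, $P_\pi(X)=\pi_*(\tilde U\times X)$ be the polynomial functor of $\pi$; $P_\pi(X)$ lies over $U$. For maps $i\colon K\to L$ and $p\colon E\to B$ in $\mathcal C/S$, a structured lift of $i$ against $p$ over $S$ is a choice, for every $X\in\mathcal C/S$ and every commutative square from $X\times_S i$ to $p$ in $\mathcal C/S$, of a diagonal filler in $\mathcal C/S$, such that the choices are compatible with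 precomposition along all $Y\to X$ in $\mathcal C/S$. Suppose that $\pi$ is equipped with the following structures. * An $\mathrm{Id}$-type structure: maps $\mathrm{Id}\colon\tilde U\times_U\tilde U\to U$ and $\rho\colon\tilde U\to\tilde U$ with $\pi\rho=\mathrm{Id}\circ\Delta$, where $\Delta$ is the diagonal, so that, $\mathrm{Id}_U(\tilde U)\to\tilde U\times_U\tilde U$ being the selected $\pi$-fibration with name $\mathrm{Id}$, there is a map $\mathrm{refl}=(\Delta,\rho)\colon\tilde U\to\mathrm{Id}_U(\tilde U)$; together with a structured lift over $U$ of $\mathrm{refl}$ against $U\times\pi\colon U\times\tilde U\to U\times U$ (objects over $U$ by the first projection). For a $\pi$-fibration $E\to B$, $\mathrm{ev}_\partial\colon\mathrm{Id}_B(E)\to E\times_BE$ is the selected $\pi$-fibration with name $E\times_BE\to\tilde U\times_U\tilde U\xrightarrow{\mathrm{Id}}U$, and $\mathrm{refl}\colon E\to\mathrm{Id}_B(E)$ is the induced map over the diagonal. * A $\Pi$-type structure: a $\pi$-fibrancy structure on $P_\pi(\pi)\colon P_\pi(\tilde U)\to P_\pi(U)$. For $\pi$-fibrations $q\colon B\to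 A$ and $E\to B$ it provides $\pi$-fibrancy structures on $q_*E\to A$ and on $q_*(\mathrm{ev}_\partial)\colon q_*(\mathrm{Id}_BE)\to q_*E\times_Aq_*E$, where $q_*$ is the pushforward along $q$. A pointed $\mathrm{Id}$-functional extensionality structure is a structured lift, over $U$, of $P_\pi(\mathrm{refl})\colon P_\pi(\tilde U)\to P_\pi(\mathrm{Id}_U(\tilde U))$ against $U\times\pi\colon U\times\tilde U\to U\times U$. A type-theoretic pointed $(\mathrm{Id},\Pi)$-functional extensionality structure assigns to each $\pi$-fibration $q\colon B\to A$ and each $\pi$-fibration $E\to B$ two maps $$s^{q,E},\,r^{q,E}\colon q_*(\mathrm{Id}_BE)\rightrightarrows\mathrm{Id}_A(q_*E)$$ over $q_*E\times_Aq_*E$ and under $q_*E$ (with respect to $\mathrm{ev}_\partial$, $q_*(\mathrm{ev}_\partial)$, and $\mathrm{refl}$, $q_*(\mathrm{refl})$), along with two $\mathrm{Id}$-homotopies over $M:=q_*E\times_Aq_*E$: $H_s^{q,E}$ from $J s^{q,E}$ to the identity, constant along $q_*(\mathrm{refl})$, and $H_r^{q,E}$ from $r^{q,E}J$ to the identity,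 constant along $\mathrm{refl}$. Here $J\colon\mathrm{Id}_A(q_*E)\to q_*(\mathrm{Id}_BE)$ is the map over $M$ and under $q_*E$ given by $\mathrm{Id}$-elimination, and, for a $\pi$-fibration $F\to M$, an $\mathrm{Id}$-homotopy over $M$ from $f$ to $g\colon X\to F$ constant along $i\colon W\to X$ is a map $H\colon X\to\mathrm{Id}_M(F)$ with $\mathrm{ev}_\partial H=(f,g)$ and $Hi=\mathrm{refl}\circ f i$. These data are required to be stable under pullback: for every $f\colon A'\to A$, if $q'\colon B'\to A'$ is the selected base change of $q$ along $f$ and $f^*E$ is the selected base change of $E$ along $B'\to B$, then $$f^*(s^{q,E})=s^{q',f^*E},\quad f^*(r^{q,E})=r^{q',f^*E},\quad f^*(H_s^{q,E})=H_s^{q',f^*E},\quad f^*(H_r^{q,E})=H_r^{q',f^*E}.$$ **Theorem.** $\pi$ supports a pointed $\mathrm{Id}$-functional extensionality structure if and only if it supports a type-theoretic pointed $(\mathrm{Id},\Pi)$-functional extensionality structure. -/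

import Mathlib

open CategoryTheory CategoryTheory.Limits

set_option linter.unusedSectionVars false

universe v u

namespace UnivCat

noncomputable section

variable {C : Type u} [Category.{v} C]

section Transpose

variable {E B : C} (p : E ⟶ B) [ChosenPullbacksAlong p] [ExponentiableMorphism p]

/-- The total object of the pushforward `p_* Y`. -/
abbrev push (Y : Over E) : C := ((ExponentiableMorphism.pushforward p).obj Y).left

/-- The structure map `p_* Y ⟶ B`. -/
abbrev pushHom (Y : Over E) : push p Y ⟶ B := ((ExponentiableMorphism.pushforward p).obj Y).hom

/-- The action of `p_*` on a morphism over `E`, on total objects. -/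
abbrev pushMap {Y Z : Over E} (f : Y ⟶ Z) : push p Y ⟶ push p Z :=
  ((ExponentiableMorphism.pushforward p).map f).left

lemma pushMap_hom {Y Z : Over E} (f : Y ⟶ Z) : pushMap p f ≫ pushHom p Z = pushHom p Y :=
  Over.w _

variable {p} {X W : C} {x : X ⟶ B} {w₁ : W ⟶ X} {w₂ : W ⟶ E}

/-- The chosen pullback of `x` along `p`, compared with an arbitrary one. -/
def pbIso (sq : IsPullback w₁ w₂ x p) :
    (ChosenPullbacksAlong.pullback p).obj (Over.mk x) ≅ Over.mk w₂ :=
  Over.isoMk ((ChosenPullbacksAlong.isPullback x p).isoIsPullback _ _ sq) (by simp)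

/-- The transpose `X ⟶ p_* Y` over `B` of a map `W ⟶ Y` over `E`, where `W` is a pullback of
`x : X ⟶ B` along `p`. -/
def curry (sq : IsPullback w₁ w₂ x p) {Y : Over E} (h : W ⟶ Y.left) (hw : h ≫ Y.hom = w₂) :
    X ⟶ push p Y :=
  ((ExponentiableMorphism.pullbackPushforwardAdj p).homEquiv (Over.mk x) Y
    ((pbIso sq).hom ≫ Over.homMk h hw)).left

/-- The inverse transpose. -/
def uncurry (sq : IsPullback w₁ w₂ x p) {Y : Over E} (g : X ⟶ push p Y)
    (hg : g ≫ pushHom p Y = x) : W ⟶ Y.left :=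
  ((pbIso sq).inv ≫ ((ExponentiableMorphism.pullbackPushforwardAdj p).homEquiv (Over.mk x) Y).symm
    (Over.homMk g hg)).left

@[simp]
lemma curry_hom (sq : IsPullback w₁ w₂ x p) {Y : Over E} (h : W ⟶ Y.left) (hw : h ≫ Y.hom = w₂) :
    curry sq h hw ≫ pushHom p Y = x :=
  Over.w _

@[simp]
lemma curry_hom_assoc (sq : IsPullback w₁ w₂ x p) {Y : Over E} (h : W ⟶ Y.left) (hw : h ≫ Y.hom = w₂) {Z : C} (k : _ ⟶ Z) :
    curry sq h hw ≫ pushHom p Y ≫ k =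
      x ≫ k := by
  simpa only [Category.assoc, Category.id_comp] using curry_hom .. =≫ k

lemma uncurry_hom (sq : IsPullback w₁ w₂ x p) {Y : Over E} (g : X ⟶ push p Y)
    (hg : g ≫ pushHom p Y = x) : uncurry sq g hg ≫ Y.hom = w₂ :=
  Over.w ((pbIso sq).inv ≫ ((ExponentiableMorphism.pullbackPushforwardAdj p).homEquiv
    (Over.mk x) Y).symm (Over.homMk g hg))

@[simp]
lemma uncurry_curry (sq : IsPullback w₁ w₂ x p) {Y : Over E} (h : W ⟶ Y.left)
    (hw : h ≫ Y.hom = w₂) : uncurry sq (curry sq h hw) (curry_hom sq h hw) = h := by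
  have : Over.homMk (U := Over.mk x) (curry sq h hw) (curry_hom sq h hw) =
    (ExponentiableMorphism.pullbackPushforwardAdj p).homEquiv (Over.mk x) Y
      ((pbIso sq).hom ≫ Over.homMk h hw) := by ext; rfl
  simp [uncurry, this, - Over.comp_left]

@[simp]
lemma curry_uncurry (sq : IsPullback w₁ w₂ x p) {Y : Over E} (g : X ⟶ push p Y)
    (hg : g ≫ pushHom p Y = x) : curry sq (uncurry sq g hg) (uncurry_hom sq g hg) = g := by
  have : Over.homMk (U := Over.mk w₂) (uncurry sq g hg) (uncurry_hom sq g hg) =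
    (pbIso sq).inv ≫ ((ExponentiableMorphism.pullbackPushforwardAdj p).homEquiv
    (Over.mk x) Y).symm (Over.homMk g hg) := by ext; rfl
  simp [curry, this]

lemma curry_injective (sq : IsPullback w₁ w₂ x p) {Y : Over E} {h h' : W ⟶ Y.left}
    {hw : h ≫ Y.hom = w₂} {hw' : h' ≫ Y.hom = w₂} (e : curry sq h hw = curry sq h' hw') :
    h = h' := by
  rw [← uncurry_curry sq h hw, ← uncurry_curry sq h' hw']
  simp only [e]

lemma curry_congr (sq : IsPullback w₁ w₂ x p) {Y : Over E} {h h' : W ⟶ Y.left}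
    {hw : h ≫ Y.hom = w₂} {hw' : h' ≫ Y.hom = w₂} (e : h = h') : curry sq h hw = curry sq h' hw' := by
  subst e; rfl

lemma curry_comp (sq : IsPullback w₁ w₂ x p) {Y Z : Over E} (h : W ⟶ Y.left)
    (hw : h ≫ Y.hom = w₂) (f : Y ⟶ Z) :
    curry sq h hw ≫ pushMap p f = curry sq (h ≫ f.left) (by simp [hw]) := by
  rw [curry, curry, ← Over.comp_left, ← Adjunction.homEquiv_naturality_right]
  congr 2
  exact Over.OverMorphism.ext (by simp)

lemma comp_curry (sq : IsPullback w₁ w₂ x p) {X' W' : C} {x' : X' ⟶ B} {w₁' : W' ⟶ X'}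
    {w₂' : W' ⟶ E} (sq' : IsPullback w₁' w₂' x' p) (t : X' ⟶ X) (t' : W' ⟶ W)
    (ht : t ≫ x = x') (h1 : t' ≫ w₁ = w₁' ≫ t) (h2 : t' ≫ w₂ = w₂')
    {Y : Over E} (h : W ⟶ Y.left) (hw : h ≫ Y.hom = w₂) :
    t ≫ curry sq h hw = curry sq' (t' ≫ h) (by simp [hw, h2]) := by
  have : t = (Over.homMk t ht : Over.mk x' ⟶ Over.mk x).left := rfl
  rw [curry, curry, this, ← Over.comp_left, ← Adjunction.homEquiv_naturality_left]
  congr 2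
  rw [← Category.assoc]
  have : (ChosenPullbacksAlong.pullback p).map (Over.homMk t ht) ≫ (pbIso sq).hom =
     (pbIso sq').hom ≫ (Over.homMk t' h2 : Over.mk w₂' ⟶ Over.mk w₂) := by
    ext
    apply sq.hom_ext
    · have e : ((ChosenPullbacksAlong.pullback p).map
          (Over.homMk t ht : Over.mk x' ⟶ Over.mk x)).left ≫ ChosenPullbacksAlong.fst x p =
          ChosenPullbacksAlong.fst x' p ≫ t :=
        congrArg (fun k ↦ k.left) ((ChosenPullbacksAlong.mapPullbackAdj p).counit.naturality
          (Over.homMk t ht : Over.mk x' ⟶ Over.mk x))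
      simp [pbIso, h1, e]
    · simp [pbIso, h2]
  rw [this]
  ext
  simp

end Transpose

attribute [local simp] pullback.lift_fst pullback.lift_snd pullback.lift_fst_assoc
  pullback.lift_snd_assoc prod.lift_fst prod.lift_snd prod.lift_fst_assoc prod.lift_snd_assoc

variable {Ut U : C}

/-- A `π`-fibration `dom ⟶ A` together with a `π`-fibrancy structure: a `π`-name `A ⟶ U` and a
`π`-point `dom ⟶ Ut` exhibiting it as a pullback of `π` (not necessarily the selected one). -/
structure Fibration (π : Ut ⟶ U) (A : C) where
  dom : C
  map : dom ⟶ A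
  name : A ⟶ U
  point : dom ⟶ Ut
  isPullback : IsPullback map point name π

namespace Fibration

variable {π : Ut ⟶ U}

lemma paste' {A : C} (q : Fibration π A) {X W : C} {x : X ⟶ A} {w₁ : W ⟶ X} {w₂ : W ⟶ q.dom}
    (sq : IsPullback w₁ w₂ x q.map) : IsPullback w₁ (w₂ ≫ q.point) (x ≫ q.name) π :=
  sq.flip.paste_horiz q.isPullback.flip |>.flip

/-- The map into the total object of a `π`-fibration with given components. -/
def lift {A X : C} (q : Fibration π A) (a : X ⟶ A) (b : X ⟶ Ut) (w : a ≫ q.name = b ≫ π) :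
    X ⟶ q.dom :=
  q.isPullback.lift a b w

@[simp]
lemma lift_map {A X : C} (q : Fibration π A) (a : X ⟶ A) (b : X ⟶ Ut)
    (w : a ≫ q.name = b ≫ π) : q.lift a b w ≫ q.map = a :=
  q.isPullback.lift_fst ..

@[simp]
lemma lift_map_assoc {A X : C} (q : Fibration π A) (a : X ⟶ A) (b : X ⟶ Ut)
    (w : a ≫ q.name = b ≫ π) {Z : C} (k : _ ⟶ Z) :
    q.lift a b w ≫ q.map ≫ k =
      a ≫ k := by
  simpa only [Category.assoc, Category.id_comp] using lift_map .. =≫ k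

@[simp]
lemma lift_point {A X : C} (q : Fibration π A) (a : X ⟶ A) (b : X ⟶ Ut)
    (w : a ≫ q.name = b ≫ π) : q.lift a b w ≫ q.point = b :=
  q.isPullback.lift_snd ..

@[simp]
lemma lift_point_assoc {A X : C} (q : Fibration π A) (a : X ⟶ A) (b : X ⟶ Ut)
    (w : a ≫ q.name = b ≫ π) {Z : C} (k : _ ⟶ Z) :
    q.lift a b w ≫ q.point ≫ k =
      b ≫ k := by
  simpa only [Category.assoc, Category.id_comp] using lift_point .. =≫ k

lemma hom_ext {A X : C} (q : Fibration π A) {f g : X ⟶ q.dom} (h₁ : f ≫ q.map = g ≫ q.map)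
    (h₂ : f ≫ q.point = g ≫ q.point) : f = g :=
  q.isPullback.hom_ext h₁ h₂

lemma paste [HasPullbacks C] {A : C} (q : Fibration π A) {X : C} (x : X ⟶ A) :
    IsPullback (pullback.fst x q.map) (pullback.snd x q.map ≫ q.point) (x ≫ q.name) π :=
  (IsPullback.of_hasPullback x q.map).flip.paste_horiz q.isPullback.flip |>.flip

/-- The canonical map between total objects of two fibrations the first of which has the name of
the base change of the second. -/
def comparison {A A' : C} (q' : Fibration π A') (q : Fibration π A) (f : A' ⟶ A)
    (h : q'.name = f ≫ q.name) : q'.dom ⟶ q.dom :=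
  q.lift (q'.map ≫ f) q'.point (by rw [← q'.isPullback.w, h, Category.assoc])

@[simp]
lemma comparison_map {A A' : C} (q' : Fibration π A') (q : Fibration π A) (f : A' ⟶ A)
    (h : q'.name = f ≫ q.name) : q'.comparison q f h ≫ q.map = q'.map ≫ f := by
  simp [comparison]

@[simp]
lemma comparison_map_assoc {A A' : C} (q' : Fibration π A') (q : Fibration π A) (f : A' ⟶ A)
    (h : q'.name = f ≫ q.name) {Z : C} (k : _ ⟶ Z) :
    q'.comparison q f h ≫ q.map ≫ k =
      q'.map ≫ f ≫ k := by
  simpa only [Category.assoc, Category.id_comp] using comparison_map .. =≫ k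

@[simp]
lemma comparison_point {A A' : C} (q' : Fibration π A') (q : Fibration π A) (f : A' ⟶ A)
    (h : q'.name = f ≫ q.name) : q'.comparison q f h ≫ q.point = q'.point := by
  simp [comparison]

@[simp]
lemma comparison_point_assoc {A A' : C} (q' : Fibration π A') (q : Fibration π A) (f : A' ⟶ A)
    (h : q'.name = f ≫ q.name) {Z : C} (k : _ ⟶ Z) :
    q'.comparison q f h ≫ q.point ≫ k =
      q'.point ≫ k := by
  simpa only [Category.assoc, Category.id_comp] using comparison_point .. =≫ k

lemma isPullback_comparison {A A' : C} (q' : Fibration π A') (q : Fibration π A) (f : A' ⟶ A)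
    (h : q'.name = f ≫ q.name) : IsPullback q'.map (q'.comparison q f h) f q.map := by
  refine (IsPullback.of_right ?_ (comparison_map q' q f h) q.isPullback.flip).flip
  rw [comparison_point, ← h]
  exact q'.isPullback.flip

end Fibration

section Exponentiable

variable [HasPullbacks C] {π : Ut ⟶ U} [ChosenPullbacksAlong π] [ExponentiableMorphism π]

lemma repr_aux {A : C} (q : Fibration π A) (Y : Over q.dom) {X : C} (x : X ⟶ A)
    (k : pullback x q.map ⟶ Y.left) (hk : k ≫ Y.hom ≫ q.point = pullback.snd _ _ ≫ q.point) :
    k ≫ Y.hom = pullback.snd _ _ ↔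
    curry (Y := Over.mk (Y.hom ≫ q.point)) (q.paste x) k hk ≫
      pushMap π (Over.homMk Y.hom : Over.mk (Y.hom ≫ q.point) ⟶ Over.mk q.point) =
    x ≫ curry (Y := Over.mk q.point) q.isPullback (𝟙 _) (by simp) := by
  rw [curry_comp, comp_curry q.isPullback (q.paste x) x (pullback.snd _ _) rfl
    pullback.condition.symm rfl]
  constructor
  · intro h
    simp [h]
  · intro h
    simpa using curry_injective _ h

/-- The map of which the pushforward of `Y` along `q` is a base change. -/
def reprMap {A : C} (q : Fibration π A) (Y : Over q.dom) :
    push π (Over.mk (Y.hom ≫ q.point)) ⟶ push π (Over.mk q.point) :=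
  pushMap π (Over.homMk Y.hom : Over.mk (Y.hom ≫ q.point) ⟶ Over.mk q.point)

/-- The name of the identity of the total object of `q`. -/
def reprPt {A : C} (q : Fibration π A) : A ⟶ push π (Over.mk q.point) :=
  curry (Y := Over.mk q.point) q.isPullback (𝟙 _) (by simp)

def reprCurry {A : C} (q : Fibration π A) (Y : Over q.dom) {X : C} (x : X ⟶ A)
    (k : pullback x q.map ⟶ Y.left) (hk : k ≫ Y.hom = pullback.snd _ _) :
    X ⟶ push π (Over.mk (Y.hom ≫ q.point)) :=
  curry (Y := Over.mk (Y.hom ≫ q.point)) (q.paste x) k (by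
    dsimp
    rw [reassoc_of% hk])

lemma reprCurry_w {A : C} (q : Fibration π A) (Y : Over q.dom) {X : C} (x : X ⟶ A)
    (k : pullback x q.map ⟶ Y.left) (hk : k ≫ Y.hom = pullback.snd _ _) :
    x ≫ reprPt q = reprCurry q Y x k hk ≫ reprMap q Y :=
  ((repr_aux q Y x _ _).1 hk).symm

def reprUncurry {A : C} (q : Fibration π A) (Y : Over q.dom) {X : C} (x : X ⟶ A)
    (g : X ⟶ push π (Over.mk (Y.hom ≫ q.point))) (hg : x ≫ reprPt q = g ≫ reprMap q Y) :
    pullback x q.map ⟶ Y.left :=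
  uncurry (Y := Over.mk (Y.hom ≫ q.point)) (q.paste x) g (by
    rw [← pushMap_hom π (Over.homMk Y.hom : Over.mk (Y.hom ≫ q.point) ⟶ Over.mk q.point)]
    have := hg =≫ pushHom π _
    rw [Category.assoc, Category.assoc, reprPt, curry_hom] at this
    exact this.symm)

lemma reprUncurry_hom {A : C} (q : Fibration π A) (Y : Over q.dom) {X : C} (x : X ⟶ A)
    (g : X ⟶ push π (Over.mk (Y.hom ≫ q.point))) (hg : x ≫ reprPt q = g ≫ reprMap q Y) :
    reprUncurry q Y x g hg ≫ Y.hom = pullback.snd _ _ := by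
  refine (repr_aux q Y x _ (uncurry_hom ..)).2 ?_
  exact (congrArg (· ≫ _) (curry_uncurry ..)).trans hg.symm

lemma reprUncurry_curry {A : C} (q : Fibration π A) (Y : Over q.dom) {X : C} (x : X ⟶ A)
    (k : pullback x q.map ⟶ Y.left) (hk : k ≫ Y.hom = pullback.snd _ _) :
    reprUncurry q Y x (reprCurry q Y x k hk) (reprCurry_w q Y x k hk) = k :=
  uncurry_curry _ _ _

lemma reprCurry_uncurry {A : C} (q : Fibration π A) (Y : Over q.dom) {X : C} (x : X ⟶ A)
    (g : X ⟶ push π (Over.mk (Y.hom ≫ q.point))) (hg : x ≫ reprPt q = g ≫ reprMap q Y) :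
    reprCurry q Y x (reprUncurry q Y x g hg) (reprUncurry_hom q Y x g hg) = g :=
  curry_uncurry _ _ _

lemma comp_reprCurry {A : C} (q : Fibration π A) (Y : Over q.dom) {X X' : C} (x : X ⟶ A)
    (x' : X' ⟶ A) (t : X' ⟶ X) (ht : t ≫ x = x')
    (k : pullback x q.map ⟶ Y.left) (hk : k ≫ Y.hom = pullback.snd _ _) :
    t ≫ reprCurry q Y x k hk = reprCurry q Y x' (pullback.lift (pullback.fst _ _ ≫ t)
      (pullback.snd _ _) (by simp [ht, pullback.condition]) ≫ k) (by simp [hk]) :=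
  comp_curry (q.paste x) (q.paste x') t _ (by rw [← Category.assoc, ht]) (by simp) (by simp) _ _

/-- Pullback along a `π`-fibration has a right adjoint, objectwise. -/
def reprBy {A : C} (q : Fibration π A) (Y : Over q.dom) :
    ((Over.pullback q.map).op ⋙ yoneda.obj Y).RepresentableBy
      (Over.mk (pullback.fst (reprPt q) (reprMap q Y))) where
  homEquiv {X} :=
    { toFun g := Over.homMk (reprUncurry q Y X.hom (g.left ≫ pullback.snd _ _) (by
            have h2 := Over.w g
            dsimp at h2
            rw [Category.assoc, ← pullback.condition, reassoc_of% h2])) (reprUncurry_hom ..)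
      invFun k := Over.homMk (pullback.lift X.hom
          (reprCurry q Y X.hom k.left (Over.w k)) (reprCurry_w ..)) (by simp)
      left_inv g := by
        have h2 := Over.w g
        dsimp at h2
        apply Over.OverMorphism.ext
        apply pullback.hom_ext
        · simp [h2]
        · simp [reprCurry_uncurry]
      right_inv k := by
        apply Over.OverMorphism.ext
        simp [reprUncurry_curry] }
  homEquiv_comp {X X'} f g := by
    have h1 := Over.w f
    have h2 := Over.w g
    dsimp at h2
    have hg : X'.hom ≫ reprPt q = (g.left ≫ pullback.snd _ _) ≫ reprMap q Y := by
      rw [Category.assoc, ← pullback.condition, reassoc_of% h2]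
    have hfg : X.hom ≫ reprPt q = (f.left ≫ g.left ≫ pullback.snd _ _) ≫ reprMap q Y := by
      rw [Category.assoc, ← hg, reassoc_of% h1]
    have key := comp_reprCurry q Y X'.hom X.hom f.left h1 (reprUncurry q Y X'.hom _ hg)
      (reprUncurry_hom ..)
    rw [reprCurry_uncurry] at key
    apply Over.OverMorphism.ext
    dsimp
    simp only [Category.assoc, key, reprUncurry_curry]
    rfl

lemma exists_pushforward {A : C} (q : Fibration π A) : (Over.pullback q.map).IsLeftAdjoint := by
  apply Functor.isLeftAdjoint_of_rightAdjointObjIsDefined_eq_top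
  ext Y
  simpa [Functor.rightAdjointObjIsDefined_iff] using (reprBy q Y).isRepresentable


/-- Pullbacks along a `π`-fibration. -/
instance {A : C} (q : Fibration π A) : ChosenPullbacksAlong q.map :=
  ChosenPullbacksAlong.ofHasPullbacksAlong q.map

/-- A choice of pushforwards along a `π`-fibration. -/
instance {A : C} (q : Fibration π A) : ExponentiableMorphism q.map :=
  have := exists_pushforward q
  ⟨(Over.pullback q.map).rightAdjoint, Adjunction.ofIsLeftAdjoint (Over.pullback q.map)⟩

end Exponentiable

section Polynomial

variable [HasFiniteLimits C] (π : Ut ⟶ U) [ChosenPullbacksAlong π] [ExponentiableMorphism π]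

variable (Ut) in
/-- The functor `Ut × - : C ⥤ C / Ut`. -/
def timesOver : C ⥤ Over Ut where
  obj X := Over.mk (prod.fst : Ut ⨯ X ⟶ Ut)
  map f := Over.homMk (prod.map (𝟙 Ut) f)

/-- The polynomial functor of `π`. -/
def poly : C ⥤ C := timesOver Ut ⋙ ExponentiableMorphism.pushforward π ⋙ Over.forget U

/-- The structure map `P_π X ⟶ U`. -/
def polyHom (X : C) : (poly π).obj X ⟶ U := pushHom π ((timesOver Ut).obj X)

lemma poly_map_hom {X Y : C} (f : X ⟶ Y) : (poly π).map f ≫ polyHom π Y = polyHom π X :=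
  pushMap_hom π _

variable {π} {X₀ W : C} {a : X₀ ⟶ U} {w₁ : W ⟶ X₀} {w₂ : W ⟶ Ut}

/-- The map `X₀ ⟶ P_π X` classifying `a : X₀ ⟶ U` together with a map to `X` from the pullback of
`π` along `a`. -/
def classify (sq : IsPullback w₁ w₂ a π) {X : C} (h : W ⟶ X) : X₀ ⟶ (poly π).obj X :=
  curry (Y := (timesOver Ut).obj X) sq (prod.lift w₂ h) (prod.lift_fst _ _)

lemma classify_hom (sq : IsPullback w₁ w₂ a π) {X : C} (h : W ⟶ X) :
    classify sq h ≫ polyHom π X = a :=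
  curry_hom ..

lemma classify_hom_assoc (sq : IsPullback w₁ w₂ a π) {X : C} (h : W ⟶ X) {Z : C} (k : _ ⟶ Z) :
    classify sq h ≫ polyHom π X ≫ k =
      a ≫ k := by
  simpa only [Category.assoc, Category.id_comp] using classify_hom .. =≫ k

lemma classify_injective (sq : IsPullback w₁ w₂ a π) {X : C} {h h' : W ⟶ X}
    (e : classify sq h = classify sq h') : h = h' := by
  have := curry_injective sq e
  simpa using this =≫ prod.snd

lemma exists_classify (sq : IsPullback w₁ w₂ a π) {X : C} (g : X₀ ⟶ (poly π).obj X)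
    (hg : g ≫ polyHom π X = a) : ∃ h, classify sq h = g := by
  have h1 := uncurry_hom (Y := (timesOver Ut).obj X) sq g hg
  refine ⟨uncurry (Y := (timesOver Ut).obj X) sq g hg ≫ prod.snd, ?_⟩
  refine Eq.trans ?_ (curry_uncurry (Y := (timesOver Ut).obj X) sq g hg)
  dsimp only [classify]
  congr 1
  apply Limits.prod.hom_ext
  · exact (prod.lift_fst _ _).trans h1.symm
  · exact prod.lift_snd _ _

lemma classify_map (sq : IsPullback w₁ w₂ a π) {X Y : C} (h : W ⟶ X) (f : X ⟶ Y) :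
    classify sq h ≫ (poly π).map f = classify sq (h ≫ f) := by
  refine (curry_comp sq _ _ ((timesOver Ut).map f)).trans ?_
  dsimp only [classify]
  congr 1
  exact (prod.lift_map _ _ _ _).trans (by simp)

lemma comp_classify (sq : IsPullback w₁ w₂ a π) {X₀' W' : C} {a' : X₀' ⟶ U} {w₁' : W' ⟶ X₀'}
    {w₂' : W' ⟶ Ut} (sq' : IsPullback w₁' w₂' a' π) (t : X₀' ⟶ X₀) (t' : W' ⟶ W)
    (ht : t ≫ a = a') (h1 : t' ≫ w₁ = w₁' ≫ t) (h2 : t' ≫ w₂ = w₂') {X : C} (h : W ⟶ X) :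
    t ≫ classify sq h = classify sq' (t' ≫ h) := by
  refine (comp_curry sq sq' t t' ht h1 h2 _ _).trans ?_
  dsimp only [classify]
  congr 1
  exact (prod.comp_lift _ _ _).trans (by rw [h2])

end Polynomial

section Lift

variable [HasFiniteLimits C] {S : C}

/-- The product of two objects in the slice over `S`. -/
abbrev sliceProd (X K : Over S) : Over S := Over.mk (pullback.fst X.hom K.hom ≫ X.hom)

/-- The product of two morphisms in the slice over `S`. -/
def sliceProdMap {X Y K L : Over S} (t : X ⟶ Y) (i : K ⟶ L) : sliceProd X K ⟶ sliceProd Y L :=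
  Over.homMk (pullback.lift (pullback.fst X.hom K.hom ≫ t.left) (pullback.snd X.hom K.hom ≫ i.left)
    (by simp [pullback.condition])) (by simp)

lemma sliceProdMap_fst {X Y K L : Over S} (t : X ⟶ Y) (i : K ⟶ L) :
    (sliceProdMap t i).left ≫ pullback.fst Y.hom L.hom = pullback.fst X.hom K.hom ≫ t.left :=
  pullback.lift_fst _ _ _

lemma sliceProdMap_fst_assoc {X Y K L : Over S} (t : X ⟶ Y) (i : K ⟶ L) {Z : C} (k : _ ⟶ Z) :
    (sliceProdMap t i).left ≫ pullback.fst Y.hom L.hom ≫ k =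
      pullback.fst X.hom K.hom ≫ t.left ≫ k := by
  simpa only [Category.assoc, Category.id_comp] using sliceProdMap_fst .. =≫ k

lemma sliceProdMap_snd {X Y K L : Over S} (t : X ⟶ Y) (i : K ⟶ L) :
    (sliceProdMap t i).left ≫ pullback.snd Y.hom L.hom = pullback.snd X.hom K.hom ≫ i.left :=
  pullback.lift_snd _ _ _

lemma sliceProdMap_snd_assoc {X Y K L : Over S} (t : X ⟶ Y) (i : K ⟶ L) {Z : C} (k : _ ⟶ Z) :
    (sliceProdMap t i).left ≫ pullback.snd Y.hom L.hom ≫ k =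
      pullback.snd X.hom K.hom ≫ i.left ≫ k := by
  simpa only [Category.assoc, Category.id_comp] using sliceProdMap_snd .. =≫ k

lemma sliceProdMap_comp {X Y Z K L M : Over S} (t : X ⟶ Y) (t' : Y ⟶ Z) (i : K ⟶ L) (i' : L ⟶ M) :
    sliceProdMap t i ≫ sliceProdMap t' i' = sliceProdMap (t ≫ t') (i ≫ i') := by
  apply Over.OverMorphism.ext
  apply pullback.hom_ext
  · rw [Over.comp_left, Category.assoc, sliceProdMap_fst, sliceProdMap_fst_assoc, sliceProdMap_fst,
      Over.comp_left]
  · rw [Over.comp_left, Category.assoc, sliceProdMap_snd, sliceProdMap_snd_assoc, sliceProdMap_snd,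
      Over.comp_left]

/-- A (stable, uniform) structured lift of `i` against `p` in the slice over `S`: a choice, for
every object `X` of the slice, of a diagonal filler for every lifting problem of `X × i` against
`p`, uniform in `X`. -/
structure StructuredLift {K L E B : Over S} (i : K ⟶ L) (p : E ⟶ B) where
  lift (X : Over S) (u : sliceProd X K ⟶ E) (v : sliceProd X L ⟶ B)
    (w : u ≫ p = sliceProdMap (𝟙 X) i ≫ v) : sliceProd X L ⟶ E
  fac_left (X : Over S) (u : sliceProd X K ⟶ E) (v : sliceProd X L ⟶ B)
    (w : u ≫ p = sliceProdMap (𝟙 X) i ≫ v) : sliceProdMap (𝟙 X) i ≫ lift X u v w = u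
  fac_right (X : Over S) (u : sliceProd X K ⟶ E) (v : sliceProd X L ⟶ B)
    (w : u ≫ p = sliceProdMap (𝟙 X) i ≫ v) : lift X u v w ≫ p = v
  uniform {X Y : Over S} (t : Y ⟶ X) (u : sliceProd X K ⟶ E) (v : sliceProd X L ⟶ B)
    (w : u ≫ p = sliceProdMap (𝟙 X) i ≫ v) :
    lift Y (sliceProdMap t (𝟙 K) ≫ u) (sliceProdMap t (𝟙 L) ≫ v)
      (by rw [Category.assoc, w, ← Category.assoc, ← Category.assoc, sliceProdMap_comp,
        sliceProdMap_comp]; simp) =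
      sliceProdMap t (𝟙 L) ≫ lift X u v w

/-- The map `S × π` over `S`. -/
def constOver (S : C) (π : Ut ⟶ U) :
    Over.mk (prod.fst : S ⨯ Ut ⟶ S) ⟶ Over.mk (prod.fst : S ⨯ U ⟶ S) :=
  Over.homMk (prod.map (𝟙 S) π)

end Lift

section Selected

variable (π : Ut ⟶ U) [ChosenPullbacksAlong π]

/-- The pullback of `π` along `a` selected by the universe structure, with its canonical
`π`-fibrancy structure. -/
def selected {A : C} (a : A ⟶ U) : Fibration π A where
  dom := ChosenPullbacksAlong.pullbackObj a π
  map := ChosenPullbacksAlong.fst a π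
  name := a
  point := ChosenPullbacksAlong.snd a π
  isPullback := ChosenPullbacksAlong.isPullback a π

variable {π}

/-- The selected base change of a `π`-fibration. -/
abbrev Fibration.baseChange {A A' : C} (q : Fibration π A) (f : A' ⟶ A) : Fibration π A' :=
  selected π (f ≫ q.name)

/-- The upper map of the selected base change square. -/
abbrev Fibration.baseChangeMap {A A' : C} (q : Fibration π A) (f : A' ⟶ A) :
    (q.baseChange f).dom ⟶ q.dom :=
  (q.baseChange f).comparison q f rfl

end Selected

section Id

variable [HasFiniteLimits C] (π : Ut ⟶ U) [ChosenPullbacksAlong π]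

/-- A pre-`Id`-type structure: `Id : Ut ×_U Ut ⟶ U` with a lift of `Id` along `π` on the
diagonal. -/
structure PreIdStructure where
  Id : pullback π π ⟶ U
  reflName : Ut ⟶ Ut
  comm : reflName ≫ π = pullback.diagonal π ≫ Id

namespace PreIdStructure

variable {π} (I : PreIdStructure π)

/-- The generic identity type, as a selected `π`-fibration over `Ut ×_U Ut`. -/
def generic : Fibration π (pullback π π) := selected π I.Id

/-- The generic reflexivity map `Ut ⟶ Id_U(Ut)`. -/
def genericRefl : Ut ⟶ I.generic.dom :=
  I.generic.lift (pullback.diagonal π) I.reflName I.comm.symm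

lemma genericRefl_map : I.genericRefl ≫ I.generic.map = pullback.diagonal π :=
  I.generic.lift_map _ _ _

lemma genericRefl_map_assoc {Z : C} (k : _ ⟶ Z) :
    I.genericRefl ≫ I.generic.map ≫ k =
      pullback.diagonal π ≫ k := by
  simpa only [Category.assoc, Category.id_comp] using genericRefl_map .. =≫ k

lemma genericRefl_point : I.genericRefl ≫ I.generic.point = I.reflName :=
  I.generic.lift_point _ _ _

lemma genericRefl_point_assoc {Z : C} (k : _ ⟶ Z) :
    I.genericRefl ≫ I.generic.point ≫ k =
      I.reflName ≫ k := by
  simpa only [Category.assoc, Category.id_comp] using genericRefl_point .. =≫ k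

/-- The projection `Id_U(Ut) ⟶ U`. -/
def genericHom : I.generic.dom ⟶ U := I.generic.map ≫ pullback.fst π π ≫ π

/-- The generic reflexivity map, over `U`. -/
def genericReflOver : Over.mk π ⟶ Over.mk I.genericHom :=
  Over.homMk I.genericRefl (by
    change I.genericRefl ≫ I.genericHom = π
    rw [genericHom, genericRefl_map_assoc, pullback.diagonal_fst_assoc])

variable {B : C} (E : Fibration π B)

/-- The map `E ×_B E ⟶ Ut ×_U Ut` given by a `π`-fibrancy structure. -/
def pairMap : pullback E.map E.map ⟶ pullback π π :=
  pullback.map E.map E.map π π E.point E.point E.name E.isPullback.w E.isPullback.w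

/-- The identity type `ev_∂ : Id_B(E) ⟶ E ×_B E`, the selected pullback of `π` along
`E ×_B E ⟶ Ut ×_U Ut ⟶ U`. -/
def path : Fibration π (pullback E.map E.map) := selected π (pairMap E ≫ I.Id)

/-- Reflexivity `E ⟶ Id_B(E)`. -/
def refl : E.dom ⟶ (I.path E).dom :=
  (I.path E).lift (pullback.diagonal E.map) (E.point ≫ I.reflName) (by
    have : pullback.diagonal E.map ≫ pairMap E = E.point ≫ pullback.diagonal π := by
      apply pullback.hom_ext <;> simp [pairMap]
    rw [Category.assoc, I.comm, ← reassoc_of% this]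
    rfl)

lemma refl_map : I.refl E ≫ (I.path E).map = pullback.diagonal E.map :=
  (I.path E).lift_map _ _ _

lemma refl_map_assoc {Z : C} (k : _ ⟶ Z) :
    I.refl E ≫ (I.path E).map ≫ k =
      pullback.diagonal E.map ≫ k := by
  simpa only [Category.assoc, Category.id_comp] using refl_map .. =≫ k

lemma refl_point : I.refl E ≫ (I.path E).point = E.point ≫ I.reflName :=
  (I.path E).lift_point _ _ _

lemma refl_point_assoc {Z : C} (k : _ ⟶ Z) :
    I.refl E ≫ (I.path E).point ≫ k =
      E.point ≫ I.reflName ≫ k := by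
  simpa only [Category.assoc, Category.id_comp] using refl_point .. =≫ k

lemma path_name : (I.path E).name = pairMap E ≫ I.Id := rfl

variable {E}

@[simp]
lemma pairMap_fst : pairMap E ≫ pullback.fst π π = pullback.fst _ _ ≫ E.point :=
  pullback.lift_fst _ _ _

@[simp]
lemma pairMap_fst_assoc {Z : C} (k : _ ⟶ Z) :
    pairMap E ≫ pullback.fst π π ≫ k =
      pullback.fst _ _ ≫ E.point ≫ k := by
  simpa only [Category.assoc, Category.id_comp] using pairMap_fst .. =≫ k

@[simp]
lemma pairMap_snd : pairMap E ≫ pullback.snd π π = pullback.snd _ _ ≫ E.point :=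
  pullback.lift_snd _ _ _

@[simp]
lemma pairMap_snd_assoc {Z : C} (k : _ ⟶ Z) :
    pairMap E ≫ pullback.snd π π ≫ k =
      pullback.snd _ _ ≫ E.point ≫ k := by
  simpa only [Category.assoc, Category.id_comp] using pairMap_snd .. =≫ k

/-- The map `E' ×_{B'} E' ⟶ E ×_B E` induced by a base change. -/
def pairComparison {B' : C} (E' : Fibration π B') (E : Fibration π B) (f : B' ⟶ B)
    (h : E'.name = f ≫ E.name) : pullback E'.map E'.map ⟶ pullback E.map E.map :=
  pullback.map _ _ _ _ (E'.comparison E f h) (E'.comparison E f h) f (by simp) (by simp)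

@[simp]
lemma pairComparison_fst {B' : C} (E' : Fibration π B') (E : Fibration π B) (f : B' ⟶ B)
    (h : E'.name = f ≫ E.name) : pairComparison E' E f h ≫ pullback.fst _ _ =
      pullback.fst _ _ ≫ E'.comparison E f h :=
  pullback.lift_fst _ _ _

@[simp]
lemma pairComparison_fst_assoc {B' : C} (E' : Fibration π B') (E : Fibration π B) (f : B' ⟶ B)
    (h : E'.name = f ≫ E.name) {Z : C} (k : _ ⟶ Z) :
    pairComparison E' E f h ≫ pullback.fst _ _ ≫ k =
      pullback.fst _ _ ≫ E'.comparison E f h ≫ k := by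
  simpa only [Category.assoc, Category.id_comp] using pairComparison_fst .. =≫ k

@[simp]
lemma pairComparison_snd {B' : C} (E' : Fibration π B') (E : Fibration π B) (f : B' ⟶ B)
    (h : E'.name = f ≫ E.name) : pairComparison E' E f h ≫ pullback.snd _ _ =
      pullback.snd _ _ ≫ E'.comparison E f h :=
  pullback.lift_snd _ _ _

@[simp]
lemma pairComparison_snd_assoc {B' : C} (E' : Fibration π B') (E : Fibration π B) (f : B' ⟶ B)
    (h : E'.name = f ≫ E.name) {Z : C} (k : _ ⟶ Z) :
    pairComparison E' E f h ≫ pullback.snd _ _ ≫ k =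
      pullback.snd _ _ ≫ E'.comparison E f h ≫ k := by
  simpa only [Category.assoc, Category.id_comp] using pairComparison_snd .. =≫ k

lemma path_name_baseChange {B' : C} (E' : Fibration π B') (E : Fibration π B) (f : B' ⟶ B)
    (h : E'.name = f ≫ E.name) :
    (I.path E').name = pairComparison E' E f h ≫ (I.path E).name := by
  rw [path_name, path_name, ← Category.assoc]
  congr 1
  apply pullback.hom_ext <;> simp

/-- The map `Id_{B'}(E') ⟶ Id_B(E)` induced by a base change. -/
def pathComparison {B' : C} (E' : Fibration π B') (E : Fibration π B) (f : B' ⟶ B)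
    (h : E'.name = f ≫ E.name) : (I.path E').dom ⟶ (I.path E).dom :=
  (I.path E').comparison (I.path E) (pairComparison E' E f h) (I.path_name_baseChange E' E f h)

end PreIdStructure

/-- A (full) `Id`-type structure: a pre-`Id`-type structure with a `J`-elimination structure, i.e. a
stable lifting structure over `U` of `refl : Ut ⟶ Id_U(Ut)` against `U × π`. -/
structure IdStructure extends PreIdStructure π where
  J : StructuredLift toPreIdStructure.genericReflOver (constOver U π)

namespace IdStructure

variable {π} (I : IdStructure π) {B : C} (E : Fibration π B)

variable {E} in
lemma toPath_aux : pullback.fst E.name I.genericHom ≫ E.name =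
    (pullback.snd E.name I.genericHom ≫ I.generic.map ≫ pullback.fst π π) ≫ π := by
  rw [Category.assoc, Category.assoc]
  exact pullback.condition

variable {E} in
lemma toPath_aux' : pullback.fst E.name I.genericHom ≫ E.name =
    (pullback.snd E.name I.genericHom ≫ I.generic.map ≫ pullback.snd π π) ≫ π := by
  rw [toPath_aux, Category.assoc, Category.assoc, Category.assoc, Category.assoc,
    pullback.condition]

/-- The map from the pullback of `Id_U(Ut)` along the name of `E` to `Id_B(E)`. -/
def toPath : pullback E.name I.genericHom ⟶ (I.path E).dom :=
  (I.path E).lift (pullback.lift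
      (E.lift (pullback.fst _ _) (pullback.snd _ _ ≫ I.generic.map ≫ pullback.fst π π) I.toPath_aux)
      (E.lift (pullback.fst _ _) (pullback.snd _ _ ≫ I.generic.map ≫ pullback.snd π π) I.toPath_aux')
      (by simp))
    (pullback.snd _ _ ≫ I.generic.point) (by
      rw [PreIdStructure.path_name, Category.assoc (pullback.snd _ _), ← I.generic.isPullback.w,
        ← Category.assoc]
      refine Eq.trans ?_ (Category.assoc _ _ _)
      refine congrArg (· ≫ I.Id) ?_
      apply pullback.hom_ext <;> simp)

/-- The map from `Id_B(E)` to the pullback of `Id_U(Ut)` along the name of `E`. -/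
def ofPath : (I.path E).dom ⟶ pullback E.name I.genericHom :=
  pullback.lift ((I.path E).map ≫ pullback.fst _ _ ≫ E.map)
    (I.generic.lift ((I.path E).map ≫ PreIdStructure.pairMap E) (I.path E).point (by
      rw [← (I.path E).isPullback.w, PreIdStructure.path_name, Category.assoc]; rfl))
    (by simp [PreIdStructure.genericHom, E.isPullback.w])

lemma ofPath_toPath : I.ofPath E ≫ I.toPath E = 𝟙 _ := by
  apply (I.path E).hom_ext
  · apply pullback.hom_ext
    · apply E.hom_ext <;> simp [toPath, ofPath]
    · apply E.hom_ext <;> simp [toPath, ofPath, pullback.condition]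
  · simp [toPath, ofPath]

lemma ofPath_toPath_assoc {Z : C} (k : _ ⟶ Z) :
    I.ofPath E ≫ I.toPath E ≫ k =
      k := by
  simpa only [Category.assoc, Category.id_comp] using ofPath_toPath .. =≫ k

/-- `refl` before and after pulling back along the name of `E`. -/
lemma refl_ofPath : I.refl E ≫ I.ofPath E =
    pullback.lift E.map E.point E.isPullback.w ≫
      (sliceProdMap (𝟙 (Over.mk E.name)) I.genericReflOver).left := by
  apply pullback.hom_ext
  · refine Eq.trans ?_ ((Category.assoc _ _ _).trans
      (pullback.lift E.map E.point E.isPullback.w ≫=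
      sliceProdMap_fst (𝟙 (Over.mk E.name)) I.genericReflOver)).symm
    simp [ofPath, PreIdStructure.refl_map_assoc]
  · refine Eq.trans ?_ ((Category.assoc _ _ _).trans
      (pullback.lift E.map E.point E.isPullback.w ≫=
      sliceProdMap_snd (𝟙 (Over.mk E.name)) I.genericReflOver)).symm
    apply I.generic.hom_ext
    · apply pullback.hom_ext
      · simp [ofPath, PreIdStructure.refl_map_assoc, PreIdStructure.genericReflOver,
          PreIdStructure.genericRefl_map_assoc]
      · simp [ofPath, PreIdStructure.refl_map_assoc, PreIdStructure.genericReflOver,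
          PreIdStructure.genericRefl_map_assoc]
    · simp [ofPath, PreIdStructure.refl_point, PreIdStructure.genericReflOver,
          PreIdStructure.genericRefl_point]

lemma map_toPath : (sliceProdMap (𝟙 (Over.mk E.name)) I.genericReflOver).left ≫ I.toPath E =
    E.lift (pullback.fst _ _) (pullback.snd _ _) pullback.condition ≫ I.refl E := by
  have e : E.lift (pullback.fst _ _) (pullback.snd _ _) pullback.condition ≫
      pullback.lift E.map E.point E.isPullback.w = 𝟙 (pullback E.name π) := by
    apply pullback.hom_ext <;> simp
  have := E.lift (pullback.fst _ _) (pullback.snd _ _) pullback.condition ≫= I.refl_ofPath E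
  rw [reassoc_of% e] at this
  rw [← this]
  simp [ofPath_toPath]

/-- The upper map of the lifting problem solved by `Id`-elimination. -/
def elimTop (d : E.dom ⟶ Ut) :
    sliceProd (Over.mk E.name) (Over.mk π) ⟶ Over.mk (prod.fst : U ⨯ Ut ⟶ U) :=
  Over.homMk (prod.lift (pullback.fst E.name π ≫ E.name)
    (E.lift (pullback.fst E.name π) (pullback.snd E.name π) pullback.condition ≫ d))
    (prod.lift_fst _ _)

/-- The lower map of the lifting problem solved by `Id`-elimination. -/
def elimBot (c : (I.path E).dom ⟶ U) :
    sliceProd (Over.mk E.name) (Over.mk I.genericHom) ⟶ Over.mk (prod.fst : U ⨯ U ⟶ U) :=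
  Over.homMk (prod.lift (pullback.fst E.name I.genericHom ≫ E.name) (I.toPath E ≫ c))
    (prod.lift_fst _ _)

lemma elim_w (c : (I.path E).dom ⟶ U) (d : E.dom ⟶ Ut) (h : d ≫ π = I.refl E ≫ c) :
    elimTop E d ≫ constOver U π =
      sliceProdMap (𝟙 (Over.mk E.name)) I.genericReflOver ≫ I.elimBot E c := by
  apply Over.OverMorphism.ext
  apply Limits.prod.hom_ext
  · exact (Over.w (elimTop E d ≫ constOver U π)).trans
      (Over.w (sliceProdMap (𝟙 (Over.mk E.name)) I.genericReflOver ≫ I.elimBot E c)).symm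
  · have h1 : (elimTop E d ≫ constOver U π).left ≫ prod.snd =
        E.lift (pullback.fst E.name π) (pullback.snd E.name π) pullback.condition ≫ d ≫ π := by
      rw [Over.comp_left, Category.assoc]
      refine ((elimTop E d).left ≫= prod.map_snd _ _).trans ?_
      exact (prod.lift_snd_assoc _ _ _).trans (Category.assoc _ _ _)
    have h2 : (sliceProdMap (𝟙 (Over.mk E.name)) I.genericReflOver ≫ I.elimBot E c).left ≫
        prod.snd =
        E.lift (pullback.fst E.name π) (pullback.snd E.name π) pullback.condition ≫ I.refl E ≫ c := by
      rw [Over.comp_left, Category.assoc]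
      refine (_ ≫= prod.lift_snd _ _).trans ?_
      exact (Category.assoc _ _ _).symm.trans ((I.map_toPath E =≫ c).trans (Category.assoc _ _ _))
    exact h1.trans ((_ ≫= h).trans h2.symm)

/-- `Id`-elimination: given a type `c` over `Id_B(E)` (a map to `U`) and a term `d` of it over
`refl`, the `J`-structure provides a term of `c`. -/
def elim (c : (I.path E).dom ⟶ U) (d : E.dom ⟶ Ut) (h : d ≫ π = I.refl E ≫ c) :
    (I.path E).dom ⟶ Ut :=
  I.ofPath E ≫ (I.J.lift (Over.mk E.name) (elimTop E d) (I.elimBot E c)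
    (I.elim_w E c d h)).left ≫ prod.snd

lemma elim_type (c : (I.path E).dom ⟶ U) (d : E.dom ⟶ Ut) (h : d ≫ π = I.refl E ≫ c) :
    I.elim E c d h ≫ π = c := by
  have := congrArg (fun k ↦ k.left ≫ prod.snd) (I.J.fac_right (Over.mk E.name) (elimTop E d)
    (I.elimBot E c) (I.elim_w E c d h))
  have h2 : (I.J.lift (Over.mk E.name) (elimTop E d) (I.elimBot E c)
    (I.elim_w E c d h)).left ≫ prod.snd ≫ π = I.toPath E ≫ c := by
    refine Eq.trans ?_ (this.trans (prod.lift_snd _ _))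
    refine Eq.trans ?_ (Category.assoc _ _ _).symm
    exact _ ≫= (prod.map_snd _ _).symm
  rw [elim, Category.assoc, Category.assoc]
  exact (I.ofPath E ≫= h2).trans (I.ofPath_toPath_assoc E c)

lemma refl_elim (c : (I.path E).dom ⟶ U) (d : E.dom ⟶ Ut) (h : d ≫ π = I.refl E ≫ c) :
    I.refl E ≫ I.elim E c d h = d := by
  have := congrArg (fun k ↦ k.left ≫ prod.snd) (I.J.fac_left (Over.mk E.name) (elimTop E d)
    (I.elimBot E c) (I.elim_w E c d h))
  have h2 := this.trans (prod.lift_snd _ _)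
  rw [elim, ← Category.assoc, refl_ofPath]
  refine (Category.assoc _ _ _).trans ((_ ≫= (Category.assoc _ _ _).symm).trans
    ((_ ≫= h2).trans ?_))
  rw [← Category.assoc]
  refine Eq.trans (congrArg (· ≫ d) ?_) (Category.id_comp d)
  apply E.hom_ext <;> simp

end IdStructure

end Id

section Pi

variable [HasFiniteLimits C] (π : Ut ⟶ U) [ChosenPullbacksAlong π] [ExponentiableMorphism π]

/-- An extensional `Π`-type structure: a `π`-fibrancy structure on `P_π(π)`. -/
structure PiStructure where
  Pi : (poly π).obj U ⟶ U
  lam : (poly π).obj Ut ⟶ Ut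
  isPullback : IsPullback ((poly π).map π) lam Pi π

variable {π}

/-- The square exhibiting the pullback of a pushforward `q_* Y` along `q`. -/
lemma pushSq {A : C} (q : Fibration π A) (Y : Over q.dom) :
    IsPullback (pullback.fst (pushHom q.map Y) q.map) (pullback.snd (pushHom q.map Y) q.map)
      (pushHom q.map Y) q.map :=
  IsPullback.of_hasPullback _ _

/-- Evaluation `q^* q_* Y ⟶ Y`. -/
def eval {A : C} (q : Fibration π A) (Y : Over q.dom) :
    pullback (pushHom q.map Y) q.map ⟶ Y.left :=
  uncurry (pushSq q Y) (𝟙 _) (Category.id_comp _)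

lemma eval_hom {A : C} (q : Fibration π A) (Y : Over q.dom) :
    eval q Y ≫ Y.hom = pullback.snd _ _ :=
  uncurry_hom _ _ _

lemma eval_hom_assoc {A : C} (q : Fibration π A) (Y : Over q.dom) {Z : C} (k : _ ⟶ Z) :
    eval q Y ≫ Y.hom ≫ k =
      pullback.snd _ _ ≫ k := by
  simpa only [Category.assoc, Category.id_comp] using eval_hom .. =≫ k

lemma curry_eval {A : C} (q : Fibration π A) (Y : Over q.dom) :
    curry (pushSq q Y) (eval q Y) (eval_hom q Y) = 𝟙 _ :=
  curry_uncurry ..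

/-- A map into `q_* Y` is the transpose of its composite with the evaluation. -/
lemma eq_curry {A X W : C} (q : Fibration π A) {Y : Over q.dom} {x : X ⟶ A} {w₁ : W ⟶ X}
    {w₂ : W ⟶ q.dom} (sq : IsPullback w₁ w₂ x q.map) (l : X ⟶ push q.map Y)
    (hl : l ≫ pushHom q.map Y = x) :
    l = curry sq ((pushSq q Y).lift (w₁ ≫ l) w₂ (by rw [Category.assoc, hl, sq.w]) ≫ eval q Y)
      (by rw [Category.assoc, eval_hom, IsPullback.lift_snd]) := by
  have := comp_curry (pushSq q Y) sq l
    ((pushSq q Y).lift (w₁ ≫ l) w₂ (by rw [Category.assoc, hl, sq.w])) hl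
    (IsPullback.lift_fst ..) (IsPullback.lift_snd ..) (eval q Y) (eval_hom q Y)
  rw [curry_eval, Category.comp_id] at this
  exact this

lemma exists_curry {A X W : C} (q : Fibration π A) {Y : Over q.dom} {x : X ⟶ A} {w₁ : W ⟶ X}
    {w₂ : W ⟶ q.dom} (sq : IsPullback w₁ w₂ x q.map) (l : X ⟶ push q.map Y)
    (hl : l ≫ pushHom q.map Y = x) : ∃ z, ∃ hz : z ≫ Y.hom = w₂, curry sq z hz = l :=
  ⟨_, _, (eq_curry q sq l hl).symm⟩

lemma lift_eval {A X W : C} (q : Fibration π A) {Y : Over q.dom} {x : X ⟶ A} {w₁ : W ⟶ X}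
    {w₂ : W ⟶ q.dom} (sq : IsPullback w₁ w₂ x q.map) (z : W ⟶ Y.left) (hz : z ≫ Y.hom = w₂)
    (t : W ⟶ pullback (pushHom q.map Y) q.map) (h1 : t ≫ pullback.fst _ _ = w₁ ≫ curry sq z hz)
    (h2 : t ≫ pullback.snd _ _ = w₂) : t ≫ eval q Y = z := by
  have := comp_curry (pushSq q Y) sq (curry sq z hz) t (curry_hom ..) h1 h2
    (eval q Y) (eval_hom q Y)
  rw [curry_eval, Category.comp_id] at this
  exact (curry_injective sq this).symm

variable (P : PiStructure π)

theorem push_isPullback {A : C} (q : Fibration π A) {Y : Over q.dom} {X₀ W : C} {ρ₀ : X₀ ⟶ A}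
    {w₁ : W ⟶ X₀} {w₂ : W ⟶ q.dom} (sq : IsPullback w₁ w₂ ρ₀ q.map) (ev : W ⟶ Y.left)
    (hev : ev ≫ Y.hom = w₂) (hmono : Mono (curry sq ev hev)) (Z : Fibration π Y.left)
    (zB : Z.dom ⟶ q.dom) (hz : Z.map ≫ Y.hom = zB) (ρ : push q.map (Over.mk zB) ⟶ X₀)
    (hρ : ρ ≫ curry sq ev hev = pushMap q.map (Over.homMk Z.map hz : Over.mk zB ⟶ Y)) :
    IsPullback ρ (classify (q.paste' (pushSq q (Over.mk zB))) (eval q _ ≫ Z.point) ≫ P.lam)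
      (classify (q.paste' sq) (ev ≫ Z.name) ≫ P.Pi) π := by
  have hρ₀ : ρ ≫ ρ₀ = pushHom q.map (Over.mk zB) := by
    have := hρ =≫ pushHom q.map Y
    rwa [Category.assoc, curry_hom, pushMap_hom] at this
  -- a map `l` into the pushforward is determined by `l ≫ ρ` and its transpose
  let sqX {X : C} (x : X ⟶ X₀) := IsPullback.of_hasPullback (x ≫ ρ₀) q.map
  let xW {X : C} (x : X ⟶ X₀) : pullback (x ≫ ρ₀) q.map ⟶ W :=
    sq.lift (pullback.fst _ _ ≫ x) (pullback.snd _ _)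
      (by rw [Category.assoc]; exact pullback.condition)
  have hx {X : C} (x : X ⟶ X₀) : x ≫ curry sq ev hev = curry (sqX x) (xW x ≫ ev)
      (by simp [hev, xW]) :=
    comp_curry sq (sqX x) x (xW x) rfl (by simp [xW]) (by simp [xW]) ev hev
  have hxc {X : C} (x : X ⟶ X₀) : x ≫ classify (q.paste' sq) (ev ≫ Z.name) =
      classify (q.paste' (sqX x)) (xW x ≫ ev ≫ Z.name) :=
    comp_classify _ _ x (xW x) (Category.assoc _ _ _).symm (by simp [xW]) (by simp [xW]) _
  have hlρ {X : C} (l : X ⟶ push q.map (Over.mk zB)) :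
      l ≫ pushHom q.map (Over.mk zB) = (l ≫ ρ) ≫ ρ₀ := by rw [← hρ₀, Category.assoc]
  let lW {X : C} (l : X ⟶ push q.map (Over.mk zB)) :
      pullback ((l ≫ ρ) ≫ ρ₀) q.map ⟶ pullback (pushHom q.map (Over.mk zB)) q.map :=
    (pushSq q (Over.mk zB)).lift (pullback.fst _ _ ≫ l) (pullback.snd _ _)
      ((Category.assoc _ _ _).trans ((_ ≫= hlρ l).trans pullback.condition))
  have hlW1 {X : C} (l : X ⟶ push q.map (Over.mk zB)) :
      lW l ≫ pullback.fst _ _ = pullback.fst _ _ ≫ l := IsPullback.lift_fst ..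
  have hlW2 {X : C} (l : X ⟶ push q.map (Over.mk zB)) :
      lW l ≫ pullback.snd _ _ = pullback.snd _ _ := IsPullback.lift_snd ..
  have hlh {X : C} (l : X ⟶ push q.map (Over.mk zB)) :
      (lW l ≫ eval q _) ≫ (Over.mk zB).hom = pullback.snd _ _ :=
    (Category.assoc _ _ _).trans ((_ ≫= eval_hom q _).trans (hlW2 l))
  have hl {X : C} (l : X ⟶ push q.map (Over.mk zB)) :
      curry (sqX (l ≫ ρ)) (lW l ≫ eval q _) (hlh l) = l :=
    (eq_curry q (sqX (l ≫ ρ)) l (hlρ l)).symm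
  have hlc {X : C} (l : X ⟶ push q.map (Over.mk zB)) :
      l ≫ classify (q.paste' (pushSq q (Over.mk zB))) (eval q _ ≫ Z.point) =
        classify (q.paste' (sqX (l ≫ ρ))) (lW l ≫ eval q _ ≫ Z.point) :=
    comp_classify _ _ l (lW l) ((Category.assoc _ _ _).symm.trans (hlρ l =≫ _)) (hlW1 l)
      ((Category.assoc _ _ _).symm.trans (hlW2 l =≫ _)) _
  have hlm {X : C} (l : X ⟶ push q.map (Over.mk zB)) :
      (lW l ≫ eval q _) ≫ Z.map = xW (l ≫ ρ) ≫ ev := by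
    have h1 := hx (l ≫ ρ)
    have h2 := curry_comp (sqX (l ≫ ρ)) (lW l ≫ eval q _) (hlh l)
      (Over.homMk Z.map hz : Over.mk zB ⟶ Y)
    rw [hl, ← hρ, ← Category.assoc, h1] at h2
    exact (curry_injective _ h2).symm
  have key : ∀ {X : C} (x : X ⟶ X₀) (l : X ⟶ push q.map (Over.mk zB)), l ≫ ρ = x →
      ∃ z : pullback (x ≫ ρ₀) q.map ⟶ Z.dom, ∃ hz' : z ≫ zB = pullback.snd _ _,
        curry (Y := Over.mk zB) (sqX x) z hz' = l ∧ z ≫ Z.map = xW x ≫ ev ∧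
        l ≫ classify (q.paste' (pushSq q (Over.mk zB))) (eval q _ ≫ Z.point) =
          classify (q.paste' (sqX x)) (z ≫ Z.point) := by
    rintro X x l rfl
    exact ⟨lW l ≫ eval q _, hlh l, hl l, hlm l,
      (hlc l).trans (congrArg (classify _) (Category.assoc _ _ _).symm)⟩
  suffices h : IsPullback ρ (classify (q.paste' (pushSq q (Over.mk zB))) (eval q _ ≫ Z.point))
      (classify (q.paste' sq) (ev ≫ Z.name)) ((poly π).map π) from h.paste_vert P.isPullback
  have ex : ∀ (s : PullbackCone (classify (q.paste' sq) (ev ≫ Z.name)) ((poly π).map π)),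
      ∃ l : s.pt ⟶ push q.map (Over.mk zB), l ≫ ρ = s.fst ∧
        l ≫ classify (q.paste' (pushSq q (Over.mk zB))) (eval q _ ≫ Z.point) = s.snd := by
    intro s
    have hs := s.condition
    have hs' := hs =≫ polyHom π U
    rw [Category.assoc, Category.assoc, classify_hom, poly_map_hom, ← Category.assoc] at hs'
    obtain ⟨k, hk⟩ := exists_classify (q.paste' (sqX s.fst)) s.snd hs'.symm
    rw [← hk, hxc, classify_map] at hs
    have hkZ := classify_injective _ hs
    have hzm := Z.lift_map (xW s.fst ≫ ev) k (by rw [Category.assoc]; exact hkZ)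
    have hzp := Z.lift_point (xW s.fst ≫ ev) k (by rw [Category.assoc]; exact hkZ)
    generalize Z.lift (xW s.fst ≫ ev) k (by rw [Category.assoc]; exact hkZ) = z at hzm hzp
    have hzB : z ≫ zB = pullback.snd _ _ := by
      rw [← hz, reassoc_of% hzm, hev]
      exact IsPullback.lift_snd ..
    have hlρ' : curry (Y := Over.mk zB) (sqX s.fst) z hzB ≫ ρ = s.fst := by
      rw [← cancel_mono (curry sq ev hev), Category.assoc, hρ, curry_comp, hx]
      congr 1
    refine ⟨_, hlρ', ?_⟩
    obtain ⟨z', hz', h1, h2, h3⟩ := key _ _ hlρ'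
    rw [h3, ← hk, curry_injective _ h1, hzp]
  refine ⟨⟨?_⟩, ⟨PullbackCone.IsLimit.mk _ (fun s ↦ (ex s).choose)
    (fun s ↦ (ex s).choose_spec.1) (fun s ↦ (ex s).choose_spec.2) (fun s m h1 h2 ↦ ?_)⟩⟩
  · obtain ⟨z, hz', h1, h2, h3⟩ := key ρ (𝟙 _) (Category.id_comp ρ)
    rw [Category.id_comp] at h3
    rw [h3, hxc, classify_map]
    refine congrArg (classify _) ?_
    rw [Category.assoc, ← Z.isPullback.w, reassoc_of% h2]
  · obtain ⟨z, hz', a1, a2, a3⟩ := key s.fst m h1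
    obtain ⟨w, hw', b1, b2, b3⟩ := key s.fst _ (ex s).choose_spec.1
    have hp : z ≫ Z.point = w ≫ Z.point :=
      classify_injective _ (a3.symm.trans (h2.trans ((ex s).choose_spec.2.symm.trans b3)))
    have : z = w := Z.hom_ext (a2.trans b2.symm) hp
    subst this
    exact a1.symm.trans b1

lemma push_id_ext {A X : C} (q : Fibration π A) {l l' : X ⟶ push q.map (Over.mk (𝟙 q.dom))}
    (h : l ≫ pushHom q.map _ = l' ≫ pushHom q.map _) : l = l' := by
  obtain ⟨x, hx⟩ : ∃ x, l ≫ pushHom q.map _ = x := ⟨_, rfl⟩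
  have hx' := h.symm.trans hx
  have sq := IsPullback.of_hasPullback x q.map
  obtain ⟨z, hz, rfl⟩ := exists_curry q sq l hx
  obtain ⟨z', hz', rfl⟩ := exists_curry q sq l' hx'
  refine curry_congr sq ?_
  have e : z = pullback.snd _ _ := (Category.comp_id _).symm.trans hz
  have e' : z' = pullback.snd _ _ := (Category.comp_id _).symm.trans hz'
  rw [e, e']

lemma push_pair_ext {A X : C} (q : Fibration π A) (E : Fibration π q.dom)
    {l l' : X ⟶ push q.map (Over.mk (pullback.fst E.map E.map ≫ E.map))}
    (h0 : l ≫ pushMap q.map (Over.homMk (pullback.fst E.map E.map) : _ ⟶ Over.mk E.map) =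
      l' ≫ pushMap q.map (Over.homMk (pullback.fst E.map E.map) : _ ⟶ Over.mk E.map))
    (h1 : l ≫ pushMap q.map (Over.homMk (pullback.snd E.map E.map) pullback.condition.symm :
        _ ⟶ Over.mk E.map) =
      l' ≫ pushMap q.map (Over.homMk (pullback.snd E.map E.map) pullback.condition.symm :
        _ ⟶ Over.mk E.map)) : l = l' := by
  have h := h0 =≫ pushHom q.map _
  rw [Category.assoc, Category.assoc, pushMap_hom] at h
  obtain ⟨x, hx⟩ : ∃ x, l ≫ pushHom q.map _ = x := ⟨_, rfl⟩
  have hx' := h.symm.trans hx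
  have sq := IsPullback.of_hasPullback x q.map
  obtain ⟨z, hz, rfl⟩ := exists_curry q sq l hx
  obtain ⟨z', hz', rfl⟩ := exists_curry q sq l' hx'
  rw [curry_comp, curry_comp] at h0 h1
  exact curry_congr sq (pullback.hom_ext (curry_injective sq h0) (curry_injective sq h1))

lemma classify_congr {X₀ W X : C} {a a' : X₀ ⟶ U} {w₁ w₁' : W ⟶ X₀} {w₂ w₂' : W ⟶ Ut}
    (sq : IsPullback w₁ w₂ a π) (sq' : IsPullback w₁' w₂' a' π) (h1 : w₁ = w₁') (h2 : w₂ = w₂')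
    (ha : a = a') {h h' : W ⟶ X} (hh : h = h') : classify sq h = classify sq' h' := by
  subst h1 h2 ha hh
  rfl

/-- The pushforward `q_* E` of a `π`-fibrant object along a `π`-fibration, with the
`π`-fibrancy structure provided by the `Π`-type structure. -/
def pushFib {A : C} (q : Fibration π A) (E : Fibration π q.dom) : Fibration π A where
  dom := push q.map (Over.mk E.map)
  map := pushHom q.map (Over.mk E.map)
  name := classify q.isPullback E.name ≫ P.Pi
  point := classify (q.paste' (pushSq q (Over.mk E.map))) (eval q _ ≫ E.point) ≫ P.lam
  isPullback := by
    have sq : IsPullback q.map (𝟙 q.dom) (𝟙 A) q.map := IsPullback.of_vert_isIso ⟨by simp⟩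
    have h := push_isPullback P q (Y := Over.mk (𝟙 q.dom)) sq (𝟙 _) (Category.comp_id _)
      ⟨fun f g h ↦ by
        have := h =≫ pushHom q.map _
        simpa using this⟩ E E.map (Category.comp_id _)
      (pushHom q.map (Over.mk E.map)) (push_id_ext q (by
        rw [Category.assoc, curry_hom, Category.comp_id, pushMap_hom]))
    rwa [classify_congr (q.paste' sq) q.isPullback rfl (Category.id_comp _) (Category.id_comp _)
      (Category.id_comp E.name)] at h


/-- The fibre product `q_* E ×_A q_* E`. -/
abbrev pushPair {A : C} (q : Fibration π A) (E : Fibration π q.dom) : C :=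
  pullback (pushFib P q E).map (pushFib P q E).map

/-- The projection `q_* E ×_A q_* E ⟶ A`. -/
abbrev pushPairHom {A : C} (q : Fibration π A) (E : Fibration π q.dom) : pushPair P q E ⟶ A :=
  pullback.fst _ _ ≫ (pushFib P q E).map

lemma pushMap_comp {A : C} (q : Fibration π A) {Y Z W : Over q.dom} (f : Y ⟶ Z) (g : Z ⟶ W) :
    pushMap q.map f ≫ pushMap q.map g = pushMap q.map (f ≫ g) := by
  rw [pushMap, pushMap, pushMap, ← Over.comp_left, ← Functor.map_comp]

lemma pushMap_eq_id {A : C} (q : Fibration π A) {Y : Over q.dom} (f : Y ⟶ Y) (h : f.left = 𝟙 _) :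
    pushMap q.map f = 𝟙 _ := by
  have : f = 𝟙 _ := Over.OverMorphism.ext h
  rw [this, pushMap, CategoryTheory.Functor.map_id]
  rfl

lemma pairSq {A : C} (q : Fibration π A) (E : Fibration π q.dom) :
    IsPullback (pullback.fst (pushPairHom P q E) q.map) (pullback.snd (pushPairHom P q E) q.map)
      (pushPairHom P q E) q.map :=
  IsPullback.of_hasPullback _ _

/-- Evaluation of a pair of sections: the map from the pullback of `q_* E ×_A q_* E` along `q` to
`E ×_B E`. -/
def evPair {A : C} (q : Fibration π A) (E : Fibration π q.dom) :
    pullback (pushPairHom P q E) q.map ⟶ pullback E.map E.map :=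
  pullback.lift
    (uncurry (Y := Over.mk E.map) (pairSq P q E) (pullback.fst _ _) rfl)
    (uncurry (Y := Over.mk E.map) (pairSq P q E) (pullback.snd _ _) pullback.condition.symm)
    ((uncurry_hom (Y := Over.mk E.map) (pairSq P q E) (pullback.fst _ _) rfl).trans
      (uncurry_hom (Y := Over.mk E.map) (pairSq P q E) (pullback.snd _ _)
        pullback.condition.symm).symm)

lemma evPair_fst {A : C} (q : Fibration π A) (E : Fibration π q.dom) :
    evPair P q E ≫ pullback.fst _ _ =
      uncurry (Y := Over.mk E.map) (pairSq P q E) (pullback.fst _ _) rfl :=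
  pullback.lift_fst _ _ _

lemma evPair_snd {A : C} (q : Fibration π A) (E : Fibration π q.dom) :
    evPair P q E ≫ pullback.snd _ _ =
      uncurry (Y := Over.mk E.map) (pairSq P q E) (pullback.snd _ _) pullback.condition.symm :=
  pullback.lift_snd _ _ _

lemma evPair_hom {A : C} (q : Fibration π A) (E : Fibration π q.dom) :
    evPair P q E ≫ pullback.fst E.map E.map ≫ E.map = pullback.snd _ _ := by
  rw [← Category.assoc, evPair_fst]
  exact uncurry_hom (Y := Over.mk E.map) (pairSq P q E) (pullback.fst _ _) rfl

/-- The comparison `q_* E ×_A q_* E ⟶ q_* (E ×_B E)`. -/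
def pairToPush {A : C} (q : Fibration π A) (E : Fibration π q.dom) :
    pushPair P q E ⟶ push q.map (Over.mk (pullback.fst E.map E.map ≫ E.map)) :=
  curry (Y := Over.mk (pullback.fst E.map E.map ≫ E.map)) (pairSq P q E) (evPair P q E)
    (evPair_hom P q E)

lemma pairToPush_fst {A : C} (q : Fibration π A) (E : Fibration π q.dom) :
    pairToPush P q E ≫ pushMap q.map (Over.homMk (pullback.fst E.map E.map) : _ ⟶ Over.mk E.map) =
      pullback.fst _ _ := by
  refine (curry_comp _ _ _ _).trans (Eq.trans ?_ (curry_uncurry (Y := Over.mk E.map) (pairSq P q E)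
    (pullback.fst _ _) rfl))
  exact curry_congr _ (evPair_fst P q E)

lemma pairToPush_snd {A : C} (q : Fibration π A) (E : Fibration π q.dom) :
    pairToPush P q E ≫ pushMap q.map
      (Over.homMk (pullback.snd E.map E.map) pullback.condition.symm : _ ⟶ Over.mk E.map) =
      pullback.snd _ _ := by
  refine (curry_comp _ _ _ _).trans (Eq.trans ?_ (curry_uncurry (Y := Over.mk E.map) (pairSq P q E)
    (pullback.snd _ _) pullback.condition.symm))
  exact curry_congr _ (evPair_snd P q E)

variable (I : PreIdStructure π)

/-- The structure map `Id_B(E) ⟶ B`. -/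
abbrev pathHom {B : C} (E : Fibration π B) : (I.path E).dom ⟶ B :=
  (I.path E).map ≫ pullback.fst E.map E.map ≫ E.map

/-- The first endpoint map `Id_B(E) ⟶ E`, over `B`. -/
def pathFst {B : C} (E : Fibration π B) : Over.mk (pathHom I E) ⟶ Over.mk E.map :=
  Over.homMk ((I.path E).map ≫ pullback.fst E.map E.map) (Category.assoc _ _ _)

/-- The second endpoint map `Id_B(E) ⟶ E`, over `B`. -/
def pathSnd {B : C} (E : Fibration π B) : Over.mk (pathHom I E) ⟶ Over.mk E.map :=
  Over.homMk ((I.path E).map ≫ pullback.snd E.map E.map)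
    ((Category.assoc _ _ _).trans (_ ≫= pullback.condition.symm))

/-- The reflexivity map `E ⟶ Id_B(E)`, over `B`. -/
def reflOver {B : C} (E : Fibration π B) : Over.mk E.map ⟶ Over.mk (pathHom I E) :=
  Over.homMk (I.refl E) (by simp [PreIdStructure.refl_map_assoc])

/-- The map `q_*(ev_∂) : q_*(Id_B E) ⟶ q_* E ×_A q_* E`. -/
def pushEnds {A : C} (q : Fibration π A) (E : Fibration π q.dom) :
    push q.map (Over.mk (pathHom I E)) ⟶ pushPair P q E :=
  pullback.lift (pushMap q.map (pathFst I E)) (pushMap q.map (pathSnd I E))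
    ((pushMap_hom _ _).trans (pushMap_hom _ _).symm)

/-- `q_*(ev_∂) : q_*(Id_B E) ⟶ q_* E ×_A q_* E`, with the `π`-fibrancy structure provided by the
`Π`-type structure. -/
def pushPath {A : C} (q : Fibration π A) (E : Fibration π q.dom) :
    Fibration π (pushPair P q E) where
  dom := push q.map (Over.mk (pathHom I E))
  map := pushEnds P I q E
  name := classify (q.paste' (pairSq P q E)) (evPair P q E ≫ (I.path E).name) ≫ P.Pi
  point := classify (q.paste' (pushSq q (Over.mk (pathHom I E)))) (eval q _ ≫ (I.path E).point) ≫
    P.lam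
  isPullback := by
    refine push_isPullback P q (Y := Over.mk (pullback.fst E.map E.map ≫ E.map)) (pairSq P q E)
      (evPair P q E) (evPair_hom P q E) ⟨fun f g h ↦ ?_⟩ (I.path E) (pathHom I E) rfl
      (pushEnds P I q E) ?_
    · apply pullback.hom_ext
      · have h1 := h =≫ pushMap q.map (Over.homMk (pullback.fst E.map E.map) : _ ⟶ Over.mk E.map)
        refine (f ≫= pairToPush_fst P q E).symm.trans (Eq.trans ?_ (g ≫= pairToPush_fst P q E))
        exact (Category.assoc _ _ _).symm.trans (h1.trans (Category.assoc _ _ _))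
      · have h1 := h =≫ pushMap q.map (Over.homMk (pullback.snd E.map E.map)
          pullback.condition.symm : _ ⟶ Over.mk E.map)
        refine (f ≫= pairToPush_snd P q E).symm.trans (Eq.trans ?_ (g ≫= pairToPush_snd P q E))
        exact (Category.assoc _ _ _).symm.trans (h1.trans (Category.assoc _ _ _))
    · apply push_pair_ext
      · refine (Category.assoc _ _ _).trans ((_ ≫= pairToPush_fst P q E).trans ?_)
        refine (pullback.lift_fst _ _ _).trans ?_
        rw [pushMap_comp]
        rfl
      · refine (Category.assoc _ _ _).trans ((_ ≫= pairToPush_snd P q E).trans ?_)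
        refine (pullback.lift_snd _ _ _).trans ?_
        rw [pushMap_comp]
        rfl

/-- The map `q_*(refl) : q_* E ⟶ q_*(Id_B E)`. -/
def pushRefl {A : C} (q : Fibration π A) (E : Fibration π q.dom) :
    (pushFib P q E).dom ⟶ (pushPath P I q E).dom :=
  pushMap q.map (reflOver I E)

lemma pushRefl_map {A : C} (q : Fibration π A) (E : Fibration π q.dom) :
    pushRefl P I q E ≫ (pushPath P I q E).map = pullback.diagonal (pushFib P q E).map := by
  apply pullback.hom_ext
  · rw [pullback.diagonal_fst]
    refine (Category.assoc _ _ _).trans ((_ ≫= pullback.lift_fst _ _ _).trans ?_)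
    refine (pushMap_comp q _ _).trans (pushMap_eq_id q _ ?_)
    simp [pathFst, reflOver, PreIdStructure.refl_map_assoc]
  · rw [pullback.diagonal_snd]
    refine (Category.assoc _ _ _).trans ((_ ≫= pullback.lift_snd _ _ _).trans ?_)
    refine (pushMap_comp q _ _).trans (pushMap_eq_id q _ ?_)
    simp [pathSnd, reflOver, PreIdStructure.refl_map_assoc]

section BaseChange

variable {A A' : C} {q' : Fibration π A'} {q : Fibration π A} {f : A' ⟶ A}
  (hq : q'.name = f ≫ q.name) {E' : Fibration π q'.dom} {E : Fibration π q.dom}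
  (hE : E'.name = q'.comparison q f hq ≫ E.name)

lemma pushFib_name_baseChange (hE : E'.name = q'.comparison q f hq ≫ E.name) : (pushFib P q' E').name = f ≫ (pushFib P q E).name := by
  dsimp only [pushFib]
  rw [← Category.assoc, comp_classify q.isPullback q'.isPullback f (q'.comparison q f hq)
    hq.symm (q'.comparison_map q f hq) (q'.comparison_point q f hq), ← hE]

/-- The comparison map `q'_* E' ⟶ q_* E` induced by a base change. -/
def pushComparison : (pushFib P q' E').dom ⟶ (pushFib P q E).dom :=
  (pushFib P q' E').comparison (pushFib P q E) f (pushFib_name_baseChange P hq hE)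

lemma comp_point {A X W : C} {q : Fibration π A} {E : Fibration π q.dom} {x : X ⟶ A} {w₁ : W ⟶ X}
    {w₂ : W ⟶ q.dom} (sq : IsPullback w₁ w₂ x q.map) (l : X ⟶ (pushFib P q E).dom)
    (hl : l ≫ (pushFib P q E).map = x) : l ≫ (pushFib P q E).point =
      classify (q.paste' sq) (uncurry (Y := Over.mk E.map) sq l hl ≫ E.point) ≫ P.lam := by
  obtain ⟨z, hz, rfl⟩ := exists_curry (Y := Over.mk E.map) q sq l hl
  have e : uncurry (Y := Over.mk E.map) sq (curry (Y := Over.mk E.map) sq z hz) hl = z :=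
    uncurry_curry (Y := Over.mk E.map) sq z hz
  rw [e]
  refine (Category.assoc _ _ _).symm.trans (congrArg (· ≫ P.lam) ?_)
  have h1 : w₁ ≫ curry (Y := Over.mk E.map) sq z hz ≫ pushHom q.map (Over.mk E.map) =
      w₂ ≫ q.map := by rw [curry_hom, sq.w]
  refine (comp_classify (q.paste' (pushSq q (Over.mk E.map))) (q.paste' sq) _
    ((pushSq q (Over.mk E.map)).lift (w₁ ≫ curry (Y := Over.mk E.map) sq z hz) w₂
      ((Category.assoc _ _ _).trans h1)) ((Category.assoc _ _ _).symm.trans (hl =≫ q.name))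
    (IsPullback.lift_fst ..)
    ((Category.assoc _ _ _).symm.trans (IsPullback.lift_snd .. =≫ q.point)) _).trans ?_
  refine congrArg (classify _) ((Category.assoc _ _ _).symm.trans (congrArg (· ≫ E.point) ?_))
  exact lift_eval q sq z hz _ (IsPullback.lift_fst ..) (IsPullback.lift_snd ..)

/-- Evaluation is compatible with base change. -/
lemma uncurry_comparison {X X' W W' : C} {x : X ⟶ A} {w₁ : W ⟶ X} {w₂ : W ⟶ q.dom}
    (sq : IsPullback w₁ w₂ x q.map) {x' : X' ⟶ A'} {w₁' : W' ⟶ X'} {w₂' : W' ⟶ q'.dom}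
    (sq' : IsPullback w₁' w₂' x' q'.map) (t : X' ⟶ X) (t' : W' ⟶ W) (h1 : t' ≫ w₁ = w₁' ≫ t)
    (h2 : t' ≫ w₂ = w₂' ≫ q'.comparison q f hq) (hx : t ≫ x = x' ≫ f)
    (l : X ⟶ (pushFib P q E).dom) (hl : l ≫ (pushFib P q E).map = x)
    (l' : X' ⟶ (pushFib P q' E').dom) (hl' : l' ≫ (pushFib P q' E').map = x')
    (h : l' ≫ pushComparison P hq hE = t ≫ l) :
    uncurry (Y := Over.mk E'.map) sq' l' hl' ≫ E'.comparison E _ hE =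
      t' ≫ uncurry (Y := Over.mk E.map) sq l hl := by
  have hz := uncurry_hom (Y := Over.mk E.map) sq l hl
  have hz' := uncurry_hom (Y := Over.mk E'.map) sq' l' hl'
  have e := comp_point P sq l hl
  have e' := comp_point P sq' l' hl'
  generalize uncurry (Y := Over.mk E.map) sq l hl = z at *
  generalize uncurry (Y := Over.mk E'.map) sq' l' hl' = z' at *
  dsimp only [Over.mk_hom, Over.mk_left] at hz hz' z z'
  have hm : z' ≫ E'.map ≫ q'.comparison q f hq = t' ≫ z ≫ E.map := by
    rw [hz, h2, ← hz', Category.assoc]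
  have key : l' ≫ (pushFib P q' E').point = t ≫ l ≫ (pushFib P q E).point := by
    rw [← reassoc_of% h, pushComparison, Fibration.comparison_point]
  rw [e, e', ← Category.assoc, comp_classify (q.paste' sq) (q'.paste' sq') t t'
    (by rw [← Category.assoc, hx, Category.assoc, hq]) h1
    (by rw [← Category.assoc, h2, Category.assoc, Fibration.comparison_point])] at key
  have key2 : classify (q'.paste' sq') (z' ≫ E'.point) =
      classify (q'.paste' sq') (t' ≫ z ≫ E.point) := by
    apply P.isPullback.hom_ext _ key
    rw [classify_map, classify_map]
    refine congrArg (classify _) ?_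
    rw [Category.assoc, Category.assoc, Category.assoc, ← E.isPullback.w, ← E'.isPullback.w, hE,
      ← reassoc_of% hm]
  apply E.hom_ext
  · rw [Category.assoc, Category.assoc, Fibration.comparison_map, hm]
  · rw [Category.assoc, Category.assoc, Fibration.comparison_point]
    exact classify_injective _ key2

/-- The comparison map `q'_* E' ×_{A'} q'_* E' ⟶ q_* E ×_A q_* E` induced by a base change. -/
def pushPairComparison : pushPair P q' E' ⟶ pushPair P q E :=
  PreIdStructure.pairComparison (pushFib P q' E') (pushFib P q E) f
    (pushFib_name_baseChange P hq hE)

lemma pushPairComparison_fst : pushPairComparison P hq hE ≫ pullback.fst _ _ =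
    pullback.fst _ _ ≫ pushComparison P hq hE :=
  PreIdStructure.pairComparison_fst _ _ _ _

lemma pushPairComparison_snd : pushPairComparison P hq hE ≫ pullback.snd _ _ =
    pullback.snd _ _ ≫ pushComparison P hq hE :=
  PreIdStructure.pairComparison_snd _ _ _ _

lemma pushPairComparison_hom : pushPairComparison P hq hE ≫ pushPairHom P q E =
    pushPairHom P q' E' ≫ f := by
  rw [← Category.assoc, pushPairComparison_fst, Category.assoc, Category.assoc, pushComparison,
    Fibration.comparison_map]

/-- The map of pullbacks along `q'` and `q` lying over `pushPairComparison`. -/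
def pushPairComparisonTop : pullback (pushPairHom P q' E') q'.map ⟶
    pullback (pushPairHom P q E) q.map :=
  pullback.map _ _ _ _ (pushPairComparison P hq hE) (q'.comparison q f hq) f
    (pushPairComparison_hom P hq hE).symm (q'.comparison_map q f hq).symm

lemma pushPairComparisonTop_fst : pushPairComparisonTop P hq hE ≫ pullback.fst _ _ =
    pullback.fst _ _ ≫ pushPairComparison P hq hE :=
  pullback.lift_fst _ _ _

lemma pushPairComparisonTop_snd : pushPairComparisonTop P hq hE ≫ pullback.snd _ _ =
    pullback.snd _ _ ≫ q'.comparison q f hq :=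
  pullback.lift_snd _ _ _

lemma evPair_comparison : evPair P q' E' ≫ PreIdStructure.pairComparison E' E _ hE =
    pushPairComparisonTop P hq hE ≫ evPair P q E := by
  apply pullback.hom_ext
  · rw [Category.assoc, Category.assoc, PreIdStructure.pairComparison_fst, ← Category.assoc,
      evPair_fst, evPair_fst]
    exact uncurry_comparison P hq hE (pairSq P q E) (pairSq P q' E') (pushPairComparison P hq hE)
      (pushPairComparisonTop P hq hE) (pushPairComparisonTop_fst P hq hE)
      (pushPairComparisonTop_snd P hq hE) (pushPairComparison_hom P hq hE) _ _ _ _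
      (pushPairComparison_fst P hq hE).symm
  · rw [Category.assoc, Category.assoc, PreIdStructure.pairComparison_snd, ← Category.assoc,
      evPair_snd, evPair_snd]
    exact uncurry_comparison P hq hE (pairSq P q E) (pairSq P q' E') (pushPairComparison P hq hE)
      (pushPairComparisonTop P hq hE) (pushPairComparisonTop_fst P hq hE)
      (pushPairComparisonTop_snd P hq hE) (pushPairComparison_hom P hq hE) _ _ _ _
      (pushPairComparison_snd P hq hE).symm

lemma pushPath_name_baseChange :
    (pushPath P I q' E').name = pushPairComparison P hq hE ≫ (pushPath P I q E).name := by
  dsimp only [pushPath]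
  rw [← Category.assoc, comp_classify (q.paste' (pairSq P q E)) (q'.paste' (pairSq P q' E'))
    (pushPairComparison P hq hE) (pushPairComparisonTop P hq hE)
    (by rw [← Category.assoc, pushPairComparison_hom, Category.assoc, hq])
    (pushPairComparisonTop_fst P hq hE)
    (by rw [← Category.assoc, pushPairComparisonTop_snd, Category.assoc,
      Fibration.comparison_point])]
  refine congrArg (fun k ↦ classify (q'.paste' (pairSq P q' E')) k ≫ P.Pi) ?_
  rw [I.path_name_baseChange E' E _ hE, ← Category.assoc, evPair_comparison, Category.assoc]

/-- The comparison map `q'_*(Id_{B'} E') ⟶ q_*(Id_B E)` induced by a base change. -/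
def pushPathComparison : (pushPath P I q' E').dom ⟶ (pushPath P I q E).dom :=
  (pushPath P I q' E').comparison (pushPath P I q E) (pushPairComparison P hq hE)
    (pushPath_name_baseChange P I hq hE)

/-- The comparison map `Id_{A'}(q'_* E') ⟶ Id_A(q_* E)` induced by a base change. -/
def pathPushComparison : (I.path (pushFib P q' E')).dom ⟶ (I.path (pushFib P q E)).dom :=
  I.pathComparison (pushFib P q' E') (pushFib P q E) f (pushFib_name_baseChange P hq hE)

/-- The comparison map between the identity types over `q_* E ×_A q_* E` of `q_*(Id_B E)`. -/
def pathPushPathComparison :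
    (I.path (pushPath P I q' E')).dom ⟶ (I.path (pushPath P I q E)).dom :=
  I.pathComparison (pushPath P I q' E') (pushPath P I q E) (pushPairComparison P hq hE)
    (pushPath_name_baseChange P I hq hE)

/-- The comparison map between the identity types over `q_* E ×_A q_* E` of `Id_A(q_* E)`. -/
def pathPathPushComparison :
    (I.path (I.path (pushFib P q' E'))).dom ⟶ (I.path (I.path (pushFib P q E))).dom :=
  I.pathComparison (I.path (pushFib P q' E')) (I.path (pushFib P q E)) (pushPairComparison P hq hE)
    (I.path_name_baseChange (pushFib P q' E') (pushFib P q E) f (pushFib_name_baseChange P hq hE))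

end BaseChange

end Pi

section FunExt

variable [HasFiniteLimits C] {π : Ut ⟶ U} [ChosenPullbacksAlong π] [ExponentiableMorphism π]

/-- A pointed `Id`-function extensionality structure: a structured lift, over `U`, of
`P_π(refl) : P_π(Ut) ⟶ P_π(Id_U(Ut))` against `U × π : U × Ut ⟶ U × U`. -/
def PtdFunExt (I : PreIdStructure π) :=
  StructuredLift
    (Over.homMk ((poly π).map I.genericRefl) (poly_map_hom π I.genericRefl) :
      Over.mk (polyHom π Ut) ⟶ Over.mk (polyHom π I.generic.dom))
    (constOver U π)

/-- An `Id`-homotopy over `B` from `f` to `g`, maps into a `π`-fibrant object `F` over `B`,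
constant along `i`: a map `X ⟶ Id_B(F)` with endpoints `f` and `g` which restricts along `i` to the
reflexivity homotopy of `f i` (so that in particular `f i = g i`). -/
structure ConstHomotopy (I : PreIdStructure π) {B : C} (F : Fibration π B) {W X : C} (i : W ⟶ X)
    (f g : X ⟶ F.dom) where
  hom : X ⟶ (I.path F).dom
  hom_fst : hom ≫ (I.path F).map ≫ pullback.fst F.map F.map = f
  hom_snd : hom ≫ (I.path F).map ≫ pullback.snd F.map F.map = g
  const : i ≫ hom = i ≫ f ≫ I.refl F

/-- The canonical map `J : Id_A(q_* E) ⟶ q_*(Id_B E)` over `q_* E ×_A q_* E` and under `q_* E`,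
obtained by `Id`-elimination. -/
def pathToPush (I : IdStructure π) (P : PiStructure π) {A : C} (q : Fibration π A)
    (E : Fibration π q.dom) : (I.path (pushFib P q E)).dom ⟶ (pushPath P I.1 q E).dom :=
  (pushPath P I.1 q E).lift (I.path (pushFib P q E)).map
    (I.elim (pushFib P q E) ((I.path (pushFib P q E)).map ≫ (pushPath P I.1 q E).name)
      (pushRefl P I.1 q E ≫ (pushPath P I.1 q E).point) (by
        rw [PreIdStructure.refl_map_assoc, Category.assoc, ← (pushPath P I.1 q E).isPullback.w,
          ← Category.assoc, pushRefl_map]))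
    (I.elim_type _ _ _ _).symm

lemma pathToPush_map (I : IdStructure π) (P : PiStructure π) {A : C} (q : Fibration π A)
    (E : Fibration π q.dom) : pathToPush I P q E ≫ (pushPath P I.1 q E).map =
      (I.path (pushFib P q E)).map :=
  Fibration.lift_map ..

lemma refl_pathToPush (I : IdStructure π) (P : PiStructure π) {A : C} (q : Fibration π A)
    (E : Fibration π q.dom) : I.refl (pushFib P q E) ≫ pathToPush I P q E =
      pushRefl P I.1 q E := by
  apply (pushPath P I.1 q E).hom_ext
  · rw [Category.assoc, pathToPush_map, PreIdStructure.refl_map, pushRefl_map]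
  · rw [Category.assoc, pathToPush, Fibration.lift_point, IdStructure.refl_elim]

/-- A type-theoretic pointed `(Id, Π)`-function extensionality structure: for all `π`-fibrations
`q : B ⟶ A` and `E ⟶ B`, maps `s, r : q_*(Id_B E) ⟶ Id_A(q_* E)` over `q_* E ×_A q_* E` and under
`q_* E`, with homotopies over `q_* E ×_A q_* E` from `J s` to the identity, constant along
`q_*(refl)`, and from `r J` to the identity, constant along `refl`. These are stable under the
selected base changes: the data at the base change of `(q, E)` along `f` is the base change along
`f` of the data at `(q, E)`, i.e. it commutes with it through the comparison maps, which are the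
upper maps of the pullback squares over `q'_* E' ×_{A'} q'_* E' ⟶ q_* E ×_A q_* E`. -/
structure TTPtdFunExt (I : IdStructure π) (P : PiStructure π) where
  s {A : C} (q : Fibration π A) (E : Fibration π q.dom) :
    (pushPath P I.1 q E).dom ⟶ (I.path (pushFib P q E)).dom
  r {A : C} (q : Fibration π A) (E : Fibration π q.dom) :
    (pushPath P I.1 q E).dom ⟶ (I.path (pushFib P q E)).dom
  s_over {A : C} (q : Fibration π A) (E : Fibration π q.dom) :
    s q E ≫ (I.path (pushFib P q E)).map = (pushPath P I.1 q E).map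
  r_over {A : C} (q : Fibration π A) (E : Fibration π q.dom) :
    r q E ≫ (I.path (pushFib P q E)).map = (pushPath P I.1 q E).map
  s_under {A : C} (q : Fibration π A) (E : Fibration π q.dom) :
    pushRefl P I.1 q E ≫ s q E = I.refl (pushFib P q E)
  r_under {A : C} (q : Fibration π A) (E : Fibration π q.dom) :
    pushRefl P I.1 q E ≫ r q E = I.refl (pushFib P q E)
  Hs {A : C} (q : Fibration π A) (E : Fibration π q.dom) :
    ConstHomotopy I.1 (pushPath P I.1 q E) (pushRefl P I.1 q E) (s q E ≫ pathToPush I P q E) (𝟙 _)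
  Hr {A : C} (q : Fibration π A) (E : Fibration π q.dom) :
    ConstHomotopy I.1 (I.path (pushFib P q E)) (I.refl (pushFib P q E))
      (pathToPush I P q E ≫ r q E) (𝟙 _)
  s_stable {A A' : C} (f : A' ⟶ A) (q : Fibration π A) (E : Fibration π q.dom) :
    s (q.baseChange f) (E.baseChange (q.baseChangeMap f)) ≫
        pathPushComparison P I.1 (q := q) (f := f) rfl (E := E) rfl =
      pushPathComparison P I.1 rfl rfl ≫ s q E
  r_stable {A A' : C} (f : A' ⟶ A) (q : Fibration π A) (E : Fibration π q.dom) :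
    r (q.baseChange f) (E.baseChange (q.baseChangeMap f)) ≫
        pathPushComparison P I.1 (q := q) (f := f) rfl (E := E) rfl =
      pushPathComparison P I.1 rfl rfl ≫ r q E
  Hs_stable {A A' : C} (f : A' ⟶ A) (q : Fibration π A) (E : Fibration π q.dom) :
    (Hs (q.baseChange f) (E.baseChange (q.baseChangeMap f))).hom ≫
        pathPushPathComparison P I.1 (q := q) (f := f) rfl (E := E) rfl =
      pushPathComparison P I.1 rfl rfl ≫ (Hs q E).hom
  Hr_stable {A A' : C} (f : A' ⟶ A) (q : Fibration π A) (E : Fibration π q.dom) :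
    (Hr (q.baseChange f) (E.baseChange (q.baseChangeMap f))).hom ≫
        pathPathPushComparison P I.1 (q := q) (f := f) rfl (E := E) rfl =
      pathPushComparison P I.1 rfl rfl ≫ (Hr q E).hom

end FunExt

end
end UnivCat

/-! ### Base changes of a map, and lifts against `π` uniform in the base change. -/

namespace UnivCat

noncomputable section

variable {C : Type u} [Category.{v} C]

attribute [local simp] pullback.lift_fst pullback.lift_snd pullback.lift_fst_assoc
  pullback.lift_snd_assoc

/-! A map over S into S × Z is the same as a map into Z. Hence a structured lift of i against S × π
over S amounts to a choice of fillers against π for all base changes of i along maps into S, natural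
in the base change: a `UniformLift` (`toStructured`, `ofStructured`). In this form lifts can be base
changed (`UniformLift.baseChange`), and a lift over S is also a lift over R for every S → R
(`UniformLift.image`).

A pair of composable π-fibrations (q, E) over A has a classifying map A → P_π(U), and q_*(refl) is
the base change of P_π(refl) along it (`pushReflBaseChange`). The pair classified by the identity of
P_π(U) is generic: every pair is a base change of it (`name_eq_genericTotal`), and its q_*(refl) is
P_π(refl) up to isomorphism. Both implications are therefore decided at the generic pair.

From pointed to type-theoretic: the generic q_*(refl) lifts against π, hence against all
π-fibrations. Lifting it against ev_∂ of the identity type of q_*E gives s. The maps J s and 1 agree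
along q_*(refl), so another lift gives H_s; s J and 1 agree along refl, so Id-elimination gives H_r
with r = s. These data are pulled back to every pair along its classifying map. Stability follows
because classifying maps compose, and because J is itself stable (`pathToPush_comparison`), which
rests on the uniformity of Id-elimination (`IdStructure.elim_baseChange`).

From type-theoretic to pointed: s, J and H_s exhibit q_*(refl) as a retract of refl : q_*E →
Id_A(q_*E), under q_*E and up to homotopy. Let c be a type over q_*(Id_B E) and d a term of it along
q_*(refl). Id-elimination extends d to a term of the pullback of c along J; restricting along s
gives a term of the pullback of c along J s, and transport along H_s turns it into a term of c.
Transport is itself an Id-elimination, into a function type. Since H_s is constant along q_*(refl),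
transport is the identity there and the filler restricts strictly to d. Every step is stable under
base change, so the result is a uniform lift (`HomotopyRetract.uniformLift`). -/

/-- A base change of `i : K ⟶ L` along a map into `S`, where `L` lies over `S` by `l`. -/
structure BaseChange {K L S : C} (i : K ⟶ L) (l : L ⟶ S) where
  base : C
  hom : base ⟶ S
  dom : C
  cod : C
  map : dom ⟶ cod
  toBase : cod ⟶ base
  domMap : dom ⟶ K
  codMap : cod ⟶ L
  isPullback_cod : IsPullback toBase codMap hom l
  isPullback_dom : IsPullback map domMap codMap i

namespace BaseChange

variable {K L S : C} {i : K ⟶ L} {l : L ⟶ S}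

/-- A morphism of base changes, over a map of the bases. -/
structure Hom (D' D : BaseChange i l) where
  base : D'.base ⟶ D.base
  dom : D'.dom ⟶ D.dom
  cod : D'.cod ⟶ D.cod
  base_hom : base ≫ D.hom = D'.hom
  cod_toBase : cod ≫ D.toBase = D'.toBase ≫ base
  cod_codMap : cod ≫ D.codMap = D'.codMap
  dom_map : dom ≫ D.map = D'.map ≫ cod
  dom_domMap : dom ≫ D.domMap = D'.domMap

/-- A base change of a base change of `i`. -/
abbrev trans (D₀ : BaseChange i l) (D : BaseChange D₀.map D₀.toBase) : BaseChange i l where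
  base := D.base
  hom := D.hom ≫ D₀.hom
  dom := D.dom
  cod := D.cod
  map := D.map
  toBase := D.toBase
  domMap := D.domMap ≫ D₀.domMap
  codMap := D.codMap ≫ D₀.codMap
  isPullback_cod := (D.isPullback_cod.flip.paste_horiz D₀.isPullback_cod.flip).flip
  isPullback_dom := (D.isPullback_dom.flip.paste_horiz D₀.isPullback_dom.flip).flip

def Hom.trans (D₀ : BaseChange i l) {D' D : BaseChange D₀.map D₀.toBase} (t : Hom D' D) :
    Hom (D₀.trans D') (D₀.trans D) where
  base := t.base
  dom := t.dom
  cod := t.cod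
  base_hom := by simp [BaseChange.trans, reassoc_of% t.base_hom]
  cod_toBase := t.cod_toBase
  cod_codMap := by simp [BaseChange.trans, reassoc_of% t.cod_codMap]
  dom_map := t.dom_map
  dom_domMap := by simp [BaseChange.trans, reassoc_of% t.dom_domMap]

section

variable [HasPullbacks C] {R : C} {g : S ⟶ R}

/-- A base change along `x : X ⟶ R` of a map over `R` which lies over `S` is a base change along
`X ×_R S ⟶ S`. -/
abbrev refine (D : BaseChange i (l ≫ g)) : BaseChange i l where
  base := pullback D.hom g
  hom := pullback.snd _ _
  dom := D.dom
  cod := D.cod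
  map := D.map
  toBase := pullback.lift D.toBase (D.codMap ≫ l) (by
    rw [D.isPullback_cod.w, Category.assoc])
  domMap := D.domMap
  codMap := D.codMap
  -- Pasting law: the outer rectangle is the base change square along `X`, and the defining square
  -- of the fibre product with `S` is cancelled from it.
  isPullback_cod := by
    refine IsPullback.of_right (h₁₂ := pullback.fst D.hom g) ?_ (pullback.lift_snd _ _ _)
      (IsPullback.of_hasPullback _ _)
    rw [pullback.lift_fst]
    exact D.isPullback_cod
  isPullback_dom := D.isPullback_dom

def Hom.refine {D' D : BaseChange i (l ≫ g)} (t : Hom D' D) : Hom D'.refine D.refine where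
  base := pullback.map _ _ _ _ t.base (𝟙 _) (𝟙 _) (by simp [t.base_hom]) (by simp)
  dom := t.dom
  cod := t.cod
  base_hom := by simp [BaseChange.refine]
  cod_toBase := by
    apply pullback.hom_ext
    · simp [BaseChange.refine, t.cod_toBase]
    · simp [BaseChange.refine, reassoc_of% t.cod_codMap]
  cod_codMap := t.cod_codMap
  dom_map := t.dom_map
  dom_domMap := t.dom_domMap

end

end BaseChange

/-- A lift of all base changes of `i` against `π`, compatible with base change. -/
structure UniformLift {Ut U : C} (π : Ut ⟶ U) {K L S : C} (i : K ⟶ L) (l : L ⟶ S) where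
  fill (D : BaseChange i l) (c : D.cod ⟶ U) (d : D.dom ⟶ Ut) (w : d ≫ π = D.map ≫ c) : D.cod ⟶ Ut
  fac_left (D : BaseChange i l) (c : D.cod ⟶ U) (d : D.dom ⟶ Ut) (w : d ≫ π = D.map ≫ c) :
    D.map ≫ fill D c d w = d
  fac_right (D : BaseChange i l) (c : D.cod ⟶ U) (d : D.dom ⟶ Ut) (w : d ≫ π = D.map ≫ c) :
    fill D c d w ≫ π = c
  uniform {D' D : BaseChange i l} (t : D'.Hom D) (c : D.cod ⟶ U) (d : D.dom ⟶ Ut)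
    (w : d ≫ π = D.map ≫ c) : fill D' (t.cod ≫ c) (t.dom ≫ d)
      (by rw [Category.assoc, w, ← Category.assoc, t.dom_map, Category.assoc]) =
        t.cod ≫ fill D c d w

namespace UniformLift

variable {Ut U : C} {π : Ut ⟶ U} {K L S : C} {i : K ⟶ L} {l : L ⟶ S}

lemma fill_congr (F : UniformLift π i l) (D : BaseChange i l) {c c' : D.cod ⟶ U}
    {d d' : D.dom ⟶ Ut} (w : d ≫ π = D.map ≫ c) (w' : d' ≫ π = D.map ≫ c') (hc : c = c')
    (hd : d = d') : F.fill D c d w = F.fill D c' d' w' := by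
  subst hc hd
  rfl

/-- A filler depends on its boundary together with a proof of commutativity. Uniformity is needed in
a form where the restricted boundary is known only up to equality. -/
lemma uniform' (F : UniformLift π i l) {D' D : BaseChange i l} (t : D'.Hom D) {c : D.cod ⟶ U}
    {d : D.dom ⟶ Ut} (w : d ≫ π = D.map ≫ c) {c' : D'.cod ⟶ U} {d' : D'.dom ⟶ Ut}
    (w' : d' ≫ π = D'.map ≫ c') (hc : c' = t.cod ≫ c) (hd : d' = t.dom ≫ d) :
    F.fill D' c' d' w' = t.cod ≫ F.fill D c d w :=
  (F.fill_congr D' _ _ hc hd).trans (F.uniform t c d w)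

/-- The base change of a uniform lift. -/
def baseChange (F : UniformLift π i l) (D₀ : BaseChange i l) :
    UniformLift π D₀.map D₀.toBase where
  fill D c d w := F.fill (D₀.trans D) c d w
  fac_left D c d w := F.fac_left (D₀.trans D) c d w
  fac_right D c d w := F.fac_right (D₀.trans D) c d w
  uniform t c d w := F.uniform (t.trans D₀) c d w

/-- The image of a uniform lift over `S` along `S ⟶ R`. -/
def image [HasPullbacks C] (F : UniformLift π i l) {R : C} (g : S ⟶ R) :
    UniformLift π i (l ≫ g) where
  fill D c d w := F.fill D.refine c d w
  fac_left D c d w := F.fac_left D.refine c d w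
  fac_right D c d w := F.fac_right D.refine c d w
  uniform t c d w := F.uniform t.refine c d w

section Structured

variable [HasFiniteLimits C] {K L : Over S} {i : K ⟶ L}

/-- The base change of `i` along `X` in the slice over `S`. -/
abbrev sliceBaseChange (i : K ⟶ L) (X : Over S) : BaseChange i.left L.hom where
  base := X.left
  hom := X.hom
  dom := pullback X.hom K.hom
  cod := pullback X.hom L.hom
  map := (sliceProdMap (𝟙 X) i).left
  toBase := pullback.fst _ _
  domMap := pullback.snd _ _
  codMap := pullback.snd _ _
  isPullback_cod := IsPullback.of_hasPullback _ _
  isPullback_dom := by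
    refine IsPullback.of_right ?_ (sliceProdMap_snd _ _) (IsPullback.of_hasPullback _ _)
    have h1 : (sliceProdMap (𝟙 X) i).left ≫ pullback.fst X.hom L.hom =
        pullback.fst X.hom K.hom := by
      rw [sliceProdMap_fst]
      simp
    have h2 := Over.w i
    rw [h1, h2]
    exact IsPullback.of_hasPullback _ _

def sliceBaseChangeHom (i : K ⟶ L) {Y X : Over S} (t : Y ⟶ X) :
    (sliceBaseChange i Y).Hom (sliceBaseChange i X) where
  base := t.left
  dom := (sliceProdMap t (𝟙 K)).left
  cod := (sliceProdMap t (𝟙 L)).left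
  base_hom := Over.w t
  cod_toBase := sliceProdMap_fst ..
  cod_codMap := (sliceProdMap_snd ..).trans (by simp)
  dom_map := by
    refine (Over.comp_left _ _ _ _ _).symm.trans (Eq.trans ?_ (Over.comp_left _ _ _ _ _))
    rw [sliceProdMap_comp, sliceProdMap_comp]
    simp
  dom_domMap := (sliceProdMap_snd ..).trans (by simp)

/-- `S × -` is right adjoint to the forgetful functor from the slice. This is why lifting against `S
× π` over `S` reduces to lifting against `π`. -/
lemma over_const_ext {X : Over S} {Z : C} {f g : X ⟶ Over.mk (prod.fst : S ⨯ Z ⟶ S)}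
    (h : f.left ≫ prod.snd = g.left ≫ prod.snd) : f = g := by
  apply Over.OverMorphism.ext
  apply Limits.prod.hom_ext
  · exact (Over.w f).trans (Over.w g).symm
  · exact h

/-- The map over `S` into a constant object determined by a map into its fibre. -/
def toConst (X : Over S) {Z : C} (h : X.left ⟶ Z) : X ⟶ Over.mk (prod.fst : S ⨯ Z ⟶ S) :=
  Over.homMk (prod.lift X.hom h) (prod.lift_fst _ _)

lemma toConst_snd (X : Over S) {Z : C} (h : X.left ⟶ Z) : (toConst X h).left ≫ prod.snd = h :=
  prod.lift_snd _ _

lemma constOver_snd : (constOver S π).left ≫ prod.snd = prod.snd ≫ π :=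
  prod.map_snd _ _

lemma comp_constOver_snd {X : Over S} (f : X ⟶ Over.mk (prod.fst : S ⨯ Ut ⟶ S)) :
    (f ≫ constOver S π).left ≫ prod.snd = (f.left ≫ prod.snd) ≫ π :=
  (Category.assoc _ _ _).trans ((_ ≫= constOver_snd).trans (Category.assoc _ _ _).symm)

/-- A uniform lift against `π` gives a structured lift against `S × π`. -/
def toStructured (F : UniformLift π i.left L.hom) : StructuredLift i (constOver S π) where
  lift X u v w := toConst _ (F.fill (sliceBaseChange i X) (v.left ≫ prod.snd) (u.left ≫ prod.snd)
    (((comp_constOver_snd u).symm.trans (congrArg (fun k ↦ k.left ≫ prod.snd) w)).trans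
      (Category.assoc _ _ _)))
  fac_left X _ _ _ := over_const_ext ((Category.assoc _ _ _).trans
    ((_ ≫= toConst_snd _ _).trans (F.fac_left (sliceBaseChange i X) _ _ _)))
  fac_right X _ _ _ := over_const_ext ((comp_constOver_snd _).trans
    ((toConst_snd _ _ =≫ π).trans (F.fac_right (sliceBaseChange i X) _ _ _)))
  uniform {X _} t _ _ _ := over_const_ext ((toConst_snd _ _).trans
    ((F.uniform' (sliceBaseChangeHom i t) _ _ (Category.assoc _ _ _) (Category.assoc _ _ _)).trans
      ((congrArg ((sliceProdMap t (𝟙 L)).left ≫ ·) (toConst_snd (sliceProd X L) _).symm).trans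
        (Category.assoc _ _ _).symm)))

end Structured

end UniformLift

end

end UnivCat

/-! ### From structured lifts to uniform lifts. -/

namespace UnivCat

noncomputable section

variable {C : Type u} [Category.{v} C]

attribute [local simp] pullback.lift_fst pullback.lift_snd pullback.lift_fst_assoc
  pullback.lift_snd_assoc

namespace UniformLift

variable {Ut U : C} {π : Ut ⟶ U}

section Structured

variable {S : C} [HasFiniteLimits C] {K L : Over S} {i : K ⟶ L}

/-- A base change of `i` maps to the canonical one. -/
def toSlice (D : BaseChange i.left L.hom) : D.Hom (sliceBaseChange i (Over.mk D.hom)) where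
  base := 𝟙 _
  dom := pullback.lift (D.map ≫ D.toBase) D.domMap (by
    dsimp
    rw [Category.assoc, D.isPullback_cod.w, reassoc_of% D.isPullback_dom.w, Over.w])
  cod := pullback.lift D.toBase D.codMap D.isPullback_cod.w
  base_hom := Category.id_comp _
  cod_toBase := (pullback.lift_fst _ _ _).trans (Category.comp_id _).symm
  cod_codMap := pullback.lift_snd _ _ _
  dom_map := by
    apply pullback.hom_ext
    · dsimp only [sliceBaseChange]
      rw [Category.assoc, sliceProdMap_fst]
      simp
    · dsimp only [sliceBaseChange]
      rw [Category.assoc, sliceProdMap_snd]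
      simp [D.isPullback_dom.w]
  dom_domMap := pullback.lift_snd _ _ _

/-- The canonical base change of `i` maps to any other one. -/
def ofSlice (D : BaseChange i.left L.hom) : (sliceBaseChange i (Over.mk D.hom)).Hom D where
  base := 𝟙 _
  dom := D.isPullback_dom.lift ((sliceProdMap (𝟙 (Over.mk D.hom)) i).left ≫
      D.isPullback_cod.lift (pullback.fst _ _) (pullback.snd _ _) pullback.condition)
    (pullback.snd _ _) (by
      rw [Category.assoc, IsPullback.lift_snd]
      exact sliceProdMap_snd _ _)
  cod := D.isPullback_cod.lift (pullback.fst _ _) (pullback.snd _ _) pullback.condition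
  base_hom := Category.id_comp _
  cod_toBase := (IsPullback.lift_fst ..).trans (Category.comp_id _).symm
  cod_codMap := IsPullback.lift_snd ..
  dom_map := IsPullback.lift_fst ..
  dom_domMap := IsPullback.lift_snd ..

/-- A structured lift only speaks of the canonical fibre products. These mutually inverse
comparisons carry its fillers to arbitrary base changes. -/
lemma toSlice_ofSlice_cod (D : BaseChange i.left L.hom) :
    (toSlice D).cod ≫ (ofSlice D).cod = 𝟙 _ := by
  apply D.isPullback_cod.hom_ext
  · rw [Category.assoc, (ofSlice D).cod_toBase, ← Category.assoc, (toSlice D).cod_toBase]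
    simp [toSlice, ofSlice]
  · rw [Category.assoc, (ofSlice D).cod_codMap, (toSlice D).cod_codMap, Category.id_comp]

lemma ofSlice_toSlice_cod (D : BaseChange i.left L.hom) :
    (ofSlice D).cod ≫ (toSlice D).cod = 𝟙 _ := by
  apply pullback.hom_ext
  · rw [Category.assoc, (toSlice D).cod_toBase, ← Category.assoc, (ofSlice D).cod_toBase]
    simp [toSlice, ofSlice]
  · rw [Category.assoc, (toSlice D).cod_codMap, (ofSlice D).cod_codMap, Category.id_comp]

lemma toSlice_ofSlice_dom (D : BaseChange i.left L.hom) :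
    (toSlice D).dom ≫ (ofSlice D).dom = 𝟙 _ := by
  apply D.isPullback_dom.hom_ext
  · rw [Category.assoc, (ofSlice D).dom_map, ← Category.assoc, (toSlice D).dom_map,
      Category.assoc, toSlice_ofSlice_cod, Category.id_comp, Category.comp_id]
  · rw [Category.assoc, (ofSlice D).dom_domMap, (toSlice D).dom_domMap, Category.id_comp]

/-- Naturality of the comparison in the base change, needed to carry uniformity from the slice to
arbitrary base changes. -/
lemma ofSlice_comp_cod {D' D : BaseChange i.left L.hom} (t : D'.Hom D) :
    (ofSlice D').cod ≫ t.cod =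
      (sliceProdMap (Over.homMk t.base t.base_hom : Over.mk D'.hom ⟶ Over.mk D.hom) (𝟙 L)).left ≫
        (ofSlice D).cod := by
  apply D.isPullback_cod.hom_ext
  · rw [Category.assoc, Category.assoc, t.cod_toBase, (ofSlice D).cod_toBase, ← Category.assoc,
      (ofSlice D').cod_toBase, sliceProdMap_fst_assoc]
    simp [ofSlice]
  · rw [Category.assoc, Category.assoc, t.cod_codMap, (ofSlice D).cod_codMap,
      (ofSlice D').cod_codMap, sliceProdMap_snd]
    simp

lemma ofSlice_comp_dom {D' D : BaseChange i.left L.hom} (t : D'.Hom D) :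
    (ofSlice D').dom ≫ t.dom =
      (sliceProdMap (Over.homMk t.base t.base_hom : Over.mk D'.hom ⟶ Over.mk D.hom) (𝟙 K)).left ≫
        (ofSlice D).dom := by
  apply D.isPullback_dom.hom_ext
  · rw [Category.assoc, Category.assoc, t.dom_map, (ofSlice D).dom_map, ← Category.assoc,
      (ofSlice D').dom_map, Category.assoc, ofSlice_comp_cod, ← Category.assoc, ← Category.assoc]
    refine congrArg (· ≫ _) ?_
    exact (sliceBaseChangeHom i (Over.homMk t.base t.base_hom : Over.mk D'.hom ⟶
      Over.mk D.hom)).dom_map.symm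
  · rw [Category.assoc, Category.assoc, t.dom_domMap, (ofSlice D).dom_domMap,
      (ofSlice D').dom_domMap, sliceProdMap_snd]
    simp

lemma toSlice_comp_cod {D' D : BaseChange i.left L.hom} (t : D'.Hom D) :
    t.cod ≫ (toSlice D).cod = (toSlice D').cod ≫
      (sliceProdMap (Over.homMk t.base t.base_hom : Over.mk D'.hom ⟶ Over.mk D.hom) (𝟙 L)).left := by
  apply pullback.hom_ext
  · rw [Category.assoc, Category.assoc, sliceProdMap_fst]
    simp [toSlice, t.cod_toBase]
  · rw [Category.assoc, Category.assoc, sliceProdMap_snd]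
    simp [toSlice, t.cod_codMap]

lemma _root_.UnivCat.StructuredLift.lift_congr {E B : Over S} {p : E ⟶ B}
    (F : StructuredLift i p) (X : Over S) {u u' : sliceProd X K ⟶ E} {v v' : sliceProd X L ⟶ B}
    (w : u ≫ p = sliceProdMap (𝟙 X) i ≫ v) (w' : u' ≫ p = sliceProdMap (𝟙 X) i ≫ v')
    (hu : u = u') (hv : v = v') : F.lift X u v w = F.lift X u' v' w' := by
  subst hu hv
  rfl

/-- The lifting problem on `D`, moved along `ofSlice` to the canonical base change, where the
structured lift can solve it. -/
lemma ofStructured_aux (D : BaseChange i.left L.hom) (c : D.cod ⟶ U) (d : D.dom ⟶ Ut)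
    (w : d ≫ π = D.map ≫ c) :
    toConst (sliceProd (Over.mk D.hom) K) ((ofSlice D).dom ≫ d) ≫ constOver S π =
      sliceProdMap (𝟙 (Over.mk D.hom)) i ≫
        toConst (sliceProd (Over.mk D.hom) L) ((ofSlice D).cod ≫ c) := by
  apply over_const_ext
  refine (comp_constOver_snd _).trans ((toConst_snd _ _ =≫ π).trans ?_)
  refine Eq.trans ?_ ((_ ≫= toConst_snd _ _).symm.trans (Category.assoc _ _ _).symm)
  rw [Category.assoc, w, ← Category.assoc, (ofSlice D).dom_map]
  exact Category.assoc _ _ _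

/-- A structured lift against `S × π` gives a uniform lift against `π`. -/
def ofStructured (F : StructuredLift i (constOver S π)) : UniformLift π i.left L.hom where
  fill D c d w := (toSlice D).cod ≫ (F.lift _ _ _ (ofStructured_aux D c d w)).left ≫ prod.snd
  fac_left D c d w := by
    rw [← Category.assoc, ← (toSlice D).dom_map, Category.assoc]
    have := congrArg (fun k ↦ k.left ≫ prod.snd) (F.fac_left _ _ _ (ofStructured_aux D c d w))
    refine (_ ≫= (Category.assoc _ _ _).symm).trans ((_ ≫= this.trans (toConst_snd _ _)).trans ?_)
    rw [← Category.assoc, toSlice_ofSlice_dom, Category.id_comp]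
  fac_right D c d w := by
    have := congrArg (fun k ↦ k.left ≫ prod.snd) (F.fac_right _ _ _ (ofStructured_aux D c d w))
    have h := (comp_constOver_snd _).symm.trans (this.trans (toConst_snd _ _))
    refine (Category.assoc _ _ _).trans ((_ ≫= h).trans ?_)
    rw [← Category.assoc, toSlice_ofSlice_cod, Category.id_comp]
  uniform {D' D} t c d w := by
    rw [reassoc_of% toSlice_comp_cod t]
    have := congrArg (fun k ↦ k.left ≫ prod.snd) (F.uniform
      (Over.homMk t.base t.base_hom : Over.mk D'.hom ⟶ Over.mk D.hom) _ _
      (ofStructured_aux D c d w))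
    -- Uniformity of `F` solves the restricted canonical problem. It remains to see that moving a
    -- problem to the slice commutes with restricting it along `t`.
    refine _ ≫= (Eq.trans ?_ (this.trans (Category.assoc _ _ _)))
    refine congrArg (fun k : sliceProd (Over.mk D'.hom) L ⟶ _ ↦ k.left ≫ prod.snd)
      (F.lift_congr _ _ _ ?_ ?_)
    · apply over_const_ext
      refine (toConst_snd _ _).trans (Eq.trans ?_
        ((_ ≫= toConst_snd _ _).symm.trans (Category.assoc _ _ _).symm))
      rw [reassoc_of% ofSlice_comp_dom t]
    · apply over_const_ext
      refine (toConst_snd _ _).trans (Eq.trans ?_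
        ((_ ≫= toConst_snd _ _).symm.trans (Category.assoc _ _ _).symm))
      rw [reassoc_of% ofSlice_comp_cod t]

end Structured

end UniformLift

end

end UnivCat

/-! ### Identity types as base changes of the generic one, and stability of `Id`-elimination. -/

namespace UnivCat

noncomputable section

variable {C : Type u} [Category.{v} C]

attribute [local simp] pullback.lift_fst pullback.lift_snd pullback.lift_fst_assoc
  pullback.lift_snd_assoc

section Path

variable [HasFiniteLimits C] {Ut U : C} {π : Ut ⟶ U} [ChosenPullbacksAlong π]

namespace PreIdStructure

variable (I : PreIdStructure π) {B B' : C}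

/-- The map `Id_B(E) ⟶ Id_U(Ut)`. -/
def pathToGeneric (E : Fibration π B) : (I.path E).dom ⟶ I.generic.dom :=
  I.generic.lift ((I.path E).map ≫ pairMap E) (I.path E).point (by
    rw [← (I.path E).isPullback.w, path_name, Category.assoc]
    rfl)

lemma pathToGeneric_map (E : Fibration π B) :
    I.pathToGeneric E ≫ I.generic.map = (I.path E).map ≫ pairMap E :=
  I.generic.lift_map _ _ _

lemma pathToGeneric_point (E : Fibration π B) :
    I.pathToGeneric E ≫ I.generic.point = (I.path E).point :=
  I.generic.lift_point _ _ _

/-- Since `E` is `B ×_U Ut`, the fibre product `E ×_B E` is `B ×_U (Ut ×_U Ut)`. -/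
lemma isPullback_pairMap (E : Fibration π B) :
    IsPullback (pullback.fst E.map E.map ≫ E.map) (pairMap E) E.name (pullback.fst π π ≫ π) := by
  refine ⟨⟨?_⟩, ⟨PullbackCone.IsLimit.mk _
    (fun s ↦ pullback.lift
      (E.lift s.fst (s.snd ≫ pullback.fst π π) (by simpa using s.condition))
      (E.lift s.fst (s.snd ≫ pullback.snd π π) 
        (s.condition.trans ((_ ≫= pullback.condition).trans (Category.assoc _ _ _).symm))) (by simp))
    (fun s ↦ by simp) (fun s ↦ ?_) (fun s m h1 h2 ↦ ?_)⟩⟩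
  · rw [Category.assoc, E.isPullback.w, pairMap_fst_assoc]
  · apply pullback.hom_ext <;> simp
  · apply pullback.hom_ext
    · apply E.hom_ext
      · simp [h1]
      · simp [← h2]
    · apply E.hom_ext
      · simp [← h1, pullback.condition]
      · simp [← h2]

/-- Both identity types are pullbacks of `π` along `Id`, so one is the pullback of the other along
`pairMap`. Paste this with `isPullback_pairMap`. -/
lemma isPullback_pathToGeneric (E : Fibration π B) :
    IsPullback (pathHom I E) (I.pathToGeneric E) E.name I.genericHom := by
  have h : IsPullback (I.path E).map (I.pathToGeneric E) (pairMap E) I.generic.map :=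
    (IsPullback.of_right (by
      rw [pathToGeneric_point]
      exact (I.path E).isPullback.flip) (I.pathToGeneric_map E) I.generic.isPullback.flip).flip
  exact (h.flip.paste_vert (isPullback_pairMap E).flip).flip

lemma refl_pathToGeneric (E : Fibration π B) :
    I.refl E ≫ I.pathToGeneric E = E.point ≫ I.genericRefl := by
  apply I.generic.hom_ext
  · rw [Category.assoc, pathToGeneric_map, refl_map_assoc, Category.assoc, genericRefl_map]
    apply pullback.hom_ext <;> simp
  · rw [Category.assoc, pathToGeneric_point, refl_point, Category.assoc, genericRefl_point]

/-- Reflexivity is a map over the base, so the outer rectangle is the square exhibiting `E` as a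
pullback of `π`, and the pasting law applies. -/
lemma isPullback_refl (E : Fibration π B) :
    IsPullback (I.refl E) E.point (I.pathToGeneric E) I.genericRefl := by
  refine IsPullback.of_right ?_ (I.refl_pathToGeneric E) (I.isPullback_pathToGeneric E)
  rw [refl_map_assoc, pullback.diagonal_fst_assoc, genericHom, genericRefl_map_assoc,
    pullback.diagonal_fst_assoc]
  exact E.isPullback

/-- Reflexivity of a `π`-fibration as a base change of the generic reflexivity. -/
abbrev pathBaseChange (E : Fibration π B) : BaseChange I.genericRefl I.genericHom where
  base := B
  hom := E.name
  dom := E.dom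
  cod := (I.path E).dom
  map := I.refl E
  toBase := pathHom I E
  domMap := E.point
  codMap := I.pathToGeneric E
  isPullback_cod := I.isPullback_pathToGeneric E
  isPullback_dom := I.isPullback_refl E

variable (E' : Fibration π B') (E : Fibration π B) (f : B' ⟶ B) (h : E'.name = f ≫ E.name)

lemma pathComparison_map : I.pathComparison E' E f h ≫ (I.path E).map =
    (I.path E').map ≫ pairComparison E' E f h :=
  Fibration.comparison_map ..

lemma pathComparison_point : I.pathComparison E' E f h ≫ (I.path E).point = (I.path E').point :=
  Fibration.comparison_point ..

lemma refl_pathComparison :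
    I.refl E' ≫ I.pathComparison E' E f h = E'.comparison E f h ≫ I.refl E := by
  apply (I.path E).hom_ext
  · rw [Category.assoc, Category.assoc, pathComparison_map, refl_map, refl_map_assoc]
    apply pullback.hom_ext <;> simp
  · rw [Category.assoc, Category.assoc, pathComparison_point, refl_point, refl_point,
      Fibration.comparison_point_assoc]

def pathBaseChangeHom : (I.pathBaseChange E').Hom (I.pathBaseChange E) where
  base := f
  dom := E'.comparison E f h
  cod := I.pathComparison E' E f h
  base_hom := h.symm
  cod_toBase := by
    dsimp
    rw [← Category.assoc, pathComparison_map]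
    simp
  cod_codMap := by
    apply I.generic.hom_ext
    · dsimp
      rw [Category.assoc, pathToGeneric_map, pathToGeneric_map, ← Category.assoc,
        pathComparison_map, Category.assoc]
      refine _ ≫= ?_
      apply pullback.hom_ext <;> simp
    · dsimp
      rw [Category.assoc, pathToGeneric_point, pathToGeneric_point, pathComparison_point]
  dom_map := (I.refl_pathComparison E' E f h).symm
  dom_domMap := Fibration.comparison_point ..

end PreIdStructure

namespace IdStructure

variable (I : IdStructure π) {B B' : C}

/-- The lifts of base changes of the generic reflexivity map provided by an `Id`-type structure. -/
def uniformLift : UniformLift π I.genericRefl I.genericHom :=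
  UniformLift.ofStructured I.J

/-- `elim` passes through the canonical fibre product by `ofPath` and `toPath`, which are the
comparisons used in `ofStructured`. The identification makes the uniformity of `J` available for
`elim`. -/
lemma elim_eq_fill (E : Fibration π B) (c : (I.path E).dom ⟶ U) (d : E.dom ⟶ Ut)
    (h : d ≫ π = I.refl E ≫ c) :
    I.elim E c d h = I.uniformLift.fill (I.pathBaseChange E) c d h := by
  let D : BaseChange I.genericReflOver.left (Over.mk I.genericHom).hom := I.pathBaseChange E
  have e1 : (UniformLift.toSlice D).cod = I.ofPath E := rfl
  -- Here `ofSlice` and `toPath` are inverses of `ofPath` on opposite sides, so they coincide.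
  have e2 : (UniformLift.ofSlice D).cod = I.toPath E := by
    have h1 : (UniformLift.ofSlice D).cod ≫ (UniformLift.toSlice D).cod ≫ I.toPath E =
        I.toPath E := by
      rw [← Category.assoc, UniformLift.ofSlice_toSlice_cod, Category.id_comp]
    rw [← h1, e1, ofPath_toPath, Category.comp_id]
  have e3 : (UniformLift.ofSlice D).dom =
      E.lift (pullback.fst E.name π) (pullback.snd E.name π) pullback.condition := by
    apply E.hom_ext
    · rw [Fibration.lift_map]
      have h1 : E.map = D.map ≫ D.toBase := by simp [D, PreIdStructure.refl_map_assoc]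
      rw [h1, ← Category.assoc, (UniformLift.ofSlice D).dom_map, Category.assoc,
        (UniformLift.ofSlice D).cod_toBase, ← Category.assoc, sliceProdMap_fst]
      simp only [UniformLift.ofSlice, Over.mk_left, Over.id_left, Category.comp_id]
      rfl
    · rw [Fibration.lift_point]
      exact (UniformLift.ofSlice D).dom_domMap
  refine (I.ofPath E) ≫= congrArg (fun k : sliceProd (Over.mk E.name) (Over.mk I.genericHom) ⟶ _ ↦
    k.left ≫ prod.snd) (I.J.lift_congr _ _ _ ?_ ?_)
  · apply UniformLift.over_const_ext
    refine (prod.lift_snd _ _).trans (Eq.trans ?_ (prod.lift_snd _ _).symm)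
    rw [e3]
  · apply UniformLift.over_const_ext
    refine (prod.lift_snd _ _).trans (Eq.trans ?_ (prod.lift_snd _ _).symm)
    rw [e2]

lemma elim_baseChange (E' : Fibration π B') (E : Fibration π B) (f : B' ⟶ B)
    (hf : E'.name = f ≫ E.name) {c : (I.path E).dom ⟶ U} {d : E.dom ⟶ Ut}
    (h : d ≫ π = I.refl E ≫ c) {c' : (I.path E').dom ⟶ U} {d' : E'.dom ⟶ Ut}
    (h' : d' ≫ π = I.refl E' ≫ c') (hc : c' = I.pathComparison E' E f hf ≫ c)
    (hd : d' = E'.comparison E f hf ≫ d) :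
    I.elim E' c' d' h' = I.pathComparison E' E f hf ≫ I.elim E c d h := by
  rw [elim_eq_fill, elim_eq_fill]
  exact I.uniformLift.uniform' (I.pathBaseChangeHom E' E f hf) h h' hc hd

end IdStructure

end Path

end

end UnivCat

/-! ### Non-dependent function types: application and identity functions. -/

namespace UnivCat

noncomputable section

variable {C : Type u} [Category.{v} C]

section Arrow

variable [HasFiniteLimits C] {Ut U : C} {π : Ut ⟶ U} [ChosenPullbacksAlong π]
  [ExponentiableMorphism π]

/-- The map between selected fibrations over a map of the bases. -/
def selectedMap {N N' : C} (x : N' ⟶ N) (c : N ⟶ U) :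
    (selected π (x ≫ c)).dom ⟶ (selected π c).dom :=
  (selected π (x ≫ c)).comparison (selected π c) x rfl

lemma selectedMap_map {N N' : C} (x : N' ⟶ N) (c : N ⟶ U) :
    selectedMap x c ≫ (selected π c).map = (selected π (x ≫ c)).map ≫ x :=
  Fibration.comparison_map ..

lemma selectedMap_point {N N' : C} (x : N' ⟶ N) (c : N ⟶ U) :
    selectedMap x c ≫ (selected π c).point = (selected π (x ≫ c)).point :=
  Fibration.comparison_point ..

lemma comp_classify_selected {N N' X : C} (x : N' ⟶ N) (c : N ⟶ U)
    (h : (selected π c).dom ⟶ X) : x ≫ classify (selected π c).isPullback h =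
      classify (selected π (x ≫ c)).isPullback (selectedMap x c ≫ h) :=
  comp_classify (selected π c).isPullback (selected π (x ≫ c)).isPullback x (selectedMap x c)
    rfl (selectedMap_map x c) (selectedMap_point x c) h

namespace PiStructure

variable (P : PiStructure π) {N N' : C}

/-- As the `Π`-square is a pullback, an element of `P_π(Ut)` is determined by its image in `P_π(U)`
and its code. So abstraction is injective on sections of a fixed family. -/
lemma classify_lam_injective {W : C} {w₁ : W ⟶ N} {w₂ : W ⟶ Ut} {c₀ : N ⟶ U}
    (sq : IsPullback w₁ w₂ c₀ π) {h h' : W ⟶ Ut} (hπ : h ≫ π = h' ≫ π)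
    (e : classify sq h ≫ P.lam = classify sq h' ≫ P.lam) : h = h' := by
  refine classify_injective sq (P.isPullback.hom_ext ?_ e)
  rw [classify_map, classify_map, hπ]

/-- The type of functions from `c₀` to `c₁`. -/
def arrow (c₀ c₁ : N ⟶ U) : N ⟶ U :=
  classify (selected π c₀).isPullback ((selected π c₀).map ≫ c₁) ≫ P.Pi

lemma comp_arrow (x : N' ⟶ N) (c₀ c₁ : N ⟶ U) :
    x ≫ P.arrow c₀ c₁ = P.arrow (x ≫ c₀) (x ≫ c₁) := by
  rw [arrow, arrow, ← Category.assoc, comp_classify_selected,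
    reassoc_of% selectedMap_map x c₀]

/-- The type of `t` factors through the constant family `c₁`. By the pullback property of the
`Π`-square `t` comes from a map to `P_π(Ut)`, whose transpose is the required section. -/
lemma exists_fun {c₀ c₁ : N ⟶ U} {t : N ⟶ Ut} (ht : t ≫ π = P.arrow c₀ c₁) :
    ∃ h : (selected π c₀).dom ⟶ Ut, h ≫ π = (selected π c₀).map ≫ c₁ ∧
      classify (selected π c₀).isPullback h ≫ P.lam = t := by
  have e1 := P.isPullback.lift_fst _ t ht.symm
  have e2 := P.isPullback.lift_snd _ t ht.symm
  obtain ⟨h, hh⟩ := exists_classify (selected π c₀).isPullback (P.isPullback.lift _ t ht.symm) (by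
    rw [← poly_map_hom π π, reassoc_of% e1, classify_hom])
  refine ⟨h, ?_, by rw [hh, e2]⟩
  rw [← hh, classify_map] at e1
  exact classify_injective _ e1

/-- Application of a term of a function type. -/
def app {c₀ c₁ : N ⟶ U} (t a : N ⟶ Ut) (ht : t ≫ π = P.arrow c₀ c₁) (ha : a ≫ π = c₀) : N ⟶ Ut :=
  (selected π c₀).lift (𝟙 N) a (by rw [Category.id_comp, ha]; rfl) ≫ (P.exists_fun ht).choose

lemma app_type {c₀ c₁ : N ⟶ U} (t a : N ⟶ Ut) (ht : t ≫ π = P.arrow c₀ c₁) (ha : a ≫ π = c₀) :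
    P.app t a ht ha ≫ π = c₁ := by
  rw [app, Category.assoc, (P.exists_fun ht).choose_spec.1, Fibration.lift_map_assoc,
    Category.id_comp]

/-- The choice made in `app` is harmless: the section representing `t` is unique by
`classify_lam_injective`, so any representative computes the application. -/
lemma app_eq {c₀ c₁ : N ⟶ U} {t a : N ⟶ Ut} (ht : t ≫ π = P.arrow c₀ c₁) (ha : a ≫ π = c₀)
    (h : (selected π c₀).dom ⟶ Ut) (h1 : h ≫ π = (selected π c₀).map ≫ c₁)
    (h2 : classify (selected π c₀).isPullback h ≫ P.lam = t) : P.app t a ht ha =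
      (selected π c₀).lift (𝟙 N) a (by rw [Category.id_comp, ha]; rfl) ≫ h :=
  _ ≫= P.classify_lam_injective (selected π c₀).isPullback
    ((P.exists_fun ht).choose_spec.1.trans h1.symm)
    ((P.exists_fun ht).choose_spec.2.trans h2.symm)

lemma app_congr {c₀ c₁ c₀' c₁' : N ⟶ U} {t a t' a' : N ⟶ Ut} (ht : t ≫ π = P.arrow c₀ c₁)
    (ha : a ≫ π = c₀) (ht' : t' ≫ π = P.arrow c₀' c₁') (ha' : a' ≫ π = c₀') (e₁ : c₁ = c₁')
    (et : t = t') (ea : a = a') : P.app t a ht ha = P.app t' a' ht' ha' := by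
  subst e₁ et ea ha ha'
  rfl

/-- A section representing `t` restricts along `x` to one representing `x ≫ t`, and `app_eq` allows
computing with it. -/
lemma comp_app {c₀ c₁ : N ⟶ U} {t a : N ⟶ Ut} (ht : t ≫ π = P.arrow c₀ c₁) (ha : a ≫ π = c₀)
    (x : N' ⟶ N) : x ≫ P.app t a ht ha = P.app (c₀ := x ≫ c₀) (c₁ := x ≫ c₁) (x ≫ t) (x ≫ a)
      (by rw [Category.assoc, ht, comp_arrow]) (by rw [Category.assoc, ha]) := by
  obtain ⟨h, h1, h2⟩ := P.exists_fun ht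
  rw [P.app_eq ht ha h h1 h2, P.app_eq _ _ (selectedMap x c₀ ≫ h)
    (by rw [Category.assoc, h1, reassoc_of% selectedMap_map x c₀])
    (by rw [← h2, ← Category.assoc, comp_classify_selected]), ← Category.assoc, ← Category.assoc]
  refine congrArg (· ≫ h) ((selected π c₀).hom_ext ?_ ?_)
  · simp [selectedMap_map]
  · simp [selectedMap_point]

/-- The identity function of the type `c`. -/
def idFun (c : N ⟶ U) : N ⟶ Ut :=
  classify (selected π c).isPullback (selected π c).point ≫ P.lam

lemma idFun_type (c : N ⟶ U) : P.idFun c ≫ π = P.arrow c c := by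
  rw [idFun, Category.assoc, ← P.isPullback.w, ← Category.assoc, classify_map,
    ← (selected π c).isPullback.w]
  rfl

lemma comp_idFun (x : N' ⟶ N) (c : N ⟶ U) : x ≫ P.idFun c = P.idFun (x ≫ c) := by
  rw [idFun, idFun, ← Category.assoc, comp_classify_selected, selectedMap_point]

lemma app_idFun {c : N ⟶ U} (a : N ⟶ Ut) (ha : a ≫ π = c) :
    P.app (P.idFun c) a (P.idFun_type c) ha = a :=
  (P.app_eq _ ha _ (selected π c).isPullback.w.symm rfl).trans (Fibration.lift_point ..)

end PiStructure

end Arrow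

/-! ### Transfer of uniform lifts along homotopy retracts. -/

section Transport

variable [HasFiniteLimits C]

namespace BaseChange

variable {K L S X W : C} {x : X ⟶ S} {k : K ⟶ S} {w₁ : W ⟶ X} {w₂ : W ⟶ K}

/-- The base change of a map over `S` obtained from a base change of its domain. -/
abbrev ofDom (sq : IsPullback w₁ w₂ x k) (i : K ⟶ L) (l : L ⟶ S) (h : i ≫ l = k) :
    BaseChange i l where
  base := X
  hom := x
  dom := W
  cod := pullback x l
  map := pullback.lift w₁ (w₂ ≫ i) (by rw [sq.w, Category.assoc, h])
  toBase := pullback.fst _ _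
  domMap := w₂
  codMap := pullback.snd _ _
  isPullback_cod := IsPullback.of_hasPullback _ _
  isPullback_dom := by
    refine IsPullback.of_right ?_ (pullback.lift_snd _ _ _) (IsPullback.of_hasPullback _ _)
    rw [pullback.lift_fst, h]
    exact sq

def Hom.ofDom {X' W' : C} {x' : X' ⟶ S} {w₁' : W' ⟶ X'} {w₂' : W' ⟶ K}
    (sq' : IsPullback w₁' w₂' x' k) (sq : IsPullback w₁ w₂ x k) (i : K ⟶ L) (l : L ⟶ S)
    (h : i ≫ l = k) (t : X' ⟶ X) (t' : W' ⟶ W) (ht : t ≫ x = x') (h1 : t' ≫ w₁ = w₁' ≫ t)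
    (h2 : t' ≫ w₂ = w₂') : (BaseChange.ofDom sq' i l h).Hom (BaseChange.ofDom sq i l h) where
  base := t
  dom := t'
  cod := pullback.map _ _ _ _ t (𝟙 _) (𝟙 _) (by simp [ht]) (by simp)
  base_hom := ht
  cod_toBase := pullback.lift_fst _ _ _
  cod_codMap := (pullback.lift_snd _ _ _).trans (Category.comp_id _)
  dom_map := by
    apply pullback.hom_ext
    · simp [pullback.lift_fst, pullback.lift_fst_assoc, h1]
    · simp [pullback.lift_snd, reassoc_of% h2]
  dom_domMap := h2

lemma cod_ext {i : K ⟶ L} {l : L ⟶ S} (D : BaseChange i l) {Z : C} {f g : Z ⟶ D.cod}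
    (h1 : f ≫ D.toBase = g ≫ D.toBase) (h2 : f ≫ D.codMap = g ≫ D.codMap) : f = g :=
  D.isPullback_cod.hom_ext h1 h2

end BaseChange

variable {Ut U : C} {π : Ut ⟶ U} [ChosenPullbacksAlong π] [ExponentiableMorphism π]

/-- The structure map of `Id_M(F)` over `A`, where `M` lies over `A` by `m`. -/
def pathTo (I : PreIdStructure π) {A M : C} (F : Fibration π M) (m : M ⟶ A) : (I.path F).dom ⟶ A :=
  pathHom I F ≫ m

lemma pathTo_eq (I : PreIdStructure π) {A M : C} (F : Fibration π M) (m : M ⟶ A) :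
    pathTo I F m = (I.path F).map ≫ pullback.fst F.map F.map ≫ F.map ≫ m := by
  simp [pathTo]

lemma pathTo_eq' (I : PreIdStructure π) {A M : C} (F : Fibration π M) (m : M ⟶ A) :
    pathTo I F m = (I.path F).map ≫ pullback.snd F.map F.map ≫ F.map ≫ m := by
  rw [pathTo_eq, pullback.condition_assoc]

lemma refl_pathTo (I : PreIdStructure π) {A M : C} (F : Fibration π M) (m : M ⟶ A) :
    I.refl F ≫ pathTo I F m = F.map ≫ m := by
  rw [pathTo_eq, PreIdStructure.refl_map_assoc, pullback.diagonal_fst_assoc]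

/-- Maps `J` and `s` over `A` exhibiting `i : K ⟶ F`, under `K`, as a retract of `r : K ⟶ D` up to
an `Id`-homotopy constant along `i`. -/
structure HomotopyRetract (I : PreIdStructure π) {A M K D : C} (F : Fibration π M) (m : M ⟶ A)
    (i : K ⟶ F.dom) (r : K ⟶ D) (δ : D ⟶ A) where
  J : D ⟶ F.dom
  s : F.dom ⟶ D
  J_over : J ≫ F.map ≫ m = δ
  s_over : s ≫ δ = F.map ≫ m
  r_J : r ≫ J = i
  i_s : i ≫ s = r
  H : ConstHomotopy I F i (s ≫ J) (𝟙 _)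

namespace HomotopyRetract

section

variable {I : PreIdStructure π} {A M K D : C} {F : Fibration π M} {m : M ⟶ A} {i : K ⟶ F.dom}
  {r : K ⟶ D} {δ : D ⟶ A} (R : HomotopyRetract I F m i r δ)

include R in
lemma r_δ : r ≫ δ = i ≫ F.map ≫ m := by
  rw [← R.J_over, reassoc_of% R.r_J]

/-- The base change of `r` associated with a base change of `i`. -/
abbrev baseChange (X : BaseChange i (F.map ≫ m)) : BaseChange r δ :=
  .ofDom (X.isPullback_dom.flip.paste_vert X.isPullback_cod.flip).flip r δ R.r_δ

def baseChangeHom {X' X : BaseChange i (F.map ≫ m)} (t : X'.Hom X) :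
    (R.baseChange X').Hom (R.baseChange X) :=
  .ofDom _ _ _ _ _ t.base t.dom t.base_hom
    (by rw [← Category.assoc, t.dom_map, Category.assoc, Category.assoc, t.cod_toBase])
    t.dom_domMap

/-- The base change of reflexivity associated with a base change of `i`. -/
abbrev reflBaseChange (X : BaseChange i (F.map ≫ m)) :
    BaseChange (I.refl F) (pathTo I F m) :=
  .ofDom X.isPullback_cod (I.refl F) (pathTo I F m) (refl_pathTo I F m)

def reflBaseChangeHom {X' X : BaseChange i (F.map ≫ m)} (t : X'.Hom X) :
    (reflBaseChange (I := I) X').Hom (reflBaseChange X) :=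
  .ofDom _ _ _ _ _ t.base t.cod t.base_hom t.cod_toBase t.cod_codMap

variable (X : BaseChange i (F.map ≫ m))

/-- The base change of `J`. -/
def JX : (R.baseChange X).cod ⟶ X.cod :=
  X.isPullback_cod.lift (pullback.fst _ _) (pullback.snd _ _ ≫ R.J)
    (by rw [Category.assoc, R.J_over, pullback.condition])

lemma JX_toBase : R.JX X ≫ X.toBase = pullback.fst _ _ := IsPullback.lift_fst ..

lemma JX_codMap : R.JX X ≫ X.codMap = pullback.snd _ _ ≫ R.J := IsPullback.lift_snd ..

/-- The base change of `s`. -/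
def sX : X.cod ⟶ (R.baseChange X).cod :=
  pullback.lift X.toBase (X.codMap ≫ R.s) (by
    rw [Category.assoc, R.s_over, X.isPullback_cod.w])

lemma sX_fst : R.sX X ≫ pullback.fst _ _ = X.toBase := pullback.lift_fst _ _ _

lemma sX_snd : R.sX X ≫ pullback.snd _ _ = X.codMap ≫ R.s := pullback.lift_snd _ _ _

/-- The base change of the first endpoint. -/
def src : (reflBaseChange (I := I) X).cod ⟶ X.cod :=
  X.isPullback_cod.lift (pullback.fst _ _)
    (pullback.snd _ _ ≫ (I.path F).map ≫ pullback.fst F.map F.map)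
    (pullback.condition.trans ((_ ≫= pathTo_eq I F m).trans (by simp)))

lemma src_toBase : src X ≫ X.toBase = pullback.fst X.hom (pathTo I F m) :=
  IsPullback.lift_fst ..

lemma src_codMap : src X ≫ X.codMap = pullback.snd X.hom (pathTo I F m) ≫ (I.path F).map ≫
    pullback.fst F.map F.map := IsPullback.lift_snd ..

/-- The base change of the second endpoint. -/
def tgt : (reflBaseChange (I := I) X).cod ⟶ X.cod :=
  X.isPullback_cod.lift (pullback.fst _ _)
    (pullback.snd _ _ ≫ (I.path F).map ≫ pullback.snd F.map F.map)
    (pullback.condition.trans ((_ ≫= pathTo_eq' I F m).trans (by simp)))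

lemma tgt_toBase : tgt X ≫ X.toBase = pullback.fst X.hom (pathTo I F m) :=
  IsPullback.lift_fst ..

lemma tgt_codMap : tgt X ≫ X.codMap = pullback.snd X.hom (pathTo I F m) ≫ (I.path F).map ≫
    pullback.snd F.map F.map := IsPullback.lift_snd ..

/-- The base change of the homotopy. -/
def HX : X.cod ⟶ (reflBaseChange (I := I) X).cod :=
  pullback.lift X.toBase (X.codMap ≫ R.H.hom) (by
    have h := R.H.hom_snd =≫ (F.map ≫ m)
    rw [X.isPullback_cod.w, pathTo_eq, pullback.condition_assoc]
    simp only [Category.assoc, Category.id_comp] at h ⊢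
    rw [h])

lemma HX_fst : R.HX X ≫ pullback.fst X.hom (pathTo I F m) = X.toBase := pullback.lift_fst _ _ _

lemma HX_snd : R.HX X ≫ pullback.snd X.hom (pathTo I F m) = X.codMap ≫ R.H.hom :=
  pullback.lift_snd _ _ _

lemma refl_src : (reflBaseChange (I := I) X).map ≫ src X = 𝟙 _ := by
  apply X.cod_ext
  · rw [Category.assoc, src_toBase, pullback.lift_fst, Category.id_comp]
  · rw [Category.assoc, src_codMap, pullback.lift_snd_assoc, Category.assoc,
      PreIdStructure.refl_map_assoc, pullback.diagonal_fst, Category.comp_id, Category.id_comp]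

lemma refl_tgt : (reflBaseChange (I := I) X).map ≫ tgt X = 𝟙 _ := by
  apply X.cod_ext
  · rw [Category.assoc, tgt_toBase, pullback.lift_fst, Category.id_comp]
  · rw [Category.assoc, tgt_codMap, pullback.lift_snd_assoc, Category.assoc,
      PreIdStructure.refl_map_assoc, pullback.diagonal_snd, Category.comp_id, Category.id_comp]

lemma HX_src : R.HX X ≫ src X = R.sX X ≫ R.JX X := by
  apply X.cod_ext
  · rw [Category.assoc, Category.assoc, src_toBase, JX_toBase, HX_fst, sX_fst]
  · rw [Category.assoc, Category.assoc, src_codMap, JX_codMap, reassoc_of% R.HX_snd X,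
      reassoc_of% R.sX_snd X, R.H.hom_fst]

lemma HX_tgt : R.HX X ≫ tgt X = 𝟙 _ := by
  apply X.cod_ext
  · rw [Category.assoc, tgt_toBase, HX_fst, Category.id_comp]
  · rw [Category.assoc, tgt_codMap, reassoc_of% R.HX_snd X, R.H.hom_snd, Category.comp_id,
      Category.id_comp]

lemma map_sX : X.map ≫ R.sX X = (R.baseChange X).map := by
  apply pullback.hom_ext
  · rw [Category.assoc, sX_fst, pullback.lift_fst]
  · rw [Category.assoc, sX_snd, pullback.lift_snd, ← Category.assoc, X.isPullback_dom.w,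
      Category.assoc, R.i_s]

lemma map_JX : (R.baseChange X).map ≫ R.JX X = X.map := by
  apply X.cod_ext
  · rw [Category.assoc, JX_toBase, pullback.lift_fst]
  · rw [Category.assoc, JX_codMap, pullback.lift_snd_assoc, Category.assoc, R.r_J,
      X.isPullback_dom.w]

/-- Constancy of the homotopy enters here. Along `i` it is reflexivity at `i ≫ s ≫ J`, and this is
`r ≫ J = i`. -/
lemma map_HX : X.map ≫ R.HX X = X.map ≫ (reflBaseChange (I := I) X).map := by
  apply pullback.hom_ext
  · rw [Category.assoc, Category.assoc, HX_fst, pullback.lift_fst]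
  · rw [Category.assoc, Category.assoc, HX_snd, pullback.lift_snd, ← Category.assoc,
      ← Category.assoc, X.isPullback_dom.w, Category.assoc, Category.assoc, R.H.const,
      Category.assoc, reassoc_of% R.i_s, reassoc_of% R.r_J]

variable {X} {X' : BaseChange i (F.map ≫ m)} (t : X'.Hom X)

lemma sX_natural : R.sX X' ≫ (R.baseChangeHom t).cod = t.cod ≫ R.sX X := by
  apply pullback.hom_ext
  · rw [Category.assoc, Category.assoc, sX_fst, (R.baseChangeHom t).cod_toBase,
      reassoc_of% R.sX_fst X', t.cod_toBase]
    rfl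
  · rw [Category.assoc, Category.assoc, sX_snd, (R.baseChangeHom t).cod_codMap, sX_snd,
      reassoc_of% t.cod_codMap]

lemma JX_natural : R.JX X' ≫ t.cod = (R.baseChangeHom t).cod ≫ R.JX X := by
  apply X.cod_ext
  · rw [Category.assoc, Category.assoc, JX_toBase, (R.baseChangeHom t).cod_toBase, t.cod_toBase,
      reassoc_of% R.JX_toBase X']
    rfl
  · rw [Category.assoc, Category.assoc, JX_codMap, t.cod_codMap, JX_codMap,
      reassoc_of% (R.baseChangeHom t).cod_codMap]

lemma HX_natural : R.HX X' ≫ (reflBaseChangeHom t).cod = t.cod ≫ R.HX X := by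
  apply pullback.hom_ext
  · rw [Category.assoc, Category.assoc, HX_fst, (reflBaseChangeHom t).cod_toBase,
      reassoc_of% R.HX_fst X', t.cod_toBase]
    rfl
  · rw [Category.assoc, Category.assoc, HX_snd, (reflBaseChangeHom t).cod_codMap, HX_snd,
      reassoc_of% t.cod_codMap]

lemma src_natural : src (I := I) X' ≫ t.cod = (reflBaseChangeHom t).cod ≫ src X := by
  apply X.cod_ext
  · rw [Category.assoc, Category.assoc, src_toBase, (reflBaseChangeHom t).cod_toBase, t.cod_toBase,
      reassoc_of% src_toBase X']
    rfl
  · rw [Category.assoc, Category.assoc, src_codMap, t.cod_codMap, src_codMap,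
      reassoc_of% (reflBaseChangeHom t).cod_codMap]

lemma tgt_natural : tgt (I := I) X' ≫ t.cod = (reflBaseChangeHom t).cod ≫ tgt X := by
  apply X.cod_ext
  · rw [Category.assoc, Category.assoc, tgt_toBase, (reflBaseChangeHom t).cod_toBase, t.cod_toBase,
      reassoc_of% tgt_toBase X']
    rfl
  · rw [Category.assoc, Category.assoc, tgt_codMap, t.cod_codMap, tgt_codMap,
      reassoc_of% (reflBaseChangeHom t).cod_codMap]

end

section

variable (P : PiStructure π) {I : PreIdStructure π} {A M K D : C} {F : Fibration π M} {m : M ⟶ A}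
  {i : K ⟶ F.dom} {r : K ⟶ D} {δ : D ⟶ A} (R : HomotopyRetract I F m i r δ)
  (G : UniformLift π r δ) (T : UniformLift π (I.refl F) (pathTo I F m))

/-- Transport in the type `c` along paths in (a base change of) `F`. -/
def transport (X : BaseChange i (F.map ≫ m)) (c : X.cod ⟶ U) :
    (reflBaseChange (I := I) X).cod ⟶ Ut :=
  -- Path induction: the motive is the type of functions from the fibre of `c` at the source to that
  -- at the target, and over reflexivity the identity function is a term of it.
  T.fill (reflBaseChange X) (P.arrow (src X ≫ c) (tgt X ≫ c)) (P.idFun c) (by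
    rw [PiStructure.idFun_type, PiStructure.comp_arrow, reassoc_of% refl_src X,
      reassoc_of% refl_tgt X])

lemma HX_transport_type (X : BaseChange i (F.map ≫ m)) (c : X.cod ⟶ U) :
    (R.HX X ≫ transport P T X c) ≫ π = P.arrow (R.sX X ≫ R.JX X ≫ c) c := by
  rw [Category.assoc, transport, T.fac_right, PiStructure.comp_arrow, reassoc_of% R.HX_src X,
    reassoc_of% R.HX_tgt X]

/-- Endpoints, function types and identity functions are all stable under base change, so the
uniformity of `T` applies. -/
lemma transport_natural {X' X : BaseChange i (F.map ≫ m)} (t : X'.Hom X) (c : X.cod ⟶ U) :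
    transport P T X' (t.cod ≫ c) = (reflBaseChangeHom t).cod ≫ transport P T X c := by
  refine T.uniform' (reflBaseChangeHom t) _ _ ?_ ?_
  · rw [PiStructure.comp_arrow, reassoc_of% src_natural t, reassoc_of% tgt_natural t]
  · exact (P.comp_idFun t.cod c).symm

lemma map_HX_transport (X : BaseChange i (F.map ≫ m)) (c : X.cod ⟶ U) :
    X.map ≫ R.HX X ≫ transport P T X c = P.idFun (X.map ≫ c) := by
  rw [reassoc_of% R.map_HX X, ← PiStructure.comp_idFun]
  exact _ ≫= T.fac_left (reflBaseChange X) _ _ _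

variable {P} in
lemma retract_w {X : BaseChange i (F.map ≫ m)} {c : X.cod ⟶ U} {d : X.dom ⟶ Ut}
    (w : d ≫ π = X.map ≫ c) : d ≫ π = (R.baseChange X).map ≫ R.JX X ≫ c := by
  rw [w, reassoc_of% R.map_JX X]

/-- The restriction along `s` of a lift on `r`. -/
def restrict (X : BaseChange i (F.map ≫ m)) (c : X.cod ⟶ U) (d : X.dom ⟶ Ut)
    (w : d ≫ π = X.map ≫ c) : X.cod ⟶ Ut :=
  R.sX X ≫ G.fill (R.baseChange X) (R.JX X ≫ c) d (R.retract_w w)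

lemma restrict_type (X : BaseChange i (F.map ≫ m)) (c : X.cod ⟶ U) (d : X.dom ⟶ Ut)
    (w : d ≫ π = X.map ≫ c) : R.restrict G X c d w ≫ π = R.sX X ≫ R.JX X ≫ c := by
  rw [restrict, Category.assoc, G.fac_right]

lemma map_restrict (X : BaseChange i (F.map ≫ m)) (c : X.cod ⟶ U) (d : X.dom ⟶ Ut)
    (w : d ≫ π = X.map ≫ c) : X.map ≫ R.restrict G X c d w = d := by
  rw [restrict, reassoc_of% R.map_sX X]
  exact G.fac_left (R.baseChange X) _ _ _

lemma restrict_natural {X' X : BaseChange i (F.map ≫ m)} (t : X'.Hom X) (c : X.cod ⟶ U)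
    (d : X.dom ⟶ Ut) (w : d ≫ π = X.map ≫ c)
    (w' : (t.dom ≫ d) ≫ π = X'.map ≫ t.cod ≫ c) :
    R.restrict G X' (t.cod ≫ c) (t.dom ≫ d) w' = t.cod ≫ R.restrict G X c d w := by
  rw [restrict, restrict, ← reassoc_of% R.sX_natural t]
  refine _ ≫= G.uniform' (R.baseChangeHom t) _ _ ?_ rfl
  rw [reassoc_of% R.JX_natural t]

/-- A uniform lift on `r` gives a uniform lift on a homotopy retract of `r` (under the domain). -/
def uniformLift : UniformLift π i (F.map ≫ m) where
  -- Extend `d` to a base change of `D` as a term of `c` pulled back along `J`, restrict it along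
  -- `s`, and transport the result along the homotopy from `s ≫ J` to the identity.
  fill X c d w := P.app (R.HX X ≫ transport P T X c) (R.restrict G X c d w)
    (R.HX_transport_type P T X c) (R.restrict_type G X c d w)
  -- Over `i` the transport is the identity function (`map_HX_transport`) and the restricted term is
  -- `d`.
  fac_left X c d w := (P.comp_app _ _ _).trans ((P.app_congr _ _ (P.idFun_type _) rfl w.symm
    ((R.map_HX_transport P T X c).trans (congrArg _ w.symm)) (R.map_restrict G X c d w)).trans
      (P.app_idFun d rfl))
  fac_right X c d w := P.app_type _ _ _ _
  uniform {X' X} t c d w := by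
    refine Eq.trans ?_ (P.comp_app (R.HX_transport_type P T X c) (R.restrict_type G X c d w)
      t.cod).symm
    refine P.app_congr _ _ _ _ rfl ?_ (R.restrict_natural G t c d w _)
    rw [transport_natural, ← reassoc_of% R.HX_natural t]

end

end HomotopyRetract

end Transport

end

end UnivCat

/-! ### Pushforwards as base changes of the polynomial functor, and the generic pair of fibrations.
-/

namespace UnivCat

noncomputable section

variable {C : Type u} [Category.{v} C]

namespace BaseChange

variable {K L S : C} {i : K ⟶ L} {l : L ⟶ S}

lemma isIso_codMap (D : BaseChange i l) [IsIso D.hom] : IsIso D.codMap :=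
  D.isPullback_cod.isIso_snd_of_isIso

lemma isIso_domMap (D : BaseChange i l) [IsIso D.hom] : IsIso D.domMap :=
  have := D.isIso_codMap
  D.isPullback_dom.isIso_snd_of_isIso

/-- A map is a base change of its base change along an isomorphism. -/
abbrev symm (D : BaseChange i l) [IsIso D.hom] : BaseChange D.map D.toBase :=
  have := D.isIso_codMap
  have := D.isIso_domMap
  { base := S
    hom := inv D.hom
    dom := K
    cod := L
    map := i
    toBase := l
    domMap := inv D.domMap
    codMap := inv D.codMap
    isPullback_cod := IsPullback.of_vert_isIso ⟨by
      rw [IsIso.eq_inv_comp, ← reassoc_of% D.isPullback_cod.w, IsIso.hom_inv_id, Category.comp_id]⟩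
    isPullback_dom := IsPullback.of_vert_isIso ⟨by
      rw [IsIso.eq_inv_comp, ← reassoc_of% D.isPullback_dom.w, IsIso.hom_inv_id, Category.comp_id]⟩ }

end BaseChange

variable [HasFiniteLimits C] {Ut U : C} {π : Ut ⟶ U} [ChosenPullbacksAlong π]
  [ExponentiableMorphism π]

section PolyPt

variable {A : C} (q : Fibration π A) {Z V : C}

/-- The map `q_* Y ⟶ P_π(Z)` induced by a map `Y ⟶ Z`. -/
def polyPt (Y : Over q.dom) (y : Y.left ⟶ Z) : push q.map Y ⟶ (poly π).obj Z :=
  classify (q.paste' (pushSq q Y)) (eval q Y ≫ y)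

/-- `polyPt` classifies evaluation followed by `y`, and evaluating a transpose gives back the
transposed map (`lift_eval`). -/
lemma curry_polyPt {X W : C} {x : X ⟶ A} {w₁ : W ⟶ X} {w₂ : W ⟶ q.dom}
    (sq : IsPullback w₁ w₂ x q.map) (Y : Over q.dom) (y : Y.left ⟶ Z) (z : W ⟶ Y.left)
    (hz : z ≫ Y.hom = w₂) : curry sq z hz ≫ polyPt q Y y = classify (q.paste' sq) (z ≫ y) := by
  have h : (w₁ ≫ curry sq z hz) ≫ pushHom q.map Y = w₂ ≫ q.map := by
    rw [Category.assoc, curry_hom, sq.w]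
  have e := lift_eval q sq z hz ((pushSq q Y).lift _ _ h) (IsPullback.lift_fst ..)
    (IsPullback.lift_snd ..)
  refine (comp_classify (q.paste' (pushSq q Y)) (q.paste' sq) (curry sq z hz)
    ((pushSq q Y).lift _ _ h) ?_ (IsPullback.lift_fst ..) ?_ _).trans ?_
  · rw [← Category.assoc, curry_hom]
  · rw [← Category.assoc, IsPullback.lift_snd]
  · rw [← Category.assoc, e]

lemma pushMap_polyPt {Y Y' : Over q.dom} (f : Y' ⟶ Y) (y : Y.left ⟶ Z) :
    pushMap q.map f ≫ polyPt q Y y = polyPt q Y' (f.left ≫ y) := by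
  have h := curry_comp (pushSq q Y') (eval q Y') (eval_hom q Y') f
  rw [curry_eval] at h
  rw [← Category.id_comp (pushMap q.map f)]
  refine (h =≫ _).trans ((curry_polyPt q _ _ _ _ _).trans ?_)
  rw [Category.assoc]
  rfl

lemma polyPt_map (Y : Over q.dom) (y : Y.left ⟶ Z) (f : Z ⟶ V) :
    polyPt q Y y ≫ (poly π).map f = polyPt q Y (y ≫ f) := by
  rw [polyPt, classify_map, Category.assoc]
  rfl

/-- A map on `Y` that factors through `q.dom` does not see the section, so what it classifies
depends only on the point of `A`. -/
lemma polyPt_hom_comp (Y : Over q.dom) (n : q.dom ⟶ V) :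
    polyPt q Y (Y.hom ≫ n) = pushHom q.map Y ≫ classify q.isPullback n := by
  rw [comp_classify q.isPullback (q.paste' (pushSq q Y)) (pushHom q.map Y) (pullback.snd _ _) rfl
    pullback.condition.symm rfl, polyPt, ← Category.assoc, eval_hom]

/-- If `Y` is a pullback of `Z ⟶ V` along `n : q.dom ⟶ V`, then `q_* Y` is a pullback of
`P_π(Z) ⟶ P_π(V)`. -/
lemma isPullback_polyPt {n : q.dom ⟶ V} {f : Z ⟶ V} {Y : Over q.dom} {y : Y.left ⟶ Z}
    (sqY : IsPullback Y.hom y n f) :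
    IsPullback (pushHom q.map Y) (polyPt q Y y) (classify q.isPullback n) ((poly π).map f) := by
  have hsq {X : C} (x : X ⟶ A) := IsPullback.of_hasPullback x q.map
  have hx {X : C} (x : X ⟶ A) : x ≫ classify q.isPullback n =
      classify (q.paste' (hsq x)) (pullback.snd _ _ ≫ n) :=
    comp_classify _ _ x (pullback.snd _ _) rfl pullback.condition.symm rfl _
  -- After transposing, a cone consists of a point of `A` and a map from its pullback along `q` to
  -- `Z`, compatible with `n`. As `Y` is a pullback, this is a map to `Y` over `q.dom`, that is, a
  -- map to the pushforward.
  have ex (s : PullbackCone (classify q.isPullback n) ((poly π).map f)) :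
      ∃ l : s.pt ⟶ push q.map Y, l ≫ pushHom q.map Y = s.fst ∧ l ≫ polyPt q Y y = s.snd := by
    have hs := s.condition
    have hs' := hs =≫ polyHom π V
    rw [Category.assoc, Category.assoc, classify_hom, poly_map_hom] at hs'
    obtain ⟨k, hk⟩ := exists_classify (q.paste' (hsq s.fst)) s.snd hs'.symm
    rw [← hk, hx, classify_map] at hs
    have hn := classify_injective _ hs
    refine ⟨curry (hsq s.fst) (sqY.lift _ k hn) (sqY.lift_fst ..), curry_hom .., ?_⟩
    rw [curry_polyPt, IsPullback.lift_snd, hk]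
  refine ⟨⟨?_⟩, ⟨PullbackCone.IsLimit.mk _ (fun s ↦ (ex s).choose)
    (fun s ↦ (ex s).choose_spec.1) (fun s ↦ (ex s).choose_spec.2) (fun s m h1 h2 ↦ ?_)⟩⟩
  · rw [← polyPt_hom_comp, polyPt_map, sqY.w]
  · obtain ⟨h3, h4⟩ := (ex s).choose_spec
    generalize (ex s).choose = l at h3 h4
    obtain ⟨z, hz, rfl⟩ := exists_curry q (hsq s.fst) m h1
    obtain ⟨z', hz', rfl⟩ := exists_curry q (hsq s.fst) l h3
    refine curry_congr _ (sqY.hom_ext (hz.trans hz'.symm) ?_)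
    rw [curry_polyPt] at h2 h4
    exact classify_injective _ (h2.trans h4.symm)

variable (P : PiStructure π) (I : PreIdStructure π)

/-- `q_*(refl)` as a base change of `P_π(refl)`. -/
abbrev pushReflBaseChange (E : Fibration π q.dom) :
    BaseChange ((poly π).map I.genericRefl) ((poly π).map I.genericHom) where
  base := A
  hom := classify q.isPullback E.name
  dom := (pushFib P q E).dom
  cod := (pushPath P I q E).dom
  map := pushRefl P I q E
  toBase := pushHom q.map (Over.mk (pathHom I E))
  domMap := polyPt q (Over.mk E.map) E.point
  codMap := polyPt q (Over.mk (pathHom I E)) (I.pathToGeneric E)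
  isPullback_cod := isPullback_polyPt q (Y := Over.mk (pathHom I E)) (I.isPullback_pathToGeneric E)
  -- Pasting law again: generic reflexivity lies over `U`, so the outer rectangle exhibits `q_* E`
  -- as a pullback of `P_π(π)`.
  isPullback_dom := by
    refine IsPullback.of_right ?_ ?_ (isPullback_polyPt q (Y := Over.mk (pathHom I E))
      (I.isPullback_pathToGeneric E))
    · have h1 : I.genericRefl ≫ I.genericHom = π := by
        rw [PreIdStructure.genericHom, PreIdStructure.genericRefl_map_assoc,
          pullback.diagonal_fst_assoc]
      have h2 : pushRefl P I q E ≫ pushHom q.map (Over.mk (pathHom I E)) =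
          pushHom q.map (Over.mk E.map) := pushMap_hom q.map (reflOver I E)
      rw [← Functor.map_comp, h1, h2]
      exact isPullback_polyPt q (Y := Over.mk E.map) E.isPullback
    · refine (pushMap_polyPt q (reflOver I E) _).trans (Eq.trans ?_ (polyPt_map q _ _ _).symm)
      exact congrArg (polyPt q (Over.mk E.map)) (I.refl_pathToGeneric E)

lemma pushPath_map_hom (E : Fibration π q.dom) :
    (pushPath P I q E).map ≫ pushPairHom P q E = pushHom q.map (Over.mk (pathHom I E)) := by
  refine (Category.assoc _ _ _).symm.trans ((pullback.lift_fst _ _ _ =≫ _).trans ?_)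
  exact pushMap_hom _ _

end PolyPt

section Generic

variable (π) in
-- A map to `P_π(U)` is a map to `U` together with a family over the fibration it names. The
-- identity of `P_π(U)` yields the universal such family.
lemma exists_genericName : ∃ n : (selected π (polyHom π U)).dom ⟶ U,
    classify (selected π (polyHom π U)).isPullback n = 𝟙 ((poly π).obj U) :=
  exists_classify _ _ (Category.id_comp _)

variable (π) in
/-- The generic `π`-fibration of a pair of composable `π`-fibrations, over `P_π(U)`. -/
def genericBase : Fibration π ((poly π).obj U) := selected π (polyHom π U)

variable (π) in
/-- The generic `π`-fibration over the total object of a `π`-fibration. -/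
def genericTotal : Fibration π (genericBase π).dom := selected π (exists_genericName π).choose

variable (π) in
lemma classify_generic : classify (genericBase π).isPullback (genericTotal π).name = 𝟙 _ :=
  (exists_genericName π).choose_spec

end Generic

/-! ### From type-theoretic to pointed functional extensionality. -/

section TTPtdFunExt

variable {I : IdStructure π} {P : PiStructure π}

/-- The homotopy retract provided by a type-theoretic function extensionality structure. -/
def TTPtdFunExt.homotopyRetract (T : TTPtdFunExt I P) {A : C} (q : Fibration π A)
    (E : Fibration π q.dom) : HomotopyRetract I.1 (pushPath P I.1 q E) (pushPairHom P q E)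
      (pushRefl P I.1 q E) (I.refl (pushFib P q E)) (pathHom I.1 (pushFib P q E)) where
  J := pathToPush I P q E
  s := T.s q E
  J_over := by rw [← Category.assoc, pathToPush_map]
  s_over := by rw [← T.s_over q E, Category.assoc]
  r_J := refl_pathToPush I P q E
  i_s := T.s_under q E
  H := T.Hs q E

/-- Uniform lifts of `q_*(refl)` against `π`. -/
def TTPtdFunExt.uniformLift (T : TTPtdFunExt I P) {A : C} (q : Fibration π A)
    (E : Fibration π q.dom) :
    UniformLift π (pushRefl P I.1 q E) ((pushPath P I.1 q E).map ≫ pushPairHom P q E) :=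
  -- Both lifts come from `Id`-elimination. Reflexivity of `q_* E` is already over `A`; that of
  -- `q_*(Id_B E)` is over `q_* E ×_A q_* E` and is regarded over `A` by `image`.
  (T.homotopyRetract q E).uniformLift P (I.uniformLift.baseChange (I.pathBaseChange _))
    ((I.uniformLift.baseChange (I.pathBaseChange _)).image (pushPairHom P q E))

/-- At the generic pair the classifying map is an identity, so the base change from `P_π(refl)` to
`q_*(refl)` can be inverted by `D.symm`. This gives lifts of `P_π(refl)` over `P_π(U)`, and then
over `U` by `image`. -/
lemma TTPtdFunExt.nonempty_ptdFunExt (T : TTPtdFunExt I P) :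
    Nonempty (PtdFunExt I.toPreIdStructure) := by
  let D := pushReflBaseChange (genericBase π) P I.1 (genericTotal π)
  have hD : IsIso D.hom := by
    dsimp only [D]
    rw [classify_generic]
    infer_instance
  have F : UniformLift π D.map D.toBase := by
    have := T.uniformLift (genericBase π) (genericTotal π)
    rwa [pushPath_map_hom] at this
  have G := (F.baseChange D.symm).image (polyHom π U)
  have e : D.symm.toBase ≫ polyHom π U = polyHom π I.generic.dom := poly_map_hom π I.genericHom
  rw [e] at G
  exact ⟨UniformLift.toStructured G⟩

end TTPtdFunExt

end

end UnivCat

/-! ### Pulling back homotopies, and lifting against fibrations. -/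

namespace UnivCat

noncomputable section

variable {C : Type u} [Category.{v} C] {Ut U : C} {π : Ut ⟶ U}

namespace Fibration

variable {A A' A'' : C}

lemma comparison_trans (q'' : Fibration π A'') (q' : Fibration π A') (q : Fibration π A)
    {f' : A'' ⟶ A'} {f : A' ⟶ A} {g : A'' ⟶ A} (h' : q''.name = f' ≫ q'.name)
    (h : q'.name = f ≫ q.name) (hg : q''.name = g ≫ q.name) (e : f' ≫ f = g) :
    q''.comparison q' f' h' ≫ q'.comparison q f h = q''.comparison q g hg := by
  apply q.hom_ext <;> simp [e]

/-- The map into a base change of `q` determined by a map to the base and a map to `q`. -/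
def pullLift (q' : Fibration π A') (q : Fibration π A) {f : A' ⟶ A} (h : q'.name = f ≫ q.name)
    {X : C} (x : X ⟶ A') (y : X ⟶ q.dom) (w : x ≫ f = y ≫ q.map) : X ⟶ q'.dom :=
  (isPullback_comparison q' q f h).lift x y w

section

variable (q' : Fibration π A') (q : Fibration π A) {f : A' ⟶ A} (h : q'.name = f ≫ q.name)
  {X : C} (x : X ⟶ A') (y : X ⟶ q.dom) (w : x ≫ f = y ≫ q.map)

lemma pullLift_map : q'.pullLift q h x y w ≫ q'.map = x := IsPullback.lift_fst ..

lemma pullLift_comparison : q'.pullLift q h x y w ≫ q'.comparison q f h = y :=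
  IsPullback.lift_snd ..

lemma pullLift_point : q'.pullLift q h x y w ≫ q'.point = y ≫ q.point := by
  rw [← comparison_point q' q f h, ← Category.assoc, pullLift_comparison]

include h in
lemma hom_ext_comparison {a b : X ⟶ q'.dom} (h1 : a ≫ q'.map = b ≫ q'.map)
    (h2 : a ≫ q'.comparison q f h = b ≫ q'.comparison q f h) : a = b :=
  (isPullback_comparison q' q f h).hom_ext h1 h2

end

end Fibration

variable [HasFiniteLimits C] [ChosenPullbacksAlong π]

section ConstHomotopy

variable {I : PreIdStructure π} {B B' : C}

lemma PreIdStructure.pairComparison_trans {B'' : C} (E'' : Fibration π B'') (E' : Fibration π B')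
    (E : Fibration π B) {f' : B'' ⟶ B'} {f : B' ⟶ B} {g : B'' ⟶ B} (h' : E''.name = f' ≫ E'.name)
    (h : E'.name = f ≫ E.name) (hg : E''.name = g ≫ E.name) (e : f' ≫ f = g) :
    pairComparison E'' E' f' h' ≫ pairComparison E' E f h = pairComparison E'' E g hg := by
  apply pullback.hom_ext
  · simp [Fibration.comparison_trans E'' E' E h' h hg e]
  · simp [Fibration.comparison_trans E'' E' E h' h hg e]

/-- The base change of a homotopy. -/
def ConstHomotopy.pull {F' : Fibration π B'} {F : Fibration π B} {b : B' ⟶ B}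
    (h : F'.name = b ≫ F.name) {W X W' X' : C} {i : W ⟶ X} {f g : X ⟶ F.dom}
    (H : ConstHomotopy I F i f g) {i' : W' ⟶ X'} {f' g' : X' ⟶ F'.dom} (u : X' ⟶ X) (v : W' ⟶ W)
    (hi : i' ≫ u = v ≫ i) (hf : f' ≫ F'.comparison F b h = u ≫ f)
    (hg : g' ≫ F'.comparison F b h = u ≫ g) (hfg : f' ≫ F'.map = g' ≫ F'.map)
    (hc : i' ≫ f' = i' ≫ g') : ConstHomotopy I F' i' f' g' :=
  -- The identity type of `F'` is a base change of that of `F`, so the new homotopy is assembled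
  -- from its endpoints and from the old homotopy restricted along `u`.
  have e1 : pullback.lift f' g' hfg ≫ PreIdStructure.pairComparison F' F b h =
      (u ≫ H.hom) ≫ (I.path F).map := by
    apply pullback.hom_ext
    · simp [H.hom_fst, hf, pullback.lift_fst_assoc]
    · simp [H.hom_snd, hg, pullback.lift_snd_assoc]
  have e2 := (I.path F').pullLift_map (I.path F) (I.path_name_baseChange F' F b h) _ _ e1
  { hom := (I.path F').pullLift (I.path F) (I.path_name_baseChange F' F b h)
      (pullback.lift f' g' hfg) (u ≫ H.hom) e1
    hom_fst := by rw [reassoc_of% e2, pullback.lift_fst]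
    hom_snd := by rw [reassoc_of% e2, pullback.lift_snd]
    const := by
      apply (I.path F').hom_ext_comparison (I.path F) (I.path_name_baseChange F' F b h)
      · rw [Category.assoc, e2, Category.assoc, Category.assoc, PreIdStructure.refl_map]
        apply pullback.hom_ext
        · simp [pullback.lift_fst]
        · simp [pullback.lift_snd, hc]
      · have e3 := I.refl_pathComparison F' F b h
        dsimp only [PreIdStructure.pathComparison] at e3
        rw [Category.assoc, Fibration.pullLift_comparison, Category.assoc, Category.assoc, e3,
          reassoc_of% hi, H.const, reassoc_of% hf, reassoc_of% hi] }

/-- A homotopy is determined by its endpoints and its point, so this formula reduces stability of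
pulled-back homotopies to stability of their endpoints. -/
lemma ConstHomotopy.pull_point {F' : Fibration π B'} {F : Fibration π B} {b : B' ⟶ B}
    (h : F'.name = b ≫ F.name) {W X W' X' : C} {i : W ⟶ X} {f g : X ⟶ F.dom}
    (H : ConstHomotopy I F i f g) {i' : W' ⟶ X'} {f' g' : X' ⟶ F'.dom} (u : X' ⟶ X) (v : W' ⟶ W)
    (hi : i' ≫ u = v ≫ i) (hf : f' ≫ F'.comparison F b h = u ≫ f)
    (hg : g' ≫ F'.comparison F b h = u ≫ g) (hfg : f' ≫ F'.map = g' ≫ F'.map)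
    (hc : i' ≫ f' = i' ≫ g') :
    (H.pull h u v hi hf hg hfg hc).hom ≫ (I.path F').point = u ≫ H.hom ≫ (I.path F).point :=
  (Fibration.pullLift_point ..).trans (Category.assoc _ _ _)

variable (π) in
/-- The (unstructured) left lifting property against base changes of `π`. -/
def HasLifts {K L : C} (i : K ⟶ L) : Prop :=
  ∀ (c : L ⟶ U) (d : K ⟶ Ut), d ≫ π = i ≫ c → ∃ e : L ⟶ Ut, i ≫ e = d ∧ e ≫ π = c

/-- As `F` is a pullback of `π`, only the `π`-point of the lift has to be found. -/
lemma HasLifts.exists_lift {K L : C} {i : K ⟶ L} (h : HasLifts π i) (F : Fibration π B)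
    (b : L ⟶ B) (k : K ⟶ F.dom) (w : k ≫ F.map = i ≫ b) :
    ∃ s : L ⟶ F.dom, i ≫ s = k ∧ s ≫ F.map = b := by
  obtain ⟨e, h1, h2⟩ := h (b ≫ F.name) (k ≫ F.point) (by
    rw [Category.assoc, ← F.isPullback.w, reassoc_of% w])
  refine ⟨F.lift b e h2.symm, ?_, F.lift_map _ _ _⟩
  apply F.hom_ext <;> simp [w, h1]

/-- A homotopy constant along `i` is a diagonal filler of `i` against `ev_∂`, with reflexivity as
upper edge. -/
lemma HasLifts.nonempty_constHomotopy {K L : C} {i : K ⟶ L} (h : HasLifts π i) (F : Fibration π B)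
    {f g : L ⟶ F.dom} (hfg : f ≫ F.map = g ≫ F.map) (hi : i ≫ f = i ≫ g) :
    Nonempty (ConstHomotopy I F i f g) := by
  obtain ⟨s, h1, h2⟩ := h.exists_lift (I.path F) (pullback.lift f g hfg) (i ≫ f ≫ I.refl F) (by
    rw [Category.assoc, Category.assoc, PreIdStructure.refl_map]
    apply pullback.hom_ext
    · simp [pullback.lift_fst]
    · simp [pullback.lift_snd, hi])
  exact ⟨⟨s, by rw [reassoc_of% h2, pullback.lift_fst], by rw [reassoc_of% h2, pullback.lift_snd],
    h1⟩⟩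

lemma IdStructure.hasLifts_refl (I : IdStructure π) (E : Fibration π B) : HasLifts π (I.refl E) :=
  fun c d w ↦ ⟨I.elim E c d w, I.refl_elim E c d w, I.elim_type E c d w⟩

end ConstHomotopy

/-! ### Stability of `q_*(refl)` and `J` under base change. -/

section Comparison

variable [ExponentiableMorphism π] (P : PiStructure π) {A A' : C} {q' : Fibration π A'}
  {q : Fibration π A} {f : A' ⟶ A} (hq : q'.name = f ≫ q.name) {E' : Fibration π q'.dom}
  {E : Fibration π q.dom} (hE : E'.name = q'.comparison q f hq ≫ E.name)

include hE in
-- Classifying maps compose with base change. This is the source of the stability of all data pulled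
-- back from the generic pair.
lemma comp_classify_name :
    f ≫ classify q.isPullback E.name = classify q'.isPullback E'.name := by
  rw [hE]
  exact comp_classify q.isPullback q'.isPullback f (q'.comparison q f hq) hq.symm
    (q'.comparison_map q f hq) (q'.comparison_point q f hq) _

lemma pushComparison_hom : pushComparison P hq hE ≫ pushHom q.map (Over.mk E.map) =
    pushHom q'.map (Over.mk E'.map) ≫ f :=
  Fibration.comparison_map ..

lemma polyPt_point_map (E : Fibration π q.dom) :
    polyPt q (Over.mk E.map) E.point ≫ (poly π).map π =
      pushHom q.map (Over.mk E.map) ≫ classify q.isPullback E.name := by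
  rw [polyPt_map, ← polyPt_hom_comp]
  exact congrArg (polyPt q (Over.mk E.map)) E.isPullback.w.symm

/-- The comparison is defined through codes, yet it preserves the underlying sections. By the
`Π`-square it suffices to compare the images in `P_π(U)`, where classifying maps compose, and the
codes, where it holds by construction. -/
lemma pushComparison_polyPt : pushComparison P hq hE ≫ polyPt q (Over.mk E.map) E.point =
    polyPt q' (Over.mk E'.map) E'.point := by
  apply P.isPullback.hom_ext
  · refine (Category.assoc _ _ _).trans ((_ ≫= polyPt_point_map E).trans
      (Eq.trans ?_ (polyPt_point_map E').symm))
    rw [← comp_classify_name hq hE]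
    exact (Category.assoc _ _ _).symm.trans ((pushComparison_hom P hq hE =≫ _).trans
      (Category.assoc _ _ _))
  · exact (Category.assoc _ _ _).trans
      (Fibration.comparison_point _ _ _ (pushFib_name_baseChange P hq hE))

/-- This expresses the code of `q_*(refl)` through the section classified in `P_π(Ut)`, whose
behaviour under base change is given by `pushComparison_polyPt`. -/
lemma pushRefl_point (I : PreIdStructure π) (E : Fibration π q.dom) :
    pushRefl P I q E ≫ (pushPath P I q E).point =
      polyPt q (Over.mk E.map) E.point ≫ (poly π).map I.reflName ≫ P.lam := by
  have h : pushMap q.map (reflOver I E) ≫ polyPt q (Over.mk (pathHom I E)) (I.path E).point =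
      polyPt q (Over.mk E.map) E.point ≫ (poly π).map I.reflName :=
    (pushMap_polyPt q (reflOver I E) _).trans
      ((congrArg (polyPt q (Over.mk E.map)) (I.refl_point E)).trans (polyPt_map q _ _ _).symm)
  exact (Category.assoc _ _ _).symm.trans ((h =≫ P.lam).trans (Category.assoc _ _ _))

lemma pushRefl_comparison (I : PreIdStructure π) :
    pushRefl P I q' E' ≫ pushPathComparison P I hq hE =
      pushComparison P hq hE ≫ pushRefl P I q E := by
  apply (pushPath P I q E).hom_ext
  · rw [Category.assoc, Category.assoc, pushPathComparison, Fibration.comparison_map, pushRefl_map,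
      ← Category.assoc, pushRefl_map]
    apply pullback.hom_ext
    · rw [Category.assoc, pushPairComparison_fst]
      simp
    · rw [Category.assoc, pushPairComparison_snd]
      simp
  · rw [Category.assoc, Category.assoc, pushPathComparison, Fibration.comparison_point,
      pushRefl_point, pushRefl_point, ← pushComparison_polyPt P hq hE]
    exact Category.assoc _ _ _

/-- `J` is an elimination whose motive is the name of `q_*(Id_B E)` and whose value on reflexivity
is `q_*(refl)`. Both are stable, so `elim_baseChange` applies. -/
lemma pathToPush_comparison (I : IdStructure π) :
    pathToPush I P q' E' ≫ pushPathComparison P I.1 hq hE =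
      pathPushComparison P I.1 hq hE ≫ pathToPush I P q E := by
  apply (pushPath P I.1 q E).hom_ext
  · rw [Category.assoc, Category.assoc, pushPathComparison, Fibration.comparison_map, pathToPush_map,
      ← Category.assoc, pathToPush_map]
    exact (I.pathComparison_map ..).symm
  · rw [Category.assoc, Category.assoc, pushPathComparison, Fibration.comparison_point, pathToPush,
      pathToPush, Fibration.lift_point, Fibration.lift_point]
    refine I.elim_baseChange (pushFib P q' E') (pushFib P q E) f (pushFib_name_baseChange P hq hE)
      _ _ ?_ ?_
    · rw [← Category.assoc, I.pathComparison_map, Category.assoc,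
        pushPath_name_baseChange P I.1 hq hE]
      rfl
    · have h := pushRefl_comparison P hq hE I.1 =≫ (pushPath P I.1 q E).point
      rw [Category.assoc, Category.assoc, pushPathComparison, Fibration.comparison_point] at h
      exact h

section Trans

variable {A'' : C} {q'' : Fibration π A''} {f' : A'' ⟶ A'} (hq' : q''.name = f' ≫ q'.name)
  {E'' : Fibration π q''.dom} (hE' : E''.name = q''.comparison q' f' hq' ≫ E'.name)
  {g : A'' ⟶ A} (hg : q''.name = g ≫ q.name) (hEg : E''.name = q''.comparison q g hg ≫ E.name)

lemma pushPathComparison_trans (I : PreIdStructure π) (e : f' ≫ f = g) :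
    pushPathComparison P I hq' hE' ≫ pushPathComparison P I hq hE =
      pushPathComparison P I hg hEg :=
  Fibration.comparison_trans _ _ _ _ _ _ (PreIdStructure.pairComparison_trans _ _ _ _ _ _ e)

lemma pathPushComparison_trans (I : PreIdStructure π) (e : f' ≫ f = g) :
    pathPushComparison P I hq' hE' ≫ pathPushComparison P I hq hE =
      pathPushComparison P I hg hEg :=
  Fibration.comparison_trans _ _ _ (I.path_name_baseChange _ _ _ _)
    (I.path_name_baseChange _ _ _ _) (I.path_name_baseChange _ _ _ _)
    (PreIdStructure.pairComparison_trans _ _ _ _ _ _ e)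

end Trans

end Comparison

end

end UnivCat

/-! ### From pointed to type-theoretic functional extensionality, through the generic pair. -/

namespace UnivCat

noncomputable section

variable {C : Type u} [Category.{v} C] [HasFiniteLimits C] {Ut U : C} {π : Ut ⟶ U}
  [ChosenPullbacksAlong π] [ExponentiableMorphism π]

section ToGeneric

variable {A : C} (q : Fibration π A) (E : Fibration π q.dom)

lemma name_eq_generic : q.name = classify q.isPullback E.name ≫ (genericBase π).name :=
  (classify_hom q.isPullback E.name).symm

/-- The two families over `q.dom` have the same classifying map, because the generic pair is
classified by the identity. Hence every pair is a base change of the generic one. -/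
lemma name_eq_genericTotal : E.name =
    q.comparison (genericBase π) _ (name_eq_generic q E) ≫ (genericTotal π).name := by
  apply classify_injective q.isPullback
  rw [← comp_classify (genericBase π).isPullback q.isPullback (classify q.isPullback E.name)
    (q.comparison (genericBase π) _ (name_eq_generic q E)) (name_eq_generic q E).symm
    (Fibration.comparison_map ..) (Fibration.comparison_point ..), classify_generic,
    Category.comp_id]

end ToGeneric

section

variable (I : IdStructure π) (P : PiStructure π)

/-- The data of a type-theoretic function extensionality structure at the generic pair of
`π`-fibrations. -/
structure GenericFunExt where
  s : (pushPath P I.1 (genericBase π) (genericTotal π)).dom ⟶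
    (I.path (pushFib P (genericBase π) (genericTotal π))).dom
  s_over : s ≫ (I.path (pushFib P (genericBase π) (genericTotal π))).map =
    (pushPath P I.1 (genericBase π) (genericTotal π)).map
  s_under : pushRefl P I.1 (genericBase π) (genericTotal π) ≫ s =
    I.refl (pushFib P (genericBase π) (genericTotal π))
  Hs : ConstHomotopy I.1 (pushPath P I.1 (genericBase π) (genericTotal π))
    (pushRefl P I.1 (genericBase π) (genericTotal π))
    (s ≫ pathToPush I P (genericBase π) (genericTotal π)) (𝟙 _)
  Hr : ConstHomotopy I.1 (I.path (pushFib P (genericBase π) (genericTotal π)))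
    (I.refl (pushFib P (genericBase π) (genericTotal π)))
    (pathToPush I P (genericBase π) (genericTotal π) ≫ s) (𝟙 _)

variable {I P}

/-- At the generic pair `q_*(refl)` is isomorphic to `P_π(refl)`, so the component of the structured
lift at the terminal object of the slice over `U` solves its lifting problems. -/
lemma PtdFunExt.hasLifts (F : PtdFunExt I.toPreIdStructure) :
    HasLifts π (pushRefl P I.1 (genericBase π) (genericTotal π)) := by
  let D := pushReflBaseChange (genericBase π) P I.1 (genericTotal π)
  have hD : IsIso D.hom := by
    dsimp only [D]
    rw [classify_generic]
    infer_instance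
  have := D.isIso_codMap
  -- Since `D.codMap` is invertible, `D.map` is also a base change of `P_π(refl)` along the identity
  -- of `U`.
  let D' : BaseChange ((poly π).map I.genericRefl) (polyHom π I.generic.dom) :=
    { base := U
      hom := 𝟙 U
      dom := D.dom
      cod := D.cod
      map := D.map
      toBase := D.codMap ≫ polyHom π I.generic.dom
      domMap := D.domMap
      codMap := D.codMap
      isPullback_cod := IsPullback.of_vert_isIso ⟨Category.comp_id _⟩
      isPullback_dom := D.isPullback_dom }
  intro c d w
  exact ⟨(UniformLift.ofStructured F).fill D' c d w, (UniformLift.ofStructured F).fac_left D' c d w,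
    (UniformLift.ofStructured F).fac_right D' c d w⟩

lemma PtdFunExt.nonempty_genericFunExt (F : PtdFunExt I.toPreIdStructure) :
    Nonempty (GenericFunExt I P) := by
  have h := F.hasLifts (P := P)
  -- `s` fills the square from `q_*(refl)` to `ev_∂` of the identity type of `q_* E`, whose upper
  -- edge is reflexivity; both composites are the diagonal.
  obtain ⟨s, h1, h2⟩ := h.exists_lift (I.path (pushFib P (genericBase π) (genericTotal π)))
    (pushPath P I.1 (genericBase π) (genericTotal π)).map
    (I.refl (pushFib P (genericBase π) (genericTotal π)))
    ((I.refl_map _).trans (pushRefl_map ..).symm)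
  obtain ⟨Hs⟩ := h.nonempty_constHomotopy (I := I.1)
    (pushPath P I.1 (genericBase π) (genericTotal π))
    (f := s ≫ pathToPush I P (genericBase π) (genericTotal π)) (g := 𝟙 _)
    (by rw [Category.assoc, pathToPush_map, h2, Category.id_comp])
    (by rw [reassoc_of% h1, refl_pathToPush, Category.comp_id])
  -- This homotopy starts on an identity type and is prescribed along reflexivity, so
  -- `Id`-elimination produces it.
  obtain ⟨Hr⟩ := (I.hasLifts_refl (pushFib P (genericBase π) (genericTotal π))).nonempty_constHomotopy
    (I := I.1) (I.path (pushFib P (genericBase π) (genericTotal π)))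
    (f := pathToPush I P (genericBase π) (genericTotal π) ≫ s) (g := 𝟙 _)
    (by rw [Category.assoc, h2, pathToPush_map, Category.id_comp])
    (by rw [← Category.assoc, refl_pathToPush, h1, Category.comp_id])
  exact ⟨⟨s, h2, h1, Hs, Hr⟩⟩

namespace GenericFunExt

variable (G : GenericFunExt I P) {A A' : C} (q : Fibration π A) (E : Fibration π q.dom)

/-- The comparison of `q_*(Id_B E)` with its generic instance. -/
abbrev toL : (pushPath P I.1 q E).dom ⟶ (pushPath P I.1 (genericBase π) (genericTotal π)).dom :=
  pushPathComparison P I.1 (name_eq_generic q E) (name_eq_genericTotal q E)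

/-- The comparison of `Id_A(q_* E)` with its generic instance. -/
abbrev toD : (I.path (pushFib P q E)).dom ⟶
    (I.path (pushFib P (genericBase π) (genericTotal π))).dom :=
  pathPushComparison P I.1 (name_eq_generic q E) (name_eq_genericTotal q E)

/-- The comparison of `q_* E ×_A q_* E` with its generic instance. -/
abbrev toM : pushPair P q E ⟶ pushPair P (genericBase π) (genericTotal π) :=
  pushPairComparison P (name_eq_generic q E) (name_eq_genericTotal q E)

lemma path_name_generic : (I.path (pushFib P q E)).name =
    toM q E ≫ (I.path (pushFib P (genericBase π) (genericTotal π))).name :=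
  I.path_name_baseChange ..

lemma pushPath_name_generic : (pushPath P I.1 q E).name =
    toM q E ≫ (pushPath P I.1 (genericBase π) (genericTotal π)).name :=
  pushPath_name_baseChange ..

lemma toL_map : toL q E ≫ (pushPath P I.1 (genericBase π) (genericTotal π)).map =
    (pushPath P I.1 q E).map ≫ toM q E :=
  Fibration.comparison_map ..

/-- The pullback of `s` to an arbitrary pair of `π`-fibrations. -/
def sAt : (pushPath P I.1 q E).dom ⟶ (I.path (pushFib P q E)).dom :=
  (I.path (pushFib P q E)).pullLift _ (path_name_generic q E) (pushPath P I.1 q E).map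
    (toL q E ≫ G.s) (by rw [Category.assoc, G.s_over, toL_map])

lemma sAt_over : G.sAt q E ≫ (I.path (pushFib P q E)).map = (pushPath P I.1 q E).map :=
  Fibration.pullLift_map ..

lemma sAt_toD : G.sAt q E ≫ toD q E = toL q E ≫ G.s :=
  Fibration.pullLift_comparison ..

lemma sAt_point : G.sAt q E ≫ (I.path (pushFib P q E)).point = toL q E ≫ G.s ≫
    (I.path (pushFib P (genericBase π) (genericTotal π))).point :=
  (Fibration.pullLift_point ..).trans (Category.assoc _ _ _)

lemma sAt_under : pushRefl P I.1 q E ≫ G.sAt q E = I.refl (pushFib P q E) := by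
  apply (I.path (pushFib P q E)).hom_ext_comparison _ (path_name_generic q E)
  · rw [Category.assoc, sAt_over, pushRefl_map, PreIdStructure.refl_map]
  · rw [Category.assoc]
    refine (_ ≫= G.sAt_toD q E).trans (Eq.trans ?_ (I.refl_pathComparison _ _ _
      (pushFib_name_baseChange P (name_eq_generic q E) (name_eq_genericTotal q E))).symm)
    rw [reassoc_of% pushRefl_comparison P (name_eq_generic q E) (name_eq_genericTotal q E) I.1,
      G.s_under]
    rfl

/-- The pullback of the homotopy `Hs`. -/
def HsAt : ConstHomotopy I.1 (pushPath P I.1 q E) (pushRefl P I.1 q E)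
    (G.sAt q E ≫ pathToPush I P q E) (𝟙 _) :=
  G.Hs.pull (pushPath_name_generic q E) (toL q E)
    (pushComparison P (name_eq_generic q E) (name_eq_genericTotal q E))
    (pushRefl_comparison P (name_eq_generic q E) (name_eq_genericTotal q E) I.1)
    (by
      refine (Category.assoc _ _ _).trans ((_ ≫= pathToPush_comparison P (name_eq_generic q E)
        (name_eq_genericTotal q E) I).trans ?_)
      exact (Category.assoc _ _ _).symm.trans ((G.sAt_toD q E =≫ _).trans (Category.assoc _ _ _)))
    ((Category.id_comp _).trans (Category.comp_id _).symm)
    (by rw [Category.assoc, pathToPush_map, sAt_over, Category.id_comp])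
    (by rw [← Category.assoc, sAt_under, refl_pathToPush, Category.comp_id])

/-- The pullback of the homotopy `Hr`. -/
def HrAt : ConstHomotopy I.1 (I.path (pushFib P q E)) (I.refl (pushFib P q E))
    (pathToPush I P q E ≫ G.sAt q E) (𝟙 _) :=
  G.Hr.pull (path_name_generic q E) (toD q E)
    (pushComparison P (name_eq_generic q E) (name_eq_genericTotal q E))
    (I.refl_pathComparison ..)
    (by
      refine (Category.assoc _ _ _).trans ((_ ≫= G.sAt_toD q E).trans ?_)
      exact (Category.assoc _ _ _).symm.trans ((pathToPush_comparison P (name_eq_generic q E)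
        (name_eq_genericTotal q E) I =≫ _).trans (Category.assoc _ _ _)))
    ((Category.id_comp _).trans (Category.comp_id _).symm)
    (by rw [Category.assoc, sAt_over, pathToPush_map, Category.id_comp])
    (by rw [← Category.assoc, refl_pathToPush, sAt_under, Category.comp_id])

section

variable {q E} {q' : Fibration π A'} {f : A' ⟶ A} (hq : q'.name = f ≫ q.name)
  {E' : Fibration π q'.dom} (hE : E'.name = q'.comparison q f hq ≫ E.name)

/-- Comparison maps compose as soon as the maps of bases do, which here is `comp_classify_name`. -/
lemma comparison_toL : pushPathComparison P I.1 hq hE ≫ toL q E = toL q' E' :=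
  pushPathComparison_trans P _ _ hq hE _ _ I.1 (comp_classify_name hq hE)

lemma comparison_toD : pathPushComparison P I.1 hq hE ≫ toD q E = toD q' E' :=
  pathPushComparison_trans P _ _ hq hE _ _ I.1 (comp_classify_name hq hE)

/-- Both sides lie over the same map of bases, and the point of each is that of the generic `s`
restricted along the comparison with the generic pair. -/
lemma sAt_stable : G.sAt q' E' ≫ pathPushComparison P I.1 hq hE =
    pushPathComparison P I.1 hq hE ≫ G.sAt q E := by
  apply (I.path (pushFib P q E)).hom_ext
  · rw [Category.assoc, Category.assoc, sAt_over]
    refine (_ ≫= I.pathComparison_map _ _ _ _).trans ?_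
    rw [← Category.assoc, sAt_over]
    exact (Fibration.comparison_map ..).symm
  · rw [Category.assoc, Category.assoc, sAt_point,
      reassoc_of% comparison_toL (I := I) (P := P) hq hE]
    refine (_ ≫= I.pathComparison_point _ _ _ _).trans (G.sAt_point q' E')

/-- A map into an identity type is determined by its two endpoints and its `π`-point, so agreement
of these suffices. -/
lemma constHomotopy_stable {B B' W W' X X' : C} {F : Fibration π B} {F' : Fibration π B'}
    {b : B' ⟶ B} (h : F'.name = b ≫ F.name) {i : W ⟶ X} {i' : W' ⟶ X'} {g g₁ : X ⟶ F.dom}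
    {g' g₁' : X' ⟶ F'.dom} (H : ConstHomotopy I.1 F i g g₁) (H' : ConstHomotopy I.1 F' i' g' g₁')
    (u : X' ⟶ X) (hg : g' ≫ F'.comparison F b h = u ≫ g) (hg₁ : g₁' ≫ F'.comparison F b h = u ≫ g₁)
    (hp : H'.hom ≫ (I.path F').point = u ≫ H.hom ≫ (I.path F).point) :
    H'.hom ≫ I.pathComparison F' F b h = u ≫ H.hom := by
  apply (I.path F).hom_ext
  · rw [Category.assoc, PreIdStructure.pathComparison_map]
    apply pullback.hom_ext
    · have := H'.hom_fst =≫ F'.comparison F b h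
      simp only [Category.assoc, PreIdStructure.pairComparison_fst, H.hom_fst] at this ⊢
      rw [this, hg]
    · have := H'.hom_snd =≫ F'.comparison F b h
      simp only [Category.assoc, PreIdStructure.pairComparison_snd, H.hom_snd] at this ⊢
      rw [this, hg₁]
  · rw [Category.assoc, PreIdStructure.pathComparison_point, hp, Category.assoc]

lemma HsAt_stable : (G.HsAt q' E').hom ≫ pathPushPathComparison P I.1 hq hE =
    pushPathComparison P I.1 hq hE ≫ (G.HsAt q E).hom := by
  refine constHomotopy_stable (pushPath_name_baseChange P I.1 hq hE) (G.HsAt q E) (G.HsAt q' E')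
    (pushPathComparison P I.1 hq hE) ?_ ((Category.id_comp _).trans (Category.comp_id _).symm) ?_
  · refine (Category.assoc _ _ _).trans ((_ ≫= pathToPush_comparison P hq hE I).trans ?_)
    exact (Category.assoc _ _ _).symm.trans
      ((G.sAt_stable hq hE =≫ _).trans (Category.assoc _ _ _))
  · refine (ConstHomotopy.pull_point ..).trans (Eq.trans ?_
      (_ ≫= (ConstHomotopy.pull_point ..).symm))
    rw [← comparison_toL hq hE, Category.assoc]

lemma HrAt_stable : (G.HrAt q' E').hom ≫ pathPathPushComparison P I.1 hq hE =
    pathPushComparison P I.1 hq hE ≫ (G.HrAt q E).hom := by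
  refine constHomotopy_stable (I.path_name_baseChange _ _ _
      (pushFib_name_baseChange P hq hE)) (G.HrAt q E) (G.HrAt q' E')
    (pathPushComparison P I.1 hq hE) ?_ ((Category.id_comp _).trans (Category.comp_id _).symm) ?_
  · refine (Category.assoc _ _ _).trans ((_ ≫= G.sAt_stable hq hE).trans ?_)
    exact (Category.assoc _ _ _).symm.trans
      ((pathToPush_comparison P hq hE I =≫ _).trans (Category.assoc _ _ _))
  · refine (ConstHomotopy.pull_point ..).trans (Eq.trans ?_
      (_ ≫= (ConstHomotopy.pull_point ..).symm))
    rw [← comparison_toD hq hE, Category.assoc]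

end

/-- The generic data determine a type-theoretic function extensionality structure. -/
def ttPtdFunExt : TTPtdFunExt I P where
  s := G.sAt
  -- One map serves as inverse on both sides, since `HrAt` starts from `J` followed by the same
  -- `sAt`.
  r := G.sAt
  s_over := G.sAt_over
  r_over := G.sAt_over
  s_under := G.sAt_under
  r_under := G.sAt_under
  Hs := G.HsAt
  Hr := G.HrAt
  s_stable _ _ _ := G.sAt_stable _ _
  r_stable _ _ _ := G.sAt_stable _ _
  Hs_stable _ _ _ := G.HsAt_stable _ _
  Hr_stable _ _ _ := G.HrAt_stable _ _

end GenericFunExt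

end

end

end UnivCat

theorem mainTheorem3 {C : Type u} [Category.{v} C] [HasFiniteLimits C] {Ut U : C} (π : Ut ⟶ U)
    [ChosenPullbacksAlong π] [ExponentiableMorphism π] (I : UnivCat.IdStructure π)
    (P : UnivCat.PiStructure π) :
    Nonempty (UnivCat.PtdFunExt I.toPreIdStructure) ↔ Nonempty (UnivCat.TTPtdFunExt I P) := by
  constructor
  · rintro ⟨F⟩
    obtain ⟨G⟩ := F.nonempty_genericFunExt (P := P)
    exact ⟨G.ttPtdFunExt⟩
  · rintro ⟨T⟩
    exact T.nonempty_ptdFunExt
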